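/- **Setting.** Let $d\ge 2$ and $s>d/2$. For $\delta>0$ put $\sigma_d=\frac d2-\delta$, and put $\delta_d=\delta$ if $d=2$, $\delta_d=0$ if $d\ge3$. On $\mathbb R^d$ consider a metric $g=I_d+h$ ($h$ real symmetric, vanishing at infinity) with inverse $g^{\alpha\beta}$, Christoffel symbols $\Gamma^\gamma_{\alpha\beta}$ and covariant derivative $\nabla$, written in harmonic coordinates, $g^{\alpha\beta}\Gamma^\gamma_{\alpha\beta}=0$ for all $\gamma$, and a complex tensor $\lambda_{\alpha\beta}$ (the complex second fundamental form), $\lambda_\alpha^\gamma=g^{\gamma\mu}\lambda_{\alpha\mu}$. Assume that the two-form $F_{\alpha\beta}=\mathrm{Im}(\lambda^\gamma_\alpha\bar\lambda_{\beta\gamma})$ is closed in the sense of distributions, which is the integrability condition of the Ricci equations and is automatic if $d=2$. The Coulomb div-curl system for a real one-form $A$ that vanishes at infinity is $$\nabla^\alpha A_\alpha=0,\qquad \nabla_\alpha A_\beta-\nabla_\beta A_\alpha=\mathrm{Im}(\lambda^\gamma_\alpha\bar\lambda_{\beta\gamma}).\tag{1}$$ For $\epsilon>0$ let $\mathcal D_\epsilon$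 be the set of such pairs $(h,\lambda)$ with $$\|\lambda\|_{H^s}\le\epsilon,\qquad \||D|^{\sigma_d}h\|_{H^{s+1-\sigma_d}}\le\epsilon .$$ Fix a smooth radial $\varphi:\mathbb R^d\to[0,1]$ with $\varphi=1$ on $\{|\xi|\le1\}$ and $\varphi=0$ on $\{|\xi|\ge2\}$, and let $S_0$ and $S_k$ ($k\ge1$) be the Fourier multipliers with symbols $\varphi(\xi)$ and $\varphi(2^{-k}\xi)-\varphi(2^{1-k}\xi)$. An admissible frequency envelope for $\lambda\in H^s$ is a nonnegative sequence $(p_{0k})_{k\ge0}\in\ell^2$ with $\|S_k\lambda\|_{H^s}\le p_{0k}$, $p_{0j}\le 2^{\delta|j-k|}p_{0k}$ for all $j,k\ge0$, and $p_{00}\approx\|\lambda\|_{H^s}$. **Proposition (Initial data $A_0$).** There is $\delta_0=\delta_0(d,s)>0$ such that for all $0<\delta<\delta_0$ (and all $\varphi$) there is $\epsilon_1>0$ with the following properties. (i) *Existence and uniqueness.* For $(h,\lambda)\in\mathcal D_{\epsilon_1}$ the system (1) has exactly one solution $A$ with $\||D|^{\delta_d}A\|_{H^{s+1-\delta_d}}<\infty$,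 and it satisfies $$\||D|^{\delta_d}A\|_{H^{s+1-\delta_d}}\lesssim\|\lambda\|_{H^s}.$$ (ii) *Frequency envelopes.* If $0<\epsilon_0\le\epsilon_1$, $(h,\lambda)\in\mathcal D_{\epsilon_0}$, and $(p_{0k})$ is an admissible frequency envelope for $\lambda\in H^s$, then for all $k\ge0$ $$\|S_k|D|^{\delta_d}A\|_{H^{s+1-\delta_d}}\lesssim\epsilon_0\,p_{0k},$$ with an implicit constant that depends also on the constant in $p_{00}\approx\|\lambda\|_{H^s}$. (iii) *Linearization.* Let $0<\epsilon_0\le\epsilon_1$, $(h,\lambda)\in\mathcal D_{\epsilon_0}$ with solution $A$, and let $(\boldsymbol\delta h,\boldsymbol\delta\lambda,\boldsymbol\delta A)$, with $\boldsymbol\delta h$ symmetric and $\||D|^{\sigma_d}\boldsymbol\delta h\|_{H^{s+1-\sigma_d}}$, $\|\boldsymbol\delta\lambda\|_{H^s}$, $\||D|^{\delta_d}\boldsymbol\delta A\|_{H^{s+1-\delta_d}}$ finite, solve the linearization of (1) at $(h,\lambda,A)$. Then for every $\sigma\in(\frac d2-2,s]$ $$\||D|^{\delta_d}\boldsymbol\delta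 A\|_{H^{\sigma+1-\delta_d}}\lesssim\epsilon_0\big(\||D|^{\sigma_d}\boldsymbol\delta h\|_{H^{\sigma+1-\sigma_d}}+\|\boldsymbol\delta\lambda\|_{H^\sigma}\big),$$ with an implicit constant that depends also on $\sigma$. Moreover, along every curve $t\mapsto(h_t,\lambda_t)\in\mathcal D_{\epsilon_1}$, defined for $t$ near $0$ and differentiable at $t=0$ in these norms with derivative $(\boldsymbol\delta h,\boldsymbol\delta\lambda)$, the solutions $A_t$ of (1) are differentiable at $t=0$ in the norm $\||D|^{\delta_d}\cdot\|_{H^{s+1-\delta_d}}$, and their derivative $\boldsymbol\delta A$ solves the linearized system. The implicit constants are independent of $h,\lambda,\boldsymbol\delta h,\boldsymbol\delta\lambda$ and $\epsilon_0$. -/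

import Mathlib

open MeasureTheory Filter Topology
open scoped ENNReal ContDiff FourierTransform

noncomputable section

/-- The space `ℝ^d`. -/
abbrev Rd (d : ℕ) : Type := EuclideanSpace ℝ (Fin d)

/-! ### Sobolev norms through Fourier multipliers -/

/-- `‖m(D) u‖_{L²}` for a Fourier multiplier with symbol `m`. With Mathlib's Fourier transform the
frequency of `e^{2πi⟨x,ξ⟩}` is `2πξ`, so the symbol is evaluated at `2πξ`, up to the fixed factor of
Plancherel's theorem for the other normalisations. The function `u` has to be the (continuous)
inverse Fourier transform of an integrable function, which is unique almost everywhere; for all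
other `u` the value is `⊤`. In the spaces used below (regularity above `d/2` at high frequency,
`|D|^a u ∈ L²` with `a < d/2` at low frequency) every element that vanishes at infinity is of this
form, by Cauchy-Schwarz. -/
def multiplierNorm {d : ℕ} (m : Rd d → ℝ) (u : Rd d → ℂ) : ℝ≥0∞ :=
  ⨅ (w : Rd d → ℂ) (_ : Integrable w volume ∧ u = 𝓕⁻ w),
    eLpNorm (fun ξ : Rd d => (m ((2 * Real.pi) • ξ) : ℂ) * w ξ) 2 volume

/-- The symbol `|η|^a (1 + |η|²)^{b/2}` of `|D|^a ⟨D⟩^b`. -/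
def sobolevSymbol {d : ℕ} (a b : ℝ) (η : Rd d) : ℝ :=
  ‖η‖ ^ a * (1 + ‖η‖ ^ 2) ^ (b / 2)

/-- The `ℓ²` sum over the components of a tensor of `‖m(D) u_i‖_{L²}`. -/
def tensorNorm {d : ℕ} {ι : Type} [Fintype ι] (m : Rd d → ℝ) (u : ι → Rd d → ℂ) : ℝ≥0∞ :=
  (∑ i, multiplierNorm m (u i) ^ 2) ^ (1 / 2 : ℝ)

/-- Smooth radial cutoffs with values in `[0,1]`, equal to `1` on the unit ball and supported in the
ball of radius `2`. -/
structure IsCutoff {d : ℕ} (φ : Rd d → ℝ) : Prop where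
  smooth : ContDiff ℝ ∞ φ
  radial : ∀ x y : Rd d, ‖x‖ = ‖y‖ → φ x = φ y
  range : ∀ x, φ x ∈ Set.Icc (0 : ℝ) 1
  eq_one : ∀ x, ‖x‖ ≤ 1 → φ x = 1
  eq_zero : ∀ x, 2 ≤ ‖x‖ → φ x = 0

/-- The symbol of the inhomogeneous Littlewood-Paley projection `S_k`: `φ(η)` for `k = 0`, and
`φ(η/2^k) - φ(η/2^{k-1})` for `k ≥ 1`. -/
def lpSymbol {d : ℕ} (φ : Rd d → ℝ) : ℕ → Rd d → ℝ
  | 0, η => φ η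
  | k + 1, η => φ (((2 : ℝ) ^ (k + 1))⁻¹ • η) - φ (((2 : ℝ) ^ k)⁻¹ • η)

/-! ### Fields -/

/-- Real matrix fields, for `h = g - I_d` and its variations. -/
abbrev MetricField (d : ℕ) : Type := Rd d → Matrix (Fin d) (Fin d) ℝ

/-- Complex matrix fields, for the complex second fundamental form `λ_{αβ}`. -/
abbrev SecondForm (d : ℕ) : Type := Rd d → Matrix (Fin d) (Fin d) ℂ

/-- Real covector fields, for the connection coefficients `A_α`. -/
abbrev Connection (d : ℕ) : Type := Rd d → Fin d → ℝ

/-- `‖|D|^{σ_d} h‖_{H^{r - σ_d}}` with `σ_d = d/2 - δ`. -/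
def metricNorm {d : ℕ} (δ r : ℝ) (h : MetricField d) : ℝ≥0∞ :=
  tensorNorm (sobolevSymbol ((d : ℝ) / 2 - δ) (r - ((d : ℝ) / 2 - δ)))
    (fun (p : Fin d × Fin d) x => (h x p.1 p.2 : ℂ))

/-- `‖λ‖_{H^r}`. -/
def formNorm {d : ℕ} (r : ℝ) (lam : SecondForm d) : ℝ≥0∞ :=
  tensorNorm (sobolevSymbol 0 r) (fun (p : Fin d × Fin d) x => lam x p.1 p.2)

/-- `‖S_k λ‖_{H^r}`. -/
def formNormLP {d : ℕ} (φ : Rd d → ℝ) (k : ℕ) (r : ℝ) (lam : SecondForm d) : ℝ≥0∞ :=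
  tensorNorm (fun η => lpSymbol φ k η * sobolevSymbol 0 r η)
    (fun (p : Fin d × Fin d) x => lam x p.1 p.2)

/-- `δ_d = δ` if `d = 2` and `δ_d = 0` otherwise. -/
def deltaD (d : ℕ) (δ : ℝ) : ℝ := if d = 2 then δ else 0

/-- `‖|D|^{δ_d} A‖_{H^{r - δ_d}}`. -/
def connNorm {d : ℕ} (δ r : ℝ) (A : Connection d) : ℝ≥0∞ :=
  tensorNorm (sobolevSymbol (deltaD d δ) (r - deltaD d δ)) (fun (i : Fin d) x => (A x i : ℂ))

/-- `‖S_k |D|^{δ_d} A‖_{H^{r - δ_d}}`. -/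
def connNormLP {d : ℕ} (φ : Rd d → ℝ) (k : ℕ) (δ r : ℝ) (A : Connection d) : ℝ≥0∞ :=
  tensorNorm (fun η => lpSymbol φ k η * sobolevSymbol (deltaD d δ) (r - deltaD d δ) η)
    (fun (i : Fin d) x => (A x i : ℂ))

/-! ### Geometry of the metric `g = I_d + h` -/

/-- The partial derivative `∂_α f` at `x`. -/
def pd {d : ℕ} (α : Fin d) (f : Rd d → ℝ) (x : Rd d) : ℝ :=
  fderiv ℝ f x (EuclideanSpace.single α 1)

/-- The inverse metric `g^{αβ}` of `g = I_d + h`. -/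
def ginv {d : ℕ} (h : MetricField d) (x : Rd d) : Matrix (Fin d) (Fin d) ℝ := (1 + h x)⁻¹

/-- The Christoffel symbol `Γ^γ_{αβ}` of `g = I_d + h`. -/
def christoffel {d : ℕ} (h : MetricField d) (γ α β : Fin d) (x : Rd d) : ℝ :=
  ∑ σ, ginv h x γ σ * ((1 / 2 : ℝ) *
    (pd α (fun y => (1 + h y) β σ) x + pd β (fun y => (1 + h y) α σ) x
      - pd σ (fun y => (1 + h y) α β) x))

/-- The covariant derivative `∇_α A_β`. -/
def covDeriv {d : ℕ} (h : MetricField d) (A : Connection d) (α β : Fin d) (x : Rd d) : ℝ :=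
  pd α (fun y => A y β) x - ∑ γ, christoffel h γ α β x * A x γ

/-- The divergence `∇^α A_α`. -/
def covDiv {d : ℕ} (h : MetricField d) (A : Connection d) (x : Rd d) : ℝ :=
  ∑ α, ∑ β, ginv h x α β * covDeriv h A α β x

/-- The curl `∇_α A_β - ∇_β A_α`. -/
def covCurl {d : ℕ} (h : MetricField d) (A : Connection d) (α β : Fin d) (x : Rd d) : ℝ :=
  covDeriv h A α β x - covDeriv h A β α x

/-- The normal curvature `Im(λ^γ_α conj λ_{βγ})`, with `λ^γ_α = g^{γμ} λ_{αμ}`. -/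
def normalCurv {d : ℕ} (h : MetricField d) (lam : SecondForm d) (α β : Fin d) (x : Rd d) : ℝ :=
  (∑ γ, ∑ μ, (ginv h x γ μ : ℂ) * lam x α μ * (starRingEnd ℂ) (lam x β γ)).im

/-- The coordinates are harmonic: `g^{αβ} Γ^γ_{αβ} = 0`. -/
def IsHarmonicGauge {d : ℕ} (h : MetricField d) : Prop :=
  ∀ (γ : Fin d) (x : Rd d), ∑ α, ∑ β, ginv h x α β * christoffel h γ α β x = 0

/-- The two-form `F_{αβ}` is closed in the sense of distributions. -/
def IsWeaklyClosed {d : ℕ} (F : Fin d → Fin d → Rd d → ℝ) : Prop :=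
  ∀ φ : Rd d → ℝ, ContDiff ℝ ∞ φ → HasCompactSupport φ → ∀ α β γ : Fin d,
    ∫ x, (F α β x * pd γ φ x + F β γ x * pd α φ x + F γ α x * pd β φ x) = 0

/-- The data `(h, λ)`: `g = I_d + h` is symmetric and in harmonic coordinates, the normal curvature
two-form is closed (the integrability condition of the Ricci equations), and
`‖λ‖_{H^s} ≤ ε`, `‖|D|^{σ_d} h‖_{H^{s+1-σ_d}} ≤ ε`. -/
structure IsSmallData {d : ℕ} (s δ ε : ℝ) (h : MetricField d) (lam : SecondForm d) : Prop where
  symm : ∀ x, (h x).IsSymm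
  harmonic : IsHarmonicGauge h
  ricci : IsWeaklyClosed (normalCurv h lam)
  lam_small : formNorm s lam ≤ ENNReal.ofReal ε
  h_small : metricNorm δ (s + 1) h ≤ ENNReal.ofReal ε

/-- The Coulomb div-curl system
`∇^α A_α = 0`, `∇_α A_β - ∇_β A_α = Im(λ^γ_α conj λ_{βγ})`. -/
structure SolvesDivCurl {d : ℕ} (h : MetricField d) (lam : SecondForm d) (A : Connection d) :
    Prop where
  coulomb : ∀ x, covDiv h A x = 0
  curl : ∀ α β x, covCurl h A α β x = normalCurv h lam α β x

/-- Solutions of the div-curl system in the class `‖|D|^{δ_d} A‖_{H^{s+1-δ_d}} < ∞`. -/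
def IsSolution {d : ℕ} (s δ : ℝ) (h : MetricField d) (lam : SecondForm d) (A : Connection d) :
    Prop :=
  SolvesDivCurl h lam A ∧ connNorm δ (s + 1) A < ⊤

/-- The linearization of the div-curl system at `(h, λ, A)`: the first variations of both equations
in the direction `(dh, dlam, dA)` vanish at every point. -/
structure SolvesLinearized {d : ℕ} (h : MetricField d) (lam : SecondForm d) (A : Connection d)
    (dh : MetricField d) (dlam : SecondForm d) (dA : Connection d) : Prop where
  coulomb : ∀ x, HasDerivAt (fun t : ℝ => covDiv (h + t • dh) (A + t • dA) x) 0 0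
  curl : ∀ α β x, HasDerivAt (fun t : ℝ => covCurl (h + t • dh) (A + t • dA) α β x
      - normalCurv (h + t • dh) (lam + t • dlam) α β x) 0 0

/-- `p` is an admissible frequency envelope for `λ ∈ H^s`, the relation `p_0 ≈ ‖λ‖_{H^s}` having
the constant `K`. -/
structure IsEnvelope {d : ℕ} (φ : Rd d → ℝ) (s δ K : ℝ) (lam : SecondForm d) (p : ℕ → ℝ) :
    Prop where
  nonneg : ∀ k, 0 ≤ p k
  summable : Summable (fun k => p k ^ 2)
  bound : ∀ k, formNormLP φ k s lam ≤ ENNReal.ofReal (p k)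
  slow : ∀ j k : ℕ, p j ≤ (2 : ℝ) ^ (δ * |(j : ℝ) - (k : ℝ)|) * p k
  zero_le : ENNReal.ofReal (p 0) ≤ ENNReal.ofReal K * formNorm s lam
  le_zero : formNorm s lam ≤ ENNReal.ofReal K * ENNReal.ofReal (p 0)

end

/-! ### Inverse Fourier transforms of integrable functions -/

/-! Since the Christoffel symbols are symmetric in their lower indices, the curl equation is the
flat one, and in harmonic coordinates the divergence is `g^{αβ} ∂_α A_β`. So the system reads `∂_α
A_β - ∂_β A_α = F_{αβ}`, `∑ ∂_α A_α = -(g^{αβ} - δ^{αβ}) ∂_α A_β`, a small perturbation of the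
constant coefficient div-curl system. The latter is inverted on the Fourier side by `|ξ|² A_β = ξ_α
(ξ_α A_β - ξ_β A_α) + ξ_β (ξ_α A_α)`, which gains exactly one derivative (`norm_le_div_curl`). It is
solvable because closedness of `F` becomes a pointwise cyclic identity for its transform
(`fourier_closed`, `Params.exists_flat_solution`). The variable coefficient term is handled by a
contraction for existence and by absorption for estimates and uniqueness (`AdmWeight.apriori`).

All spaces have weights `wt a b`, of order `a` at low and `b` at high frequency: `(σ_d, s+1)` for
the metric, `(δ_d, s+1)` for `A`, `(δ_d - 1, s)` for sources and `(0, s)` for `λ`. All products rest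
on one mechanism. The weight `wt (-σ_d) (-s)` is square integrable because `σ_d < d/2 < s`. If the
symbols satisfy `W(ζ+η) ≤ C V₁(ζ) V₂(η)` times the sum of this weight over the three frequencies,
then Cauchy-Schwarz and Tonelli bound the convolution in `L²` (`l2_conv_weight_le`). The symbol
inequality holds because the two larger of three frequencies forming a triangle are comparable
(`rwt_trilinear`), so most product estimates reduce to linear inequalities between exponents. The
inverse metric is controlled by a Neumann series, run as a contraction (`Params.invDev_bound`).

The source `F` is quadratic in `λ`, so the solution is of size `‖λ‖²`; this is the origin of the
factor `ε₀`. For the frequency envelopes the same elliptic estimate is run with an additional weight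
`min (t, 1/t)`, `t = (2^{-k}⟨η⟩)^{2δ}`. It dominates the `k`th Littlewood-Paley symbol, varies
slowly enough to pass through the product estimates, and decays at twice the rate permitted to the
envelope, so the sum over dyadic pieces converges.

The linearized system is the same elliptic system for the variation of `A`, with sources linear in
the other variations; the regularity `σ` is always put on the varied factor. For differentiability,
the difference quotients solve an exact system with the coefficients of the operator frozen at time
zero. The a priori estimate first bounds them, which gives continuity of `A_t` and hence convergence
of the sources. Applied to differences of two quotients it then gives the Cauchy property, and
completeness gives the derivative. These norms control values and gradients pointwise, so the limit
solves the linearized system classically. -/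

theorem fourier_eq_zero_imp {d : ℕ} {w : Rd d → ℂ} (hw : Integrable w volume) (h : 𝓕 w = 0) :
    w =ᵐ[volume] 0 := by
  apply ae_eq_zero_of_integral_contDiff_smul_eq_zero hw.locallyIntegrable
  intro g hg hgc
  have hgC : ContDiff ℝ ∞ (fun x => (g x : ℂ)) := Complex.ofRealCLM.contDiff.comp hg
  have hgc' : HasCompactSupport (fun x => (g x : ℂ)) := hgc.comp_left (g := fun t : ℝ => (t : ℂ)) (by simp)
  let ψ : SchwartzMap (Rd d) ℂ := hgc'.toSchwartzMap hgC
  -- Inversion is available for Schwartz functions: the bump is written as a Fourier transform, and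
  -- moving the transform onto `w` makes every pairing of `w` with a test function vanish.
  have h1 : ∫ ξ, 𝓕 w ξ • (𝓕⁻ ψ) ξ = ∫ x, w x • 𝓕 (𝓕⁻ ψ : SchwartzMap (Rd d) ℂ) x := by
    have := VectorFourier.integral_fourierIntegral_smul_eq_flip (μ := (volume : Measure (Rd d)))
      (ν := (volume : Measure (Rd d)))
      (L := innerₗ (Rd d)) Real.continuous_fourierChar continuous_inner hw
      (𝓕⁻ ψ : SchwartzMap (Rd d) ℂ).integrable
    rw [flip_innerₗ] at this
    rw [SchwartzMap.fourier_coe]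
    exact this
  rw [h] at h1
  have h2 : (𝓕 (𝓕⁻ ψ : SchwartzMap (Rd d) ℂ)) = ψ := by simp
  rw [h2] at h1
  simp only [Pi.zero_apply, zero_smul, integral_zero] at h1
  rw [h1]
  apply integral_congr_ae
  refine .of_forall fun x => ?_
  show (g x) • w x = w x • (g x : ℂ)
  rw [Complex.real_smul, smul_eq_mul, mul_comm]

theorem fourierInv_injective {d : ℕ} {w v : Rd d → ℂ} (hw : Integrable w volume)
    (hv : Integrable v volume) (h : 𝓕⁻ w = 𝓕⁻ v) : w =ᵐ[volume] v := by
  have h0 : 𝓕 (w - v) = 0 := by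
    funext x
    have h1 := congrFun h (-x)
    rw [Real.fourierInv_eq_fourier_neg, Real.fourierInv_eq_fourier_neg, neg_neg] at h1
    have : 𝓕 (w - v) x = 𝓕 w x - 𝓕 v x := by
      simp only [Real.fourier_eq, Pi.sub_apply, smul_sub]
      exact integral_sub ((Real.fourierIntegral_convergent_iff x).2 hw)
        ((Real.fourierIntegral_convergent_iff x).2 hv)
    rw [this, h1, sub_self]; rfl
  have := fourier_eq_zero_imp (hw.sub hv) h0
  filter_upwards [this] with x hx
  exact sub_eq_zero.1 hx

theorem fourierInv_add {d : ℕ} {w v : Rd d → ℂ} (hw : Integrable w volume)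
    (hv : Integrable v volume) : 𝓕⁻ (w + v) = 𝓕⁻ w + 𝓕⁻ v := by
  funext x
  simp only [Pi.add_apply, Real.fourierInv_eq_fourier_neg, Real.fourier_eq, smul_add]
  exact integral_add ((Real.fourierIntegral_convergent_iff _).2 hw)
        ((Real.fourierIntegral_convergent_iff _).2 hv)

theorem fourierInv_const_mul {d : ℕ} (c : ℂ) (w : Rd d → ℂ) :
    𝓕⁻ (fun ξ => c * w ξ) = fun x => c * 𝓕⁻ w x := by
  funext x
  simp only [Real.fourierInv_eq_fourier_neg, Real.fourier_eq]
  rw [← integral_const_mul]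
  congr 1; ext v
  simp only [Circle.smul_def, smul_eq_mul]; ring

theorem fourierInv_conj {d : ℕ} (w : Rd d → ℂ) :
    𝓕⁻ (fun ξ => (starRingEnd ℂ) (w (-ξ))) = fun x => (starRingEnd ℂ) (𝓕⁻ w x) := by
  rw [Real.fourierInv_eq_fourier_comp_neg]
  funext x
  simp only [Real.fourierInv_eq, Real.fourier_eq, neg_neg]
  rw [← integral_conj]
  congr 1; ext v
  simp only [Circle.smul_def, smul_eq_mul, map_mul]
  congr 1
  rw [← Circle.coe_inv_eq_conj, AddChar.map_neg_eq_inv]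

theorem fourierInv_mul {d : ℕ} {w v : Rd d → ℂ} (hw : Integrable w volume)
    (hv : Integrable v volume) :
    𝓕⁻ (convolution w v (ContinuousLinearMap.mul ℂ ℂ) volume) = fun x => 𝓕⁻ w x * 𝓕⁻ v x := by
  funext x
  simp only [Real.fourierInv_eq_fourier_neg]
  exact Real.fourier_mul_convolution_eq hw hv (-x)

theorem enorm_fourierInv_le {d : ℕ} (w : Rd d → ℂ) (x : Rd d) :
    ‖𝓕⁻ w x‖ₑ ≤ ∫⁻ ξ, ‖w ξ‖ₑ := by
  rw [Real.fourierInv_eq]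
  refine (enorm_integral_le_lintegral_enorm _).trans (le_of_eq ?_)
  congr 1; ext v
  rw [Circle.smul_def, enorm_smul, ← ofReal_norm, Circle.norm_coe]
  simp

theorem continuous_fourierInv {d : ℕ} {w : Rd d → ℂ} (hw : Integrable w volume) :
    Continuous (𝓕⁻ w) := by
  have h1 : Continuous (𝓕 w) := VectorFourier.fourierIntegral_continuous
    Real.continuous_fourierChar continuous_inner hw
  have : 𝓕⁻ w = fun x => 𝓕 w (-x) := by funext x; exact Real.fourierInv_eq_fourier_neg _ _
  rw [this]
  exact h1.comp continuous_neg

/-- The partial derivative of a complex-valued function. -/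
noncomputable def pdC {d : ℕ} (α : Fin d) (u : Rd d → ℂ) (x : Rd d) : ℂ :=
  fderiv ℝ u x (EuclideanSpace.single α 1)

theorem fourierInv_pd {d : ℕ} {w : Rd d → ℂ} (hw : Integrable w volume)
    (hw1 : Integrable (fun ξ => ‖ξ‖ * ‖w ξ‖) volume) :
    Differentiable ℝ (𝓕⁻ w) ∧ ∀ α, pdC α (𝓕⁻ w) =
      𝓕⁻ (fun ξ => (2 * Real.pi * Complex.I * (ξ α : ℂ)) * w ξ) := by
  have hn : Integrable (fun ξ => w (-ξ)) volume := hw.comp_neg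
  have hn1 : Integrable (fun ξ => ‖ξ‖ * ‖w (-ξ)‖) volume := by
    have := hw1.comp_neg
    simpa using this
  rw [Real.fourierInv_eq_fourier_comp_neg]
  refine ⟨Real.differentiable_fourier hn hn1, fun α => ?_⟩
  funext x
  rw [pdC, Real.fderiv_fourier hn hn1]
  have hint : Integrable (VectorFourier.fourierSMulRight (innerSL ℝ) (fun ξ => w (-ξ))) volume := by
    refine (hn1.const_mul (2 * Real.pi * ‖(innerSL ℝ : Rd d →L[ℝ] _)‖)).mono' hn.1.fourierSMulRight
      (.of_forall fun v => ?_)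
    refine (VectorFourier.norm_fourierSMulRight_le _ _ _).trans (le_of_eq (by ring))
  have h2 := Real.fourier_continuousLinearMap_apply hint (a := (EuclideanSpace.single α (1:ℝ)))
    (v := x)
  rw [h2, Real.fourierInv_eq_fourier_comp_neg]
  refine congrFun (congrArg _ (funext fun v => ?_)) x
  have h3 : (innerSL ℝ v) (EuclideanSpace.single α (1 : ℝ)) = v α := by
    rw [innerSL_apply_apply, EuclideanSpace.inner_single_right]; simp
  rw [VectorFourier.fourierSMulRight_apply, h3]
  simp
  ring

/-! ### The Wiener class -/

/-- Inverse Fourier transforms of integrable functions. -/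
def FL {d : ℕ} (u : Rd d → ℂ) : Prop := ∃ w : Rd d → ℂ, Integrable w volume ∧ u = 𝓕⁻ w

/-- Inverse Fourier transforms of functions with an integrable first moment. -/
def FL1 {d : ℕ} (u : Rd d → ℂ) : Prop :=
  ∃ w : Rd d → ℂ, Integrable w volume ∧ Integrable (fun ξ => ‖ξ‖ * ‖w ξ‖) volume ∧ u = 𝓕⁻ w

namespace FL
variable {d : ℕ} {u v : Rd d → ℂ}

theorem zero : FL (0 : Rd d → ℂ) := ⟨0, integrable_zero _ _ _, by
  funext x; simp [Real.fourierInv_eq]⟩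

theorem add (hu : FL u) (hv : FL v) : FL (u + v) := by
  obtain ⟨w, hw, rfl⟩ := hu
  obtain ⟨z, hz, rfl⟩ := hv
  exact ⟨w + z, hw.add hz, (fourierInv_add hw hz).symm⟩

theorem const_mul (c : ℂ) (hu : FL u) : FL (fun x => c * u x) := by
  obtain ⟨w, hw, rfl⟩ := hu
  exact ⟨_, hw.const_mul c, (fourierInv_const_mul c w).symm⟩

theorem neg (hu : FL u) : FL (-u) := by
  have := hu.const_mul (-1)
  convert this using 1
  funext x; simp

theorem sub (hu : FL u) (hv : FL v) : FL (u - v) := by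
  rw [sub_eq_add_neg]; exact hu.add hv.neg

theorem mul (hu : FL u) (hv : FL v) : FL (u * v) := by
  obtain ⟨w, hw, rfl⟩ := hu
  obtain ⟨z, hz, rfl⟩ := hv
  exact ⟨_, hw.integrable_convolution _ hz, (fourierInv_mul hw hz).symm⟩

theorem conj (hu : FL u) : FL (fun x => (starRingEnd ℂ) (u x)) := by
  obtain ⟨w, hw, rfl⟩ := hu
  refine ⟨_, ?_, (fourierInv_conj w).symm⟩
  have : Integrable (fun ξ => w (-ξ)) volume := hw.comp_neg
  exact (RCLike.conjLIE.toContinuousLinearEquiv.toContinuousLinearMap).integrable_comp this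

theorem sum {ι : Type*} (s : Finset ι) {f : ι → Rd d → ℂ} (hf : ∀ i ∈ s, FL (f i)) :
    FL (∑ i ∈ s, f i) := by
  classical
  induction s using Finset.induction_on with
  | empty => simpa using FL.zero
  | insert a s ha ih =>
    rw [Finset.sum_insert ha]
    exact (hf a (by simp)).add (ih fun i hi => hf i (by simp [hi]))

end FL

namespace FL1
variable {d : ℕ} {u v : Rd d → ℂ}

theorem fl (hu : FL1 u) : FL u := by
  obtain ⟨w, hw, -, rfl⟩ := hu
  exact ⟨w, hw, rfl⟩

theorem differentiable (hu : FL1 u) : Differentiable ℝ u := by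
  obtain ⟨w, hw, h1, rfl⟩ := hu
  exact (fourierInv_pd hw h1).1

end FL1

theorem integrable_symbol_mul {d : ℕ} {w : Rd d → ℂ} (hw : Integrable w volume)
    (hw1 : Integrable (fun ξ => ‖ξ‖ * ‖w ξ‖) volume) (α : Fin d) :
    Integrable (fun ξ : Rd d => (2 * Real.pi * Complex.I * (ξ α : ℂ)) * w ξ) volume := by
  refine (hw1.const_mul (2 * Real.pi)).mono' (AEStronglyMeasurable.mul ?_ hw.1)
    (.of_forall fun v => ?_)
  · apply Continuous.aestronglyMeasurable; fun_prop
  · have := PiLp.norm_apply_le v α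
    simp only [norm_mul, Complex.norm_I, Complex.norm_real, Complex.norm_ofNat]
    rw [Real.norm_of_nonneg Real.pi_pos.le, mul_assoc (2 * Real.pi)]
    have h3 := norm_nonneg (w v)
    have : ‖v.ofLp α‖ * ‖w v‖ ≤ ‖v‖ * ‖w v‖ := by gcongr
    have := Real.pi_pos
    rw [one_mul, mul_assoc (2 * Real.pi)]
    gcongr

theorem FL1.pd {d : ℕ} {u : Rd d → ℂ} (hu : FL1 u) (α : Fin d) : FL (pdC α u) := by
  obtain ⟨w, hw, h1, rfl⟩ := hu
  exact ⟨_, integrable_symbol_mul hw h1 α, (fourierInv_pd hw h1).2 α⟩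

/-! ### Multiplier norms -/

/-- By injectivity of the inverse transform, the infimum in the definition runs over functions that
agree almost everywhere, so any representative computes it. -/
theorem multiplierNorm_fourierInv {d : ℕ} (m : Rd d → ℝ) {w : Rd d → ℂ}
    (hw : Integrable w volume) :
    multiplierNorm m (𝓕⁻ w) =
      eLpNorm (fun ξ : Rd d => (m ((2 * Real.pi) • ξ) : ℂ) * w ξ) 2 volume := by
  apply le_antisymm
  · exact iInf₂_le w ⟨hw, rfl⟩
  · refine le_iInf₂ fun v hv => le_of_eq (eLpNorm_congr_ae ?_)
    filter_upwards [fourierInv_injective hw hv.1 hv.2] with ξ hξ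
    rw [hξ]

/-- Outside the Wiener class the infimum is over an empty family and equals `⊤`; a finite norm
therefore always supplies a representative, whatever the symbol. -/
theorem fl_of_multiplierNorm_ne_top {d : ℕ} {m : Rd d → ℝ} {u : Rd d → ℂ}
    (h : multiplierNorm m u ≠ ⊤) : FL u := by
  by_contra hu
  apply h
  refine iInf₂_eq_top.2 fun w hw => absurd ⟨w, hw⟩ hu

theorem fl_or_multiplierNorm_eq_top {d : ℕ} (m : Rd d → ℝ) (u : Rd d → ℂ) :
    FL u ∨ multiplierNorm m u = ⊤ := by
  by_cases h : multiplierNorm m u = ⊤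
  · exact Or.inr h
  · exact Or.inl (fl_of_multiplierNorm_ne_top h)

theorem multiplierNorm_zero {d : ℕ} (m : Rd d → ℝ) : multiplierNorm m (0 : Rd d → ℂ) = 0 := by
  have : (0 : Rd d → ℂ) = 𝓕⁻ (0 : Rd d → ℂ) := by funext x; simp [Real.fourierInv_eq]
  rw [this, multiplierNorm_fourierInv m (integrable_zero _ _ _)]
  simp

theorem aestronglyMeasurable_multiplier {d : ℕ} {m : Rd d → ℝ} (hm : Measurable m)
    {w : Rd d → ℂ} (hw : Integrable w volume) :
    AEStronglyMeasurable (fun ξ : Rd d => (m ((2 * Real.pi) • ξ) : ℂ) * w ξ) volume := by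
  refine AEStronglyMeasurable.mul ?_ hw.1
  apply Measurable.aestronglyMeasurable
  exact Complex.measurable_ofReal.comp (hm.comp (measurable_const_smul _))

theorem multiplierNorm_add_le {d : ℕ} {m : Rd d → ℝ} (hm : Measurable m) (u v : Rd d → ℂ) :
    multiplierNorm m (u + v) ≤ multiplierNorm m u + multiplierNorm m v := by
  rcases fl_or_multiplierNorm_eq_top m u with ⟨w, hw, rfl⟩ | h
  swap; · simp [h]
  rcases fl_or_multiplierNorm_eq_top m v with ⟨z, hz, rfl⟩ | h
  swap; · simp [h]
  rw [← fourierInv_add hw hz, multiplierNorm_fourierInv _ hw, multiplierNorm_fourierInv _ hz,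
    multiplierNorm_fourierInv _ (hw.add hz)]
  refine le_trans (le_of_eq ?_) (eLpNorm_add_le (aestronglyMeasurable_multiplier hm hw)
    (aestronglyMeasurable_multiplier hm hz) (by norm_num))
  congr 1; funext ξ
  simp [mul_add]

theorem multiplierNorm_const_mul_le {d : ℕ} (m : Rd d → ℝ) (c : ℂ) (u : Rd d → ℂ) :
    multiplierNorm m (fun x => c * u x) ≤ ‖c‖ₑ * multiplierNorm m u := by
  -- Separate case because `0 * ⊤ = 0`: the right side can vanish although `u` has no
  -- representative.
  by_cases hc : c = 0
  · subst hc
    have : (fun x => (0 : ℂ) * u x) = 0 := by funext x; simp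
    rw [this, multiplierNorm_zero]; simp
  rcases fl_or_multiplierNorm_eq_top m u with ⟨w, hw, rfl⟩ | h
  swap; · rw [h, ENNReal.mul_top (by simpa using hc)]; exact le_top
  rw [← fourierInv_const_mul, multiplierNorm_fourierInv _ hw,
    multiplierNorm_fourierInv _ (hw.const_mul c), ← eLpNorm_const_smul]
  apply le_of_eq
  congr 1; funext ξ
  simp; ring

theorem multiplierNorm_neg {d : ℕ} (m : Rd d → ℝ) (u : Rd d → ℂ) :
    multiplierNorm m (-u) = multiplierNorm m u := by
  have key : ∀ v : Rd d → ℂ, multiplierNorm m (-v) ≤ multiplierNorm m v := fun v => by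
    have := multiplierNorm_const_mul_le m (-1) v
    simpa [← Pi.neg_def] using this
  refine le_antisymm (key u) ?_
  simpa using key (-u)

theorem multiplierNorm_sub_le {d : ℕ} {m : Rd d → ℝ} (hm : Measurable m) (u v : Rd d → ℂ) :
    multiplierNorm m (u - v) ≤ multiplierNorm m u + multiplierNorm m v := by
  rw [sub_eq_add_neg, ← multiplierNorm_neg m v]
  exact multiplierNorm_add_le hm _ _

theorem multiplierNorm_sum_le {d : ℕ} {m : Rd d → ℝ} (hm : Measurable m) {ι : Type*}
    (s : Finset ι) (f : ι → Rd d → ℂ) :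
    multiplierNorm m (∑ i ∈ s, f i) ≤ ∑ i ∈ s, multiplierNorm m (f i) := by
  classical
  induction s using Finset.induction_on with
  | empty => simp [multiplierNorm_zero]
  | insert a s ha ih =>
    rw [Finset.sum_insert ha, Finset.sum_insert ha]
    exact (multiplierNorm_add_le hm _ _).trans (by gcongr)

/-- The weights are degenerate or singular at the origin, so symbols are only ever compared off this
null set. -/
theorem ae_ne_zero {d : ℕ} (hd : 2 ≤ d) : ∀ᵐ ξ : Rd d ∂volume, ξ ≠ 0 := by
  have : Nonempty (Fin d) := ⟨⟨0, by omega⟩⟩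
  have : Nontrivial (Rd d) := inferInstance
  rw [ae_iff]
  simp

theorem eLpNorm_multiplier_mono {d : ℕ} (hd : 2 ≤ d) {m m' : Rd d → ℝ} {C : ℝ}
    {w w' : Rd d → ℂ}
    (h : ∀ ξ : Rd d, ξ ≠ 0 → |m ((2 * Real.pi) • ξ)| * ‖w ξ‖ ≤
      C * (|m' ((2 * Real.pi) • ξ)| * ‖w' ξ‖)) :
    eLpNorm (fun ξ : Rd d => (m ((2 * Real.pi) • ξ) : ℂ) * w ξ) 2 volume ≤
      ENNReal.ofReal C *
        eLpNorm (fun ξ : Rd d => (m' ((2 * Real.pi) • ξ) : ℂ) * w' ξ) 2 volume := by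
  refine eLpNorm_le_mul_eLpNorm_of_ae_le_mul ?_ 2
  filter_upwards [ae_ne_zero hd] with ξ hξ
  simpa only [norm_mul, Complex.norm_real, Real.norm_eq_abs] using h ξ hξ

theorem two_pi_smul_ne_zero {d : ℕ} {ξ : Rd d} (hξ : ξ ≠ 0) : (2 * Real.pi) • ξ ≠ 0 :=
  smul_ne_zero (by positivity) hξ

theorem multiplierNorm_mono {d : ℕ} (hd : 2 ≤ d) {m m' : Rd d → ℝ} {C : ℝ} (hC : 0 < C)
    (h : ∀ η : Rd d, η ≠ 0 → |m η| ≤ C * |m' η|) (u : Rd d → ℂ) :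
    multiplierNorm m u ≤ ENNReal.ofReal C * multiplierNorm m' u := by
  rcases fl_or_multiplierNorm_eq_top m' u with ⟨w, hw, rfl⟩ | hu
  swap; · rw [hu, ENNReal.mul_top (by simpa using hC)]; exact le_top
  rw [multiplierNorm_fourierInv _ hw, multiplierNorm_fourierInv _ hw]
  refine eLpNorm_multiplier_mono hd fun ξ hξ => ?_
  rw [← mul_assoc]
  exact mul_le_mul_of_nonneg_right (h _ (two_pi_smul_ne_zero hξ)) (norm_nonneg _)

/-- Conjugating a function reflects the frequency of its representative, hence the evenness of the
symbol. -/
theorem multiplierNorm_conj {d : ℕ} {m : Rd d → ℝ} (hm : Measurable m) (he : ∀ η, m (-η) = m η)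
    (u : Rd d → ℂ) :
    multiplierNorm m (fun x => (starRingEnd ℂ) (u x)) ≤ multiplierNorm m u := by
  rcases fl_or_multiplierNorm_eq_top m u with ⟨w, hw, rfl⟩ | hu
  swap; · rw [hu]; exact le_top
  have hi : Integrable (fun ξ => (starRingEnd ℂ) (w (-ξ))) volume :=
    (RCLike.conjLIE.toContinuousLinearEquiv.toContinuousLinearMap).integrable_comp hw.comp_neg
  rw [← fourierInv_conj, multiplierNorm_fourierInv _ hw, multiplierNorm_fourierInv _ hi]
  have h1 : eLpNorm (fun ξ : Rd d => (m ((2 * Real.pi) • ξ) : ℂ) * (starRingEnd ℂ) (w (-ξ))) 2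
      volume = eLpNorm ((fun ξ : Rd d => (m ((2 * Real.pi) • ξ) : ℂ) * w ξ) ∘ Neg.neg) 2 volume := by
    apply eLpNorm_congr_norm_ae
    refine .of_forall fun ξ => ?_
    simp only [Function.comp, smul_neg, he, norm_mul, RCLike.norm_conj]
  rw [h1, eLpNorm_comp_measurePreserving (aestronglyMeasurable_multiplier hm hw)
    (Measure.measurePreserving_neg _)]

theorem multiplierNorm_re {d : ℕ} {m : Rd d → ℝ} (hm : Measurable m) (he : ∀ η, m (-η) = m η)
    (u : Rd d → ℂ) :
    multiplierNorm m (fun x => ((u x).re : ℂ)) ≤ multiplierNorm m u := by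
  have h1 : (fun x => ((u x).re : ℂ)) =
      fun x => (1 / 2 : ℂ) * ((u + fun x => (starRingEnd ℂ) (u x)) x) := by
    funext x
    rw [Pi.add_apply, Complex.add_conj]; push_cast; ring
  rw [h1]
  refine (multiplierNorm_const_mul_le _ _ _).trans ?_
  refine (mul_le_mul_right (multiplierNorm_add_le hm _ _) _).trans ?_
  refine (mul_le_mul_right (add_le_add_right (multiplierNorm_conj hm he u) _) _).trans ?_
  rw [← two_mul, ← mul_assoc]
  have : ‖(1 / 2 : ℂ)‖ₑ * 2 = 1 := by
    rw [← ofReal_norm, show (2 : ℝ≥0∞) = ENNReal.ofReal 2 by simp,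
      ← ENNReal.ofReal_mul (norm_nonneg _)]
    simp
  rw [this, one_mul]

theorem multiplierNorm_im {d : ℕ} {m : Rd d → ℝ} (hm : Measurable m) (he : ∀ η, m (-η) = m η)
    (u : Rd d → ℂ) :
    multiplierNorm m (fun x => ((u x).im : ℂ)) ≤ multiplierNorm m u := by
  have h1 : (fun x => ((u x).im : ℂ)) = fun x => (((-Complex.I * u x).re : ℝ) : ℂ) := by
    funext x; simp
  rw [h1]
  refine (multiplierNorm_re hm he _).trans ((multiplierNorm_const_mul_le _ _ _).trans ?_)
  rw [← ofReal_norm]; simp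

theorem multiplierNorm_pd_le {d : ℕ} (hd : 2 ≤ d) {m m' : Rd d → ℝ} {u : Rd d → ℂ} (hu : FL1 u)
    (h : ∀ η : Rd d, η ≠ 0 → |m' η| * ‖η‖ ≤ |m η|) (α : Fin d) :
    multiplierNorm m' (pdC α u) ≤ multiplierNorm m u := by
  obtain ⟨w, hw, h1, rfl⟩ := hu
  rw [(fourierInv_pd hw h1).2 α, multiplierNorm_fourierInv _ hw,
    multiplierNorm_fourierInv _ (integrable_symbol_mul hw h1 α)]
  refine (eLpNorm_multiplier_mono (C := 1) (m' := m) (w' := w) hd fun ξ hξ => ?_).trans (by simp)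
  have h2 := h _ (two_pi_smul_ne_zero hξ)
  have h3 := PiLp.norm_apply_le ξ α
  have hpi := Real.pi_pos
  rw [one_mul, norm_mul, ← mul_assoc]
  refine mul_le_mul_of_nonneg_right (le_trans ?_ h2) (norm_nonneg _)
  refine mul_le_mul_of_nonneg_left ?_ (abs_nonneg _)
  rw [norm_smul]
  simp only [norm_mul, Complex.norm_I, Complex.norm_real, Complex.norm_ofNat, mul_one,
    Real.norm_ofNat]
  gcongr

theorem eq_zero_of_multiplierNorm_eq_zero {d : ℕ} (hd : 2 ≤ d) {m : Rd d → ℝ}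
    (hm : Measurable m) (hpos : ∀ η, η ≠ 0 → m η ≠ 0) {u : Rd d → ℂ}
    (h : multiplierNorm m u = 0) : u = 0 := by
  obtain ⟨w, hw, rfl⟩ := fl_of_multiplierNorm_ne_top (h.trans_ne ENNReal.zero_ne_top)
  rw [multiplierNorm_fourierInv _ hw,
    eLpNorm_eq_zero_iff (aestronglyMeasurable_multiplier hm hw) (by norm_num)] at h
  funext x
  have : w =ᵐ[volume] 0 := by
    filter_upwards [h, ae_ne_zero hd] with ξ h1 h2
    have := hpos _ (two_pi_smul_ne_zero h2)
    simpa [this] using h1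
  rw [Real.fourierInv_congr_ae this]
  simp [Real.fourierInv_eq]

/-! ### Two-exponent weights -/

/-- The weight `x^a ⟨x⟩^(b-a)`, of order `a` near zero and `b` at infinity. -/
noncomputable def rwt (a b x : ℝ) : ℝ := x ^ a * (1 + x ^ 2) ^ ((b - a) / 2)

theorem rwt_pos (a b : ℝ) {x : ℝ} (hx : 0 < x) : 0 < rwt a b x := by
  unfold rwt; positivity

theorem rwt_nonneg (a b : ℝ) {x : ℝ} (hx : 0 ≤ x) : 0 ≤ rwt a b x := by
  unfold rwt; positivity

theorem rwt_mul (a b a' b' : ℝ) {x : ℝ} (hx : 0 < x) :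
    rwt a b x * rwt a' b' x = rwt (a + a') (b + b') x := by
  unfold rwt
  rw [Real.rpow_add hx, show (b + b' - (a + a')) / 2 = (b - a) / 2 + (b' - a') / 2 by ring,
    Real.rpow_add (by positivity)]
  ring

theorem rwt_zero {x : ℝ} : rwt 0 0 x = 1 := by simp [rwt]

theorem rwt_one {x : ℝ} : rwt 1 1 x = x := by simp [rwt]

theorem rwt_neg (a b : ℝ) {x : ℝ} (hx : 0 < x) : rwt (-a) (-b) x = (rwt a b x)⁻¹ := by
  apply eq_inv_of_mul_eq_one_left
  rw [rwt_mul _ _ _ _ hx]; simp [rwt_zero]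

/-- The two exponents decouple in terms of `x/⟨x⟩`, which is increasing and at most one, and `⟨x⟩`,
which is increasing and at least one. Monotonicity in `x` and in the exponents is then read off
factor by factor. -/
theorem rwt_eq (a b : ℝ) {x : ℝ} (hx : 0 < x) :
    rwt a b x = (x / √(1 + x ^ 2)) ^ a * √(1 + x ^ 2) ^ b := by
  unfold rwt
  rw [Real.div_rpow hx.le (Real.sqrt_nonneg _), Real.sqrt_eq_rpow, ← Real.rpow_mul (by positivity),
    ← Real.rpow_mul (by positivity), div_mul_eq_mul_div, mul_div_assoc,
    ← Real.rpow_sub (by positivity)]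
  congr 2; ring

theorem div_sqrt_mono {x y : ℝ} (hx : 0 < x) (h : x ≤ y) :
    x / √(1 + x ^ 2) ≤ y / √(1 + y ^ 2) := by
  have hy : 0 < y := hx.trans_le h
  rw [div_le_div_iff₀ (by positivity) (by positivity)]
  rw [← abs_of_nonneg (a := x * _) (by positivity), ← abs_of_nonneg (a := y * _) (by positivity)]
  apply sq_le_sq.1
  rw [mul_pow, mul_pow, Real.sq_sqrt (by positivity), Real.sq_sqrt (by positivity)]
  nlinarith

theorem sqrt_le_two {x y : ℝ} (hx : 0 < x) (h : x ≤ 2 * y) :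
    √(1 + x ^ 2) ≤ 2 * √(1 + y ^ 2) := by
  rw [Real.sqrt_le_left (by positivity), mul_pow, Real.sq_sqrt (by positivity)]
  nlinarith

theorem div_sqrt_le_two {x y : ℝ} (hx : 0 < x) (h : x ≤ 2 * y) :
    x / √(1 + x ^ 2) ≤ 2 * (y / √(1 + y ^ 2)) := by
  have hy : 0 < y := by linarith
  refine (div_sqrt_mono hx h).trans ?_
  rw [mul_div_assoc]
  gcongr
  linarith

theorem rwt_mono {a b : ℝ} (ha : 0 ≤ a) (hb : 0 ≤ b) {x y : ℝ} (hx : 0 < x) (h : x ≤ y) :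
    rwt a b x ≤ rwt a b y := by
  have hy : 0 < y := hx.trans_le h
  rw [rwt_eq a b hx, rwt_eq a b hy]
  have := div_sqrt_mono hx h
  gcongr

theorem rwt_le_rwt {a b a' b' : ℝ} (ha : a' ≤ a) (hb : b ≤ b') {x : ℝ} (hx : 0 < x) :
    rwt a b x ≤ rwt a' b' x := by
  rw [rwt_eq a b hx, rwt_eq a' b' hx]
  have h1 : x / √(1 + x ^ 2) ≤ 1 := by
    rw [div_le_one (by positivity)]
    apply Real.le_sqrt_of_sq_le; linarith
  have h2 : 1 ≤ √(1 + x ^ 2) := by rw [Real.one_le_sqrt]; nlinarith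
  exact mul_le_mul (Real.rpow_le_rpow_of_exponent_ge (by positivity) h1 ha)
    (Real.rpow_le_rpow_of_exponent_le h2 hb) (by positivity) (by positivity)

theorem rpow_le_two_rpow_abs {x y : ℝ} (hx : 0 < x) (hy : 0 < y) (h1 : x ≤ 2 * y)
    (h2 : y ≤ 2 * x) (a : ℝ) : x ^ a ≤ 2 ^ |a| * y ^ a := by
  rcases le_total 0 a with ha | ha
  · rw [abs_of_nonneg ha, ← Real.mul_rpow (by norm_num) hy.le]
    gcongr
  · rw [abs_of_nonpos ha]
    have h3 : y ^ (-a) ≤ (2 * x) ^ (-a) := Real.rpow_le_rpow hy.le h2 (by linarith)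
    rw [Real.mul_rpow (by norm_num) hx.le, Real.rpow_neg hy.le, Real.rpow_neg hx.le] at h3
    have h4 : 0 < x ^ a := by positivity
    have h5 : 0 < y ^ a := by positivity
    rw [← div_eq_mul_inv, le_div_iff₀ h4, inv_mul_le_iff₀ h5] at h3
    linarith

theorem rwt_le_two {x y : ℝ} (hx : 0 < x) (hy : 0 < y) (h1 : x ≤ 2 * y)
    (h2 : y ≤ 2 * x) (a b : ℝ) : rwt a b x ≤ 2 ^ (|a| + |b|) * rwt a b y := by
  rw [rwt_eq a b hx, rwt_eq a b hy, Real.rpow_add (by norm_num)]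
  have e1 := rpow_le_two_rpow_abs (by positivity) (by positivity) (div_sqrt_le_two hx h1)
    (div_sqrt_le_two hy h2) a
  have e2 := rpow_le_two_rpow_abs (by positivity) (by positivity) (sqrt_le_two hx h1)
    (sqrt_le_two hy h2) b
  calc _ ≤ (2 ^ |a| * (y / √(1 + y ^ 2)) ^ a) * (2 ^ |b| * √(1 + y ^ 2) ^ b) :=
        mul_le_mul e1 e2 (by positivity) (by positivity)
    _ = _ := by ring

/-- The larger arguments `y` and `z` are comparable, so their weights merge into one of exponents
`a₂ + a₃`, `b₂ + b₃`. These are nonnegative, so the merged weight only decreases when moved down to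
`x`, where the three total exponents are compared with `p` and `s`. -/
theorem rwt_trilinear_of_smallest {p s B a₁ b₁ a₂ b₂ a₃ b₃ : ℝ} (ha : 0 ≤ a₂ + a₃)
    (hb : 0 ≤ b₂ + b₃) (hp : a₁ + a₂ + a₃ ≤ p) (hs : s ≤ b₁ + b₂ + b₃)
    (hB : |a₃| + |b₃| ≤ B) {x y z : ℝ} (hx : 0 < x) (hxy : x ≤ y) (hyz : y ≤ 2 * z)
    (hzy : z ≤ 2 * y) :
    1 ≤ 2 ^ B * (rwt a₁ b₁ x * rwt a₂ b₂ y * rwt a₃ b₃ z * rwt (-p) (-s) x) := by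
  have hy : 0 < y := hx.trans_le hxy
  have hz : 0 < z := by linarith
  have h1 := rwt_le_two hy hz hyz hzy a₃ b₃
  have h2 : (2 : ℝ) ^ (|a₃| + |b₃|) ≤ 2 ^ B := Real.rpow_le_rpow_of_exponent_le (by norm_num) hB
  have h3 : rwt a₃ b₃ y ≤ 2 ^ B * rwt a₃ b₃ z :=
    h1.trans (mul_le_mul_of_nonneg_right h2 (rwt_pos _ _ hz).le)
  have hw1 := rwt_pos a₁ b₁ hx
  have hw2 := rwt_pos a₂ b₂ hy
  have hm := rwt_pos (-p) (-s) hx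
  calc (1 : ℝ) = rwt p s x * rwt (-p) (-s) x := by rw [rwt_mul _ _ _ _ hx]; simp [rwt_zero]
    _ ≤ rwt (a₁ + (a₂ + a₃)) (b₁ + (b₂ + b₃)) x * rwt (-p) (-s) x := by
        refine mul_le_mul_of_nonneg_right (rwt_le_rwt (by linarith) (by linarith) hx) hm.le
    _ = rwt a₁ b₁ x * rwt (a₂ + a₃) (b₂ + b₃) x * rwt (-p) (-s) x := by
        rw [rwt_mul a₁ b₁ _ _ hx]
    _ ≤ rwt a₁ b₁ x * rwt (a₂ + a₃) (b₂ + b₃) y * rwt (-p) (-s) x := by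
        have := rwt_mono ha hb hx hxy
        gcongr
    _ = rwt a₁ b₁ x * (rwt a₂ b₂ y * rwt a₃ b₃ y) * rwt (-p) (-s) x := by
        rw [rwt_mul _ _ _ _ hy]
    _ ≤ rwt a₁ b₁ x * (rwt a₂ b₂ y * (2 ^ B * rwt a₃ b₃ z)) * rwt (-p) (-s) x := by gcongr
    _ = _ := by ring

/-- In a triangle the two longer sides agree up to a factor two; whichever side is shortest takes
the role of `x`. The statement is symmetric in the three sides, which is why all pairwise sums of
exponents have to be nonnegative. -/
theorem rwt_trilinear {p s B a₁ b₁ a₂ b₂ a₃ b₃ : ℝ} (ha12 : 0 ≤ a₁ + a₂) (ha13 : 0 ≤ a₁ + a₃)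
    (ha23 : 0 ≤ a₂ + a₃) (hb12 : 0 ≤ b₁ + b₂) (hb13 : 0 ≤ b₁ + b₃)
    (hb23 : 0 ≤ b₂ + b₃) (hp : a₁ + a₂ + a₃ ≤ p) (hs : s ≤ b₁ + b₂ + b₃)
    (hB2 : |a₂| + |b₂| ≤ B) (hB3 : |a₃| + |b₃| ≤ B)
    {x y z : ℝ} (hx : 0 < x) (hy : 0 < y) (hz : 0 < z) (h1 : x ≤ y + z) (h2 : y ≤ x + z)
    (h3 : z ≤ x + y) :
    1 ≤ 2 ^ B * (rwt a₁ b₁ x * rwt a₂ b₂ y * rwt a₃ b₃ z *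
      (rwt (-p) (-s) x + rwt (-p) (-s) y + rwt (-p) (-s) z)) := by
  have hw1 := rwt_pos a₁ b₁ hx
  have hw2 := rwt_pos a₂ b₂ hy
  have hw3 := rwt_pos a₃ b₃ hz
  have m1 := rwt_pos (-p) (-s) hx
  have m2 := rwt_pos (-p) (-s) hy
  have m3 := rwt_pos (-p) (-s) hz
  have hP : 0 < rwt a₁ b₁ x * rwt a₂ b₂ y * rwt a₃ b₃ z := by positivity
  have h2B : (0 : ℝ) < 2 ^ B := by positivity
  by_cases hxy : x ≤ y
  · by_cases hxz : x ≤ z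
    · refine (rwt_trilinear_of_smallest (p := p) (s := s) (B := B) (a₁ := a₁) (b₁ := b₁)
        (x := x) (y := y) (z := z) ha23 hb23
        hp hs hB3 hx hxy (by linarith) (by linarith)).trans ?_
      gcongr; linarith
    · have := rwt_trilinear_of_smallest (p := p) (s := s) (B := B) (a₁ := a₃) (b₁ := b₃)
        (x := z) (y := x) (z := y) ha12 hb12
        (by linarith) (by linarith) hB2 hz (by linarith) (by linarith) (by linarith)
      refine this.trans ?_
      rw [show rwt a₃ b₃ z * rwt a₁ b₁ x * rwt a₂ b₂ y = rwt a₁ b₁ x * rwt a₂ b₂ y * rwt a₃ b₃ z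
        by ring]
      gcongr; linarith
  · by_cases hyz : y ≤ z
    · have := rwt_trilinear_of_smallest (p := p) (s := s) (B := B) (a₁ := a₂) (b₁ := b₂)
        (x := y) (y := x) (z := z) ha13 hb13
        (by linarith) (by linarith) hB3 hy (by linarith) (by linarith) (by linarith)
      refine this.trans ?_
      rw [show rwt a₂ b₂ y * rwt a₁ b₁ x * rwt a₃ b₃ z = rwt a₁ b₁ x * rwt a₂ b₂ y * rwt a₃ b₃ z
        by ring]
      gcongr; linarith
    · have := rwt_trilinear_of_smallest (p := p) (s := s) (B := B) (a₁ := a₃) (b₁ := b₃)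
        (x := z) (y := x) (z := y) ha12 hb12
        (by linarith) (by linarith) hB2 hz (by linarith) (by linarith) (by linarith)
      refine this.trans ?_
      rw [show rwt a₃ b₃ z * rwt a₁ b₁ x * rwt a₂ b₂ y = rwt a₁ b₁ x * rwt a₂ b₂ y * rwt a₃ b₃ z
        by ring]
      gcongr; linarith

/-! ### The weights as Fourier symbols. -/

/-- The Fourier symbol of order `a` near zero and `b` at infinity. -/
noncomputable abbrev wt {d : ℕ} (a b : ℝ) : Rd d → ℝ := sobolevSymbol a (b - a)

theorem wt_eq {d : ℕ} (a b : ℝ) (η : Rd d) : wt a b η = rwt a b ‖η‖ := rfl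

theorem wt_pos {d : ℕ} (a b : ℝ) {η : Rd d} (h : η ≠ 0) : 0 < wt a b η :=
  rwt_pos _ _ (norm_pos_iff.2 h)

theorem wt_nonneg {d : ℕ} (a b : ℝ) (η : Rd d) : 0 ≤ wt a b η := rwt_nonneg _ _ (norm_nonneg _)

theorem measurable_sobolevSymbol {d : ℕ} (a b : ℝ) :
    Measurable (sobolevSymbol a b : Rd d → ℝ) := by
  unfold sobolevSymbol
  fun_prop

theorem sobolevSymbol_neg {d : ℕ} (a b : ℝ) (η : Rd d) :
    sobolevSymbol a b (-η) = sobolevSymbol a b η := by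
  simp [sobolevSymbol]

/-- Duality: moving the symbol of the product to the other side gives it the exponents `-a`, `-b`,
and the bound becomes the symmetric trilinear inequality. The conditions `a ≤ a₁`, `a ≤ a₂`, `0 ≤ a₁
+ a₂`, and likewise for `b`, are its pairwise sign conditions. -/
theorem wt_bilinear {d : ℕ} {p s B a b a₁ b₁ a₂ b₂ : ℝ} (ha1 : a ≤ a₁) (ha2 : a ≤ a₂)
    (ha12 : 0 ≤ a₁ + a₂) (hb1 : b ≤ b₁) (hb2 : b ≤ b₂) (hb12 : 0 ≤ b₁ + b₂)
    (hp : a₁ + a₂ - a ≤ p) (hs : s ≤ b₁ + b₂ - b) (hB1 : |a₁| + |b₁| ≤ B) (hB2 : |a₂| + |b₂| ≤ B)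
    {ζ η : Rd d} (hζ : ζ ≠ 0) (hη : η ≠ 0) (hξ : ζ + η ≠ 0) :
    wt a b (ζ + η) ≤ 2 ^ B * (wt a₁ b₁ ζ * wt a₂ b₂ η *
      (wt (-p) (-s) (ζ + η) + wt (-p) (-s) ζ + wt (-p) (-s) η)) := by
  have hx := norm_pos_iff.2 hξ
  have hy := norm_pos_iff.2 hζ
  have hz := norm_pos_iff.2 hη
  have t1 := norm_add_le ζ η
  have t2 : ‖ζ‖ ≤ ‖ζ + η‖ + ‖η‖ := by simpa using norm_sub_le (ζ + η) η
  have t3 : ‖η‖ ≤ ‖ζ + η‖ + ‖ζ‖ := by simpa using norm_sub_le (ζ + η) ζ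
  have := rwt_trilinear (p := p) (s := s) (B := B) (a₁ := -a) (b₁ := -b) (a₂ := a₁) (b₂ := b₁)
    (a₃ := a₂) (b₃ := b₂) (by linarith) (by linarith) (by linarith) (by linarith) (by linarith)
    (by linarith) (by linarith) (by linarith) hB1 hB2 hx hy hz t1 t2 t3
  rw [rwt_neg a b hx] at this
  have hw := rwt_pos a b hx
  simp only [wt_eq]
  calc rwt a b ‖ζ + η‖ = rwt a b ‖ζ + η‖ * 1 := (mul_one _).symm
    _ ≤ _ := mul_le_mul_of_nonneg_left this hw.le
    _ = _ := by field_simp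

/-! ### Square integrability of the weights -/

/-- In polar coordinates the integrand is at most a constant times `r^{d-1-2p}` near zero and
`r^{d-1-2s}` at infinity; the two strict inequalities are exactly what makes these integrable. -/
theorem integrable_wt_sq {d : ℕ} (hd : 2 ≤ d) {p s : ℝ} (hp : p < (d : ℝ) / 2)
    (hs : (d : ℝ) / 2 < s) :
    Integrable (fun ξ : Rd d => (wt (-p) (-s) ((2 * Real.pi) • ξ)) ^ 2) volume := by
  have : Nonempty (Fin d) := ⟨⟨0, by omega⟩⟩
  have : Nontrivial (Rd d) := inferInstance
  have h0 : Integrable (fun ξ : Rd d => (wt (-p) (-s) ξ) ^ 2) volume := by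
    have h1 := integrable_fun_norm_addHaar (volume : Measure (Rd d))
      (f := fun x => (rwt (-p) (-s) x) ^ 2)
    refine h1.2 ?_
    rw [finrank_euclideanSpace_fin, ← Set.Ioc_union_Ioi_eq_Ioi (zero_le_one (α := ℝ))]
    have hdd : ((d - 1 : ℕ) : ℝ) = d - 1 := by
      rw [Nat.cast_sub (by omega)]; simp
    have hmeas : Measurable (fun y : ℝ => y ^ (d - 1) • (rwt (-p) (-s) y) ^ 2) := by
      unfold rwt; fun_prop
    apply IntegrableOn.union
    · have hI : IntegrableOn (fun y : ℝ => (2 : ℝ) ^ |p - s| * y ^ ((d : ℝ) - 1 - 2 * p)) (Set.Ioc 0 1) := by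
        apply Integrable.const_mul
        rw [← IntegrableOn, ← intervalIntegrable_iff_integrableOn_Ioc_of_le zero_le_one]
        exact intervalIntegral.intervalIntegrable_rpow' (by linarith)
      refine Integrable.mono' hI hmeas.aestronglyMeasurable ?_
      refine (ae_restrict_iff' measurableSet_Ioc).2 (.of_forall fun y hy => ?_)
      have hy0 : 0 < y := hy.1
      have hr := rwt_pos (-p) (-s) hy0
      rw [Real.norm_of_nonneg (by positivity), smul_eq_mul]
      unfold rwt
      rw [mul_pow, ← Real.rpow_natCast y (d - 1), ← Real.rpow_natCast (y ^ (-p)),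
        ← Real.rpow_mul hy0.le, ← Real.rpow_natCast ((1 + y ^ 2) ^ _),
        ← Real.rpow_mul (by positivity), ← mul_assoc, ← Real.rpow_add hy0, mul_comm]
      have e1 : (d - 1 : ℕ) + (-p) * ((2 : ℕ) : ℝ) = (d : ℝ) - 1 - 2 * p := by rw [hdd]; push_cast; ring
      rw [e1]
      refine mul_le_mul_of_nonneg_right ?_ (by positivity)
      have e2 : (-s - -p) / 2 * ((2 : ℕ) : ℝ) = p - s := by push_cast; ring
      rw [e2]
      have h3 : (1 : ℝ) ≤ 1 + y ^ 2 := by nlinarith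
      calc (1 + y ^ 2) ^ (p - s) ≤ (1 + y ^ 2) ^ |p - s| :=
            Real.rpow_le_rpow_of_exponent_le h3 (le_abs_self _)
        _ ≤ 2 ^ |p - s| := by
            apply Real.rpow_le_rpow (by positivity) _ (abs_nonneg _)
            have := hy.2
            nlinarith
    · have hI : IntegrableOn (fun y : ℝ => (2 : ℝ) ^ |p - s| * y ^ ((d : ℝ) - 1 - 2 * s)) (Set.Ioi 1) := by
        apply Integrable.const_mul
        exact integrableOn_Ioi_rpow_of_lt (by linarith) one_pos
      refine Integrable.mono' hI hmeas.aestronglyMeasurable ?_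
      refine (ae_restrict_iff' measurableSet_Ioi).2 (.of_forall fun y hy => ?_)
      have hy1 : 1 < y := hy
      have hy0 : 0 < y := by linarith
      have hr := rwt_pos (-p) (-s) hy0
      rw [Real.norm_of_nonneg (by positivity), smul_eq_mul]
      have h4 : rwt (-p) (-s) y ^ 2 ≤ 2 ^ |p - s| * (y ^ (-2 * s)) := by
        have e0 : rwt (-p) (-s) y ^ 2 = (y ^ 2) ^ (-p) * (1 + y ^ 2) ^ (p - s) := by
          unfold rwt
          rw [mul_pow, ← Real.rpow_natCast (y ^ (-p)), ← Real.rpow_mul hy0.le,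
            ← Real.rpow_natCast ((1 + y ^ 2) ^ _),
            ← Real.rpow_mul (by positivity), ← Real.rpow_natCast y, ← Real.rpow_mul hy0.le]
          congr 2 <;> push_cast <;> ring
        have e1 := rpow_le_two_rpow_abs (x := 1 + y ^ 2) (y := y ^ 2) (by positivity) (by positivity)
          (by nlinarith) (by nlinarith) (p - s)
        rw [e0]
        calc _ ≤ (y ^ 2) ^ (-p) * (2 ^ |p - s| * (y ^ 2) ^ (p - s)) := by gcongr
          _ = 2 ^ |p - s| * ((y ^ 2) ^ (-p) * (y ^ 2) ^ (p - s)) := by ring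
          _ = _ := by
            rw [← Real.rpow_add (by positivity), ← Real.rpow_natCast y, ← Real.rpow_mul hy0.le]
            congr 2; push_cast; ring
      calc y ^ (d - 1) * rwt (-p) (-s) y ^ 2 ≤ y ^ (d - 1) * (2 ^ |p - s| * (y ^ (-2 * s))) := by
            gcongr
        _ = 2 ^ |p - s| * (y ^ ((d - 1 : ℕ) : ℝ) * y ^ (-2 * s)) := by
            rw [Real.rpow_natCast]; ring
        _ = _ := by
            rw [← Real.rpow_add hy0, hdd]
            congr 2; ring
  exact (integrable_comp_smul_iff volume (fun ξ : Rd d => (wt (-p) (-s) ξ) ^ 2)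
    (by positivity : (2 * Real.pi) ≠ 0)).2 h0

/-! ### Weighted convolution estimates -/

/-- The `L²` norm of an extended nonnegative function. -/
noncomputable def l2 {d : ℕ} (f : Rd d → ℝ≥0∞) : ℝ≥0∞ := (∫⁻ ξ, f ξ ^ (2 : ℝ)) ^ (1 / 2 : ℝ)

theorem eLpNorm_two_eq_l2 {d : ℕ} (F : Rd d → ℂ) : eLpNorm F 2 volume = l2 (fun ξ => ‖F ξ‖ₑ) := by
  rw [eLpNorm_eq_lintegral_rpow_enorm_toReal (by norm_num) (by norm_num)]
  simp [l2]

theorem l2_sq {d : ℕ} (f : Rd d → ℝ≥0∞) : l2 f ^ (2 : ℝ) = ∫⁻ ξ, f ξ ^ (2 : ℝ) := by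
  rw [l2, ← ENNReal.rpow_mul]; norm_num

theorem l2_add_le {d : ℕ} {f g : Rd d → ℝ≥0∞} (hf : AEMeasurable f volume)
    (hg : AEMeasurable g volume) : l2 (f + g) ≤ l2 f + l2 g :=
  ENNReal.lintegral_Lp_add_le hf hg (by norm_num)

theorem l2_mono {d : ℕ} {f g : Rd d → ℝ≥0∞} (h : ∀ᵐ ξ ∂volume, f ξ ≤ g ξ) : l2 f ≤ l2 g := by
  unfold l2
  refine ENNReal.rpow_le_rpow (lintegral_mono_ae ?_) (by norm_num)
  filter_upwards [h] with ξ hξ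
  exact ENNReal.rpow_le_rpow hξ (by norm_num)

theorem l2_const_mul {d : ℕ} (c : ℝ≥0∞) {f : Rd d → ℝ≥0∞} (hf : AEMeasurable f volume) :
    l2 (fun ξ => c * f ξ) = c * l2 f := by
  unfold l2
  simp_rw [ENNReal.mul_rpow_of_nonneg _ _ (by norm_num : (0 : ℝ) ≤ 2)]
  rw [lintegral_const_mul'' _ (hf.pow_const _), ENNReal.mul_rpow_of_nonneg _ _ (by norm_num),
    ← ENNReal.rpow_mul]
  norm_num

theorem lintegral_mul_le_l2 {d : ℕ} {f g : Rd d → ℝ≥0∞} (hf : AEMeasurable f volume)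
    (hg : AEMeasurable g volume) : ∫⁻ ξ, f ξ * g ξ ≤ l2 f * l2 g :=
  ENNReal.lintegral_mul_le_Lp_mul_Lq volume
    (Real.holderConjugate_iff.2 (by norm_num)) hf hg

theorem aemeasurable_comp_sub {d : ℕ} {f : Rd d → ℝ≥0∞} (hf : AEMeasurable f volume) (ξ : Rd d) :
    AEMeasurable (fun t => f (ξ - t)) volume :=
  hf.comp_quasiMeasurePreserving (quasiMeasurePreserving_sub_left volume ξ)

theorem l2_comp_sub {d : ℕ} (f : Rd d → ℝ≥0∞) (ξ : Rd d) : l2 (fun t => f (ξ - t)) = l2 f := by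
  unfold l2
  rw [lintegral_sub_left_eq_self (fun t => f t ^ (2 : ℝ)) ξ]

theorem aemeasurable_conv {d : ℕ} {f g : Rd d → ℝ≥0∞} (hf : AEMeasurable f volume)
    (hg : AEMeasurable g volume) :
    AEMeasurable (fun q : Rd d × Rd d => f q.2 * g (q.1 - q.2)) (volume.prod volume) := by
  refine (hf.comp_snd).mul ?_
  exact hg.comp_quasiMeasurePreserving (quasiMeasurePreserving_sub volume volume)

/-- The hypothesis says that `T²` is at most `A²` times the convolution of `f²` and `g²`, whose
integral factors by Tonelli and translation invariance. -/
theorem l2_conv_le_of_le {d : ℕ} {f g : Rd d → ℝ≥0∞} (hf : AEMeasurable f volume)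
    (hg : AEMeasurable g volume) {T : Rd d → ℝ≥0∞} {A : ℝ≥0∞}
    (hT : ∀ ξ, T ξ ≤ A * l2 (fun t => f t * g (ξ - t))) : l2 T ≤ A * (l2 f * l2 g) := by
  have h1 : ∀ ξ, T ξ ^ (2 : ℝ) ≤ A ^ (2 : ℝ) * ∫⁻ t, f t ^ (2 : ℝ) * g (ξ - t) ^ (2 : ℝ) := by
    intro ξ
    refine (ENNReal.rpow_le_rpow (hT ξ) (by norm_num)).trans (le_of_eq ?_)
    rw [ENNReal.mul_rpow_of_nonneg _ _ (by norm_num), l2_sq]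
    simp_rw [ENNReal.mul_rpow_of_nonneg _ _ (by norm_num : (0 : ℝ) ≤ 2)]
  have hm := aemeasurable_conv (hf.pow_const (2 : ℝ)) (hg.pow_const (2 : ℝ))
  have h2 : ∫⁻ ξ, T ξ ^ (2 : ℝ) ≤ A ^ (2 : ℝ) * (l2 f ^ (2 : ℝ) * l2 g ^ (2 : ℝ)) := by
    refine (lintegral_mono h1).trans (le_of_eq ?_)
    rw [lintegral_const_mul'' _ hm.lintegral_prod_right', lintegral_lintegral_swap hm]
    congr 1
    have : ∀ t : Rd d, ∫⁻ ξ, f t ^ (2 : ℝ) * g (ξ - t) ^ (2 : ℝ) = f t ^ (2 : ℝ) * l2 g ^ (2 : ℝ) := by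
      intro t
      have hgt : AEMeasurable (fun ξ => g (ξ - t)) volume :=
        hg.comp_quasiMeasurePreserving (measurePreserving_sub_right volume t).quasiMeasurePreserving
      rw [lintegral_const_mul'' _ (hgt.pow_const _),
        lintegral_sub_right_eq_self (fun t => g t ^ (2 : ℝ)) t, l2_sq]
    simp_rw [this]
    rw [lintegral_mul_const'' _ (hf.pow_const _), l2_sq f]
  unfold l2 at *
  refine (ENNReal.rpow_le_rpow h2 (by norm_num : (0 : ℝ) ≤ 1 / 2)).trans (le_of_eq ?_)
  rw [← ENNReal.mul_rpow_of_nonneg _ _ (by norm_num), ← ENNReal.mul_rpow_of_nonneg _ _ (by norm_num),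
    ← ENNReal.rpow_mul]
  norm_num

/-- If the weight sits at the output frequency, `f * g` is bounded uniformly by Cauchy-Schwarz and
the weight supplies the square integrability. If it sits at an input frequency, Cauchy-Schwarz in
`t` against the weight leaves the situation of `l2_conv_le_of_le`. -/
theorem l2_conv_weight_le {d : ℕ} {f g M : Rd d → ℝ≥0∞} (hf : AEMeasurable f volume)
    (hg : AEMeasurable g volume) (hM : Measurable M) :
    l2 (fun ξ => ∫⁻ t, (M ξ + M t + M (ξ - t)) * (f t * g (ξ - t))) ≤
      3 * l2 M * (l2 f * l2 g) := by
  have hfg : ∀ ξ, AEMeasurable (fun t => f t * g (ξ - t)) volume := fun ξ =>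
    hf.mul (aemeasurable_comp_sub hg ξ)
  have hMs : ∀ ξ, AEMeasurable (fun t => M (ξ - t)) volume := fun ξ =>
    aemeasurable_comp_sub hM.aemeasurable ξ
  have hc : AEMeasurable (fun ξ => ∫⁻ t, f t * g (ξ - t)) volume :=
    (aemeasurable_conv hf hg).lintegral_prod_right'
  have hc2 : AEMeasurable (fun ξ => ∫⁻ t, M t * (f t * g (ξ - t))) volume := by
    have := (aemeasurable_conv (hM.aemeasurable.mul hf) hg).lintegral_prod_right'
    simpa [mul_assoc] using this
  have hc3 : AEMeasurable (fun ξ => ∫⁻ t, M (ξ - t) * (f t * g (ξ - t))) volume := by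
    have := (aemeasurable_conv hf (hM.aemeasurable.mul hg)).lintegral_prod_right'
    simpa [mul_left_comm] using this
  have e : (fun ξ => ∫⁻ t, (M ξ + M t + M (ξ - t)) * (f t * g (ξ - t))) =
      ((M * (fun ξ => ∫⁻ t, f t * g (ξ - t))) + (fun ξ => ∫⁻ t, M t * (f t * g (ξ - t)))) +
        (fun ξ => ∫⁻ t, M (ξ - t) * (f t * g (ξ - t))) := by
    funext ξ
    simp only [Pi.add_apply, Pi.mul_apply]
    simp_rw [add_mul]
    have a1 := lintegral_add_right' (μ := volume) (fun t => M ξ * (f t * g (ξ - t)) + M t * (f t * g (ξ - t)))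
      ((hMs ξ).mul (hfg ξ))
    have a2 := lintegral_add_right' (μ := volume) (fun t => M ξ * (f t * g (ξ - t)))
      (hM.aemeasurable.mul (hfg ξ))
    simp only [Pi.mul_apply] at a1 a2
    rw [a1, a2, lintegral_const_mul'' _ (hfg ξ)]
  rw [e]
  refine (l2_add_le ((hM.aemeasurable.mul hc).add hc2) hc3).trans ?_
  refine (add_le_add_left (l2_add_le (hM.aemeasurable.mul hc) hc2) _).trans ?_
  have e1 : l2 (M * (fun ξ => ∫⁻ t, f t * g (ξ - t))) ≤ l2 M * (l2 f * l2 g) := by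
    refine (l2_mono (g := fun ξ => (l2 f * l2 g) * M ξ) (.of_forall fun ξ => ?_)).trans ?_
    · rw [Pi.mul_apply, mul_comm]
      refine mul_le_mul_left ?_ _
      refine (lintegral_mul_le_l2 hf (aemeasurable_comp_sub hg ξ)).trans ?_
      rw [l2_comp_sub]
    · rw [l2_const_mul _ hM.aemeasurable, mul_comm]
  have e2 : l2 (fun ξ => ∫⁻ t, M t * (f t * g (ξ - t))) ≤ l2 M * (l2 f * l2 g) :=
    l2_conv_le_of_le hf hg fun ξ => lintegral_mul_le_l2 hM.aemeasurable (hfg ξ)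
  have e3 : l2 (fun ξ => ∫⁻ t, M (ξ - t) * (f t * g (ξ - t))) ≤ l2 M * (l2 f * l2 g) :=
    l2_conv_le_of_le hf hg fun ξ => by
      refine (lintegral_mul_le_l2 (hMs ξ) (hfg ξ)).trans ?_
      rw [l2_comp_sub]
  calc _ ≤ l2 M * (l2 f * l2 g) + l2 M * (l2 f * l2 g) + l2 M * (l2 f * l2 g) :=
        add_le_add (add_le_add e1 e2) e3
    _ = _ := by ring

/-- A product estimate for multiplier norms: the symbol of the product is controlled by two
products of symbols, up to a square integrable weight in one of the three frequencies. -/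
theorem multiplierNorm_mul_le_add {d : ℕ} (hd : 2 ≤ d) {W V₁ V₂ V₁' V₂' M : Rd d → ℝ} {C : ℝ}
    (hV₁ : Measurable V₁) (hV₂ : Measurable V₂) (hV₁' : Measurable V₁') (hV₂' : Measurable V₂')
    (hM : Measurable M) (hM0 : ∀ η, 0 ≤ M η) (hC : 0 ≤ C)
    (h : ∀ ζ η : Rd d, ζ ≠ 0 → η ≠ 0 → ζ + η ≠ 0 →
      |W (ζ + η)| ≤ C * ((|V₁ ζ| * |V₂ η| + |V₁' ζ| * |V₂' η|) * (M (ζ + η) + M ζ + M η)))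
    {u v : Rd d → ℂ} (hu : FL u) (hv : FL v) :
    multiplierNorm W (u * v) ≤
      ENNReal.ofReal C * (3 * l2 (fun ξ => ENNReal.ofReal (M ((2 * Real.pi) • ξ)))) *
      (multiplierNorm V₁ u * multiplierNorm V₂ v + multiplierNorm V₁' u * multiplierNorm V₂' v) := by
  obtain ⟨w, hw, rfl⟩ := hu
  obtain ⟨z, hz, rfl⟩ := hv
  have e0 : 𝓕⁻ w * 𝓕⁻ z = 𝓕⁻ (convolution w z (ContinuousLinearMap.mul ℂ ℂ) volume) :=
    (fourierInv_mul hw hz).symm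
  rw [e0, multiplierNorm_fourierInv _ (hw.integrable_convolution _ hz)]
  simp only [multiplierNorm_fourierInv _ hw, multiplierNorm_fourierInv _ hz, eLpNorm_two_eq_l2]
  set N : Rd d → ℝ≥0∞ := fun ξ => ENNReal.ofReal (M ((2 * Real.pi) • ξ)) with hN
  have hNm : Measurable N := (hM.comp (measurable_const_smul _)).ennreal_ofReal
  set f : Rd d → ℝ≥0∞ := fun ξ => ‖((V₁ ((2 * Real.pi) • ξ) : ℝ) : ℂ) * w ξ‖ₑ with hf
  set g : Rd d → ℝ≥0∞ := fun ξ => ‖((V₂ ((2 * Real.pi) • ξ) : ℝ) : ℂ) * z ξ‖ₑ with hg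
  set f' : Rd d → ℝ≥0∞ := fun ξ => ‖((V₁' ((2 * Real.pi) • ξ) : ℝ) : ℂ) * w ξ‖ₑ with hf'
  set g' : Rd d → ℝ≥0∞ := fun ξ => ‖((V₂' ((2 * Real.pi) • ξ) : ℝ) : ℂ) * z ξ‖ₑ with hg'
  have mf : AEMeasurable f volume := (aestronglyMeasurable_multiplier hV₁ hw).enorm
  have mg : AEMeasurable g volume := (aestronglyMeasurable_multiplier hV₂ hz).enorm
  have mf' : AEMeasurable f' volume := (aestronglyMeasurable_multiplier hV₁' hw).enorm
  have mg' : AEMeasurable g' volume := (aestronglyMeasurable_multiplier hV₂' hz).enorm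
  have hK : ∀ {a b : Rd d → ℝ≥0∞}, AEMeasurable a volume → AEMeasurable b volume →
      AEMeasurable (fun q : Rd d × Rd d => (N q.1 + N q.2 + N (q.1 - q.2)) * (a q.2 * b (q.1 - q.2)))
        (volume.prod volume) := fun ha hb => by
    refine AEMeasurable.mul (Measurable.aemeasurable ?_) (aemeasurable_conv ha hb)
    exact ((hNm.comp measurable_fst).add (hNm.comp measurable_snd)).add
      (hNm.comp (measurable_fst.sub measurable_snd))
  set T := fun ξ => ∫⁻ t, (N ξ + N t + N (ξ - t)) * (f t * g (ξ - t)) with hT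
  set T' := fun ξ => ∫⁻ t, (N ξ + N t + N (ξ - t)) * (f' t * g' (ξ - t)) with hT'
  have mT : AEMeasurable T volume := (hK mf mg).lintegral_prod_right'
  have mT' : AEMeasurable T' volume := (hK mf' mg').lintegral_prod_right'
  have hpt : ∀ᵐ ξ ∂volume, ‖((W ((2 * Real.pi) • ξ) : ℝ) : ℂ) *
      convolution w z (ContinuousLinearMap.mul ℂ ℂ) volume ξ‖ₑ ≤
        ENNReal.ofReal C * (T + T') ξ := by
    filter_upwards [ae_ne_zero hd] with ξ hξ
    have mfg : AEMeasurable (fun t => (N ξ + N t + N (ξ - t)) * (f t * g (ξ - t))) volume := by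
      refine AEMeasurable.mul (Measurable.aemeasurable ?_) (mf.mul (aemeasurable_comp_sub mg ξ))
      exact (measurable_const.add hNm).add (hNm.comp (measurable_const.sub measurable_id))
    have e1 := lintegral_add_left' mfg (fun t => (N ξ + N t + N (ξ - t)) * (f' t * g' (ξ - t)))
    simp only [Pi.add_apply, hT, hT']
    rw [← e1, ← lintegral_const_mul' _ _ ENNReal.ofReal_ne_top, enorm_mul]
    unfold convolution
    refine (mul_le_mul_right (enorm_integral_le_lintegral_enorm _) _).trans ?_
    rw [← lintegral_const_mul' _ _ enorm_ne_top]
    refine lintegral_mono_ae ?_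
    -- At `t = ξ` the second frequency vanishes and the symbol hypothesis says nothing.
    have hne : ∀ᵐ t : Rd d ∂volume, t ≠ ξ := by
      have h0 := (measurePreserving_sub_right volume ξ).quasiMeasurePreserving.ae (ae_ne_zero hd)
      filter_upwards [h0] with t ht h'
      exact ht (by rw [h', sub_self])
    filter_upwards [ae_ne_zero hd, hne] with t ht htξ
    have h1 := h ((2 * Real.pi) • t) ((2 * Real.pi) • (ξ - t)) (two_pi_smul_ne_zero ht)
      (two_pi_smul_ne_zero (sub_ne_zero.2 htξ.symm))
      (by rw [← smul_add, add_sub_cancel]; exact two_pi_smul_ne_zero hξ)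
    rw [← smul_add, add_sub_cancel] at h1
    have hM1 := hM0 ((2 * Real.pi) • t)
    have hM2 := hM0 ((2 * Real.pi) • (ξ - t))
    have hM3 := hM0 ((2 * Real.pi) • ξ)
    rw [ContinuousLinearMap.mul_apply']
    simp only [hN, hf, hg, hf', hg', ← ofReal_norm]
    rw [← ENNReal.ofReal_add (by positivity) (by positivity),
      ← ENNReal.ofReal_add (by positivity) (by positivity),
      ← ENNReal.ofReal_mul (by positivity), ← ENNReal.ofReal_mul (by positivity),
      ← ENNReal.ofReal_mul (by positivity), ← ENNReal.ofReal_mul (by positivity),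
      ← ENNReal.ofReal_mul (by positivity), ← ENNReal.ofReal_add (by positivity) (by positivity),
      ← ENNReal.ofReal_mul (by positivity)]
    apply ENNReal.ofReal_le_ofReal
    simp only [norm_mul, Complex.norm_real, Real.norm_eq_abs]
    refine (mul_le_mul_of_nonneg_right h1 (by positivity : 0 ≤ ‖w t‖ * ‖z (ξ - t)‖)).trans
      (le_of_eq ?_)
    ring
  refine (l2_mono hpt).trans ?_
  have mTT : AEMeasurable (T + T') volume := mT.add mT'
  rw [l2_const_mul _ mTT, mul_assoc]
  refine mul_le_mul_right ((l2_add_le mT mT').trans ?_) _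
  rw [mul_add]
  exact add_le_add (l2_conv_weight_le mf mg hNm) (l2_conv_weight_le mf' mg' hNm)

/-! ### Product estimates in the function spaces -/

/-- The admissible range of the dimension, the regularity and the low frequency parameter. -/
structure Params (d : ℕ) (s δ : ℝ) : Prop where
  two_le : 2 ≤ d
  lt_s : (d : ℝ) / 2 < s
  pos : 0 < δ
  lt_quarter : δ < 1 / 4

/-- The low frequency exponent `σ_d`. -/
noncomputable abbrev lowExp (d : ℕ) (δ : ℝ) : ℝ := (d : ℝ) / 2 - δ

/-- The constant of the product estimates. -/
noncomputable def prodConst (d : ℕ) (s δ : ℝ) : ℝ≥0∞ :=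
  ENNReal.ofReal (2 ^ ((d : ℝ) + s + 4)) *
    (3 * l2 (fun ξ : Rd d => ENNReal.ofReal (wt (-lowExp d δ) (-s) ((2 * Real.pi) • ξ))))

namespace Params
variable {d : ℕ} {s δ : ℝ} (P : Params d s δ)
include P

theorem two_le_real : (2 : ℝ) ≤ d := by exact_mod_cast P.two_le

theorem deltaD_nonneg : 0 ≤ deltaD d δ := by
  unfold deltaD; split_ifs
  · exact P.pos.le
  · exact le_rfl

theorem deltaD_lt : deltaD d δ < 1 / 4 := by
  unfold deltaD; split_ifs
  · exact P.lt_quarter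
  · norm_num

/-- A product of two factors of low frequency order zero lands in order `δ_d - 1` at the price `1 -
δ_d`, and the square integrable weight pays up to `d/2 - δ`. In dimension two this is an equality,
which explains `δ_d = δ` there; for `d ≥ 3` there is room. -/
theorem one_sub_deltaD_le : 1 - deltaD d δ ≤ lowExp d δ := by
  unfold deltaD lowExp; split_ifs with h
  · subst h; norm_num
  · have h3 : 3 ≤ d := by have := P.two_le; omega
    have : (3 : ℝ) ≤ d := by exact_mod_cast h3
    have := P.lt_quarter
    linarith

theorem l2_weight_ne_top :
    l2 (fun ξ : Rd d => ENNReal.ofReal (wt (-lowExp d δ) (-s) ((2 * Real.pi) • ξ))) ≠ ⊤ := by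
  have h := integrable_wt_sq P.two_le (p := lowExp d δ) (s := s)
    (by have := P.pos; unfold lowExp; linarith) P.lt_s
  unfold l2
  refine (ENNReal.rpow_lt_top_of_nonneg (by norm_num) ?_).ne
  have h1 := h.lintegral_lt_top
  refine ne_of_lt (lt_of_le_of_lt (lintegral_mono fun ξ => ?_) h1)
  rw [ENNReal.ofReal_rpow_of_nonneg (wt_nonneg _ _ _) (by norm_num)]
  apply le_of_eq; congr 1
  exact Real.rpow_natCast _ 2

theorem prodConst_ne_top : prodConst d s δ ≠ ⊤ :=
  ENNReal.mul_ne_top ENNReal.ofReal_ne_top (ENNReal.mul_ne_top (by norm_num) P.l2_weight_ne_top)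

theorem abs_add_abs_le {a b : ℝ} (h1 : -1 ≤ a) (h2 : a ≤ d) (h3 : -2 ≤ b) (h4 : b ≤ s + 2) :
    |a| + |b| ≤ (d : ℝ) + s + 4 := by
  have := P.two_le_real
  have := P.lt_s
  have e1 : |a| ≤ d := abs_le.2 ⟨by linarith, h2⟩
  have e2 : |b| ≤ s + 2 := abs_le.2 ⟨by linarith, h4⟩
  linarith

theorem wt_bilinear {a b a₁ b₁ a₂ b₂ : ℝ} (ha1 : a ≤ a₁) (ha2 : a ≤ a₂)
    (ha12 : 0 ≤ a₁ + a₂) (hb1 : b ≤ b₁) (hb2 : b ≤ b₂) (hb12 : 0 ≤ b₁ + b₂)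
    (hp : a₁ + a₂ - a ≤ lowExp d δ) (hs : s ≤ b₁ + b₂ - b)
    (h1 : -1 ≤ a₁ ∧ a₁ ≤ d) (h2 : -1 ≤ a₂ ∧ a₂ ≤ d) (h3 : -2 ≤ b₁ ∧ b₁ ≤ s + 2)
    (h4 : -2 ≤ b₂ ∧ b₂ ≤ s + 2)
    {ζ η : Rd d} (hζ : ζ ≠ 0) (hη : η ≠ 0) (hξ : ζ + η ≠ 0) :
    wt a b (ζ + η) ≤ 2 ^ ((d : ℝ) + s + 4) * (wt a₁ b₁ ζ * wt a₂ b₂ η *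
      (wt (-lowExp d δ) (-s) (ζ + η) + wt (-lowExp d δ) (-s) ζ + wt (-lowExp d δ) (-s) η)) :=
  _root_.wt_bilinear ha1 ha2 ha12 hb1 hb2 hb12 hp hs (P.abs_add_abs_le h1.1 h1.2 h3.1 h3.2)
    (P.abs_add_abs_le h2.1 h2.2 h4.1 h4.2) hζ hη hξ

/-- Product estimate from a pointwise bound on the symbols. -/
theorem norm_mul_le_of_symbol {W V₁ V₂ : Rd d → ℝ} (hV₁ : Measurable V₁) (hV₂ : Measurable V₂)
    (h : ∀ ζ η : Rd d, ζ ≠ 0 → η ≠ 0 → ζ + η ≠ 0 →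
      |W (ζ + η)| ≤ 2 ^ ((d : ℝ) + s + 4) * (|V₁ ζ| * |V₂ η| * (wt (-lowExp d δ) (-s) (ζ + η) +
        wt (-lowExp d δ) (-s) ζ + wt (-lowExp d δ) (-s) η)))
    {u v : Rd d → ℂ} (hu : FL u) (hv : FL v) :
    multiplierNorm W (u * v) ≤
      prodConst d s δ * (multiplierNorm V₁ u * multiplierNorm V₂ v) := by
  have h0 := multiplierNorm_mul_le_add (V₁' := 0) (V₂' := 0) P.two_le hV₁ hV₂ measurable_zero
    measurable_zero (measurable_sobolevSymbol _ _) (wt_nonneg (-lowExp d δ) (-s))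
    (C := 2 ^ ((d : ℝ) + s + 4)) (by positivity) (W := W)
    (by simpa using h) hu hv
  have h1 : multiplierNorm 0 u = 0 := by
    obtain ⟨w, hw, rfl⟩ := hu
    rw [multiplierNorm_fourierInv _ hw]; simp
  rw [h1, zero_mul, add_zero] at h0
  exact h0

theorem norm_mul_le {a b a₁ b₁ a₂ b₂ : ℝ} (ha1 : a ≤ a₁) (ha2 : a ≤ a₂)
    (ha12 : 0 ≤ a₁ + a₂) (hb1 : b ≤ b₁) (hb2 : b ≤ b₂) (hb12 : 0 ≤ b₁ + b₂)
    (hp : a₁ + a₂ - a ≤ lowExp d δ) (hs : s ≤ b₁ + b₂ - b)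
    (h1 : -1 ≤ a₁ ∧ a₁ ≤ d) (h2 : -1 ≤ a₂ ∧ a₂ ≤ d) (h3 : -2 ≤ b₁ ∧ b₁ ≤ s + 2)
    (h4 : -2 ≤ b₂ ∧ b₂ ≤ s + 2) {u v : Rd d → ℂ} (hu : FL u) (hv : FL v) :
    multiplierNorm (wt a b) (u * v) ≤
      prodConst d s δ * (multiplierNorm (wt a₁ b₁) u * multiplierNorm (wt a₂ b₂) v) := by
  refine P.norm_mul_le_of_symbol (measurable_sobolevSymbol _ _) (measurable_sobolevSymbol _ _)
    (fun ζ η hζ hη hξ => ?_) hu hv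
  rw [abs_of_nonneg (wt_nonneg _ _ _), abs_of_nonneg (wt_nonneg _ _ _),
    abs_of_nonneg (wt_nonneg _ _ _)]
  exact P.wt_bilinear ha1 ha2 ha12 hb1 hb2 hb12 hp hs h1 h2 h3 h4 hζ hη hξ

/-- The metric space of order `σ + 1` is a module over the metric space of order `s + 1`. -/
theorem norm_metric_mul_metric {σ : ℝ} (h1 : (d : ℝ) / 2 - 2 ≤ σ) (h2 : σ ≤ s)
    {u v : Rd d → ℂ} (hu : FL u) (hv : FL v) :
    multiplierNorm (wt (lowExp d δ) (σ + 1)) (u * v) ≤ prodConst d s δ *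
      (multiplierNorm (wt (lowExp d δ) (s + 1)) u *
        multiplierNorm (wt (lowExp d δ) (σ + 1)) v) := by
  have := P.two_le_real; have := P.lt_s; have := P.pos; have := P.lt_quarter
  have e : lowExp d δ = (d : ℝ) / 2 - δ := rfl
  refine P.norm_mul_le ?_ ?_ ?_ ?_ ?_ ?_ ?_ ?_ ⟨?_, ?_⟩ ⟨?_, ?_⟩ ⟨?_, ?_⟩ ⟨?_, ?_⟩ hu hv <;> linarith

/-- For the terms in which the inverse metric is varied: the variation has the regularity of order
`σ`, while the factor that it multiplies has top regularity. -/
theorem norm_metric_mul_source {σ : ℝ} (h1 : (d : ℝ) / 2 - 2 ≤ σ) (h2 : σ ≤ s)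
    {u v : Rd d → ℂ} (hu : FL u) (hv : FL v) :
    multiplierNorm (wt (deltaD d δ - 1) σ) (u * v) ≤ prodConst d s δ *
      (multiplierNorm (wt (lowExp d δ) (σ + 1)) u *
        multiplierNorm (wt (deltaD d δ - 1) s) v) := by
  have := P.two_le_real; have := P.lt_s; have := P.pos; have := P.lt_quarter
  have := P.one_sub_deltaD_le; have := P.deltaD_nonneg; have := P.deltaD_lt
  have e : lowExp d δ = (d : ℝ) / 2 - δ := rfl
  refine P.norm_mul_le ?_ ?_ ?_ ?_ ?_ ?_ ?_ ?_ ⟨?_, ?_⟩ ⟨?_, ?_⟩ ⟨?_, ?_⟩ ⟨?_, ?_⟩ hu hv <;> linarith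

/-- For the products of lowered Christoffel symbols with `A`, where the metric has already lost one
derivative. -/
theorem norm_dmetric_mul_conn {σ : ℝ} (h1 : (d : ℝ) / 2 - 2 ≤ σ) (h2 : σ ≤ s)
    {u v : Rd d → ℂ} (hu : FL u) (hv : FL v) :
    multiplierNorm (wt (deltaD d δ - 1) σ) (u * v) ≤ prodConst d s δ *
      (multiplierNorm (wt (lowExp d δ - 1) σ) u *
        multiplierNorm (wt (deltaD d δ) (s + 1)) v) := by
  have := P.two_le_real; have := P.lt_s; have := P.pos; have := P.lt_quarter
  have := P.one_sub_deltaD_le; have := P.deltaD_nonneg; have := P.deltaD_lt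
  have e : lowExp d δ = (d : ℝ) / 2 - δ := rfl
  refine P.norm_mul_le ?_ ?_ ?_ ?_ ?_ ?_ ?_ ?_ ⟨?_, ?_⟩ ⟨?_, ?_⟩ ⟨?_, ?_⟩ ⟨?_, ?_⟩ hu hv <;> linarith

/-- The lower bound on `σ` enters as `s + σ ≥ d - 2 ≥ 0`: two high frequencies interacting into a
low one need nonnegative total regularity. The low frequency condition is
`Params.one_sub_deltaD_le`. -/
theorem norm_form_mul_form {σ : ℝ} (h1 : (d : ℝ) / 2 - 2 ≤ σ) (h2 : σ ≤ s)
    {u v : Rd d → ℂ} (hu : FL u) (hv : FL v) :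
    multiplierNorm (wt (deltaD d δ - 1) σ) (u * v) ≤ prodConst d s δ *
      (multiplierNorm (wt 0 s) u * multiplierNorm (wt 0 σ) v) := by
  have := P.two_le_real; have := P.lt_s; have := P.pos; have := P.lt_quarter
  have := P.one_sub_deltaD_le; have := P.deltaD_nonneg; have := P.deltaD_lt
  have e : lowExp d δ = (d : ℝ) / 2 - δ := rfl
  refine P.norm_mul_le ?_ ?_ ?_ ?_ ?_ ?_ ?_ ?_ ⟨?_, ?_⟩ ⟨?_, ?_⟩ ⟨?_, ?_⟩ ⟨?_, ?_⟩ hu hv <;> linarith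

end Params

/-! ### Admissible weights for the elliptic estimate. -/

/-- A pair of symbols for the sources and the solutions of the div-curl system. -/
structure AdmWeight (d : ℕ) (s δ : ℝ) (Z Y : Rd d → ℝ) : Prop where
  measZ : Measurable Z
  measY : Measurable Y
  evenZ : ∀ η, Z (-η) = Z η
  evenY : ∀ η, Y (-η) = Y η
  mul_norm : ∀ η, η ≠ 0 → |Z η| * ‖η‖ = |Y η|
  le_top : ∀ η, η ≠ 0 → |Y η| ≤ |wt (deltaD d δ) (s + 1) η|
  bilinear : ∀ ζ η : Rd d, ζ ≠ 0 → η ≠ 0 → ζ + η ≠ 0 →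
      |Z (ζ + η)| ≤ 2 ^ ((d : ℝ) + s + 4) * (|wt (lowExp d δ) (s + 1) ζ| * |Z η| *
        (wt (-lowExp d δ) (-s) (ζ + η) + wt (-lowExp d δ) (-s) ζ + wt (-lowExp d δ) (-s) η))

theorem wt_mul_norm {d : ℕ} (a b : ℝ) {η : Rd d} (h : η ≠ 0) :
    wt (a - 1) b η * ‖η‖ = wt a (b + 1) η := by
  have h0 := norm_pos_iff.2 h
  have := rwt_mul (a - 1) b 1 1 h0
  rw [rwt_one] at this
  rw [wt_eq, wt_eq, this]; simp

theorem wt_mul {d : ℕ} (a b a' b' : ℝ) {η : Rd d} (h : η ≠ 0) :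
    wt a b η * wt a' b' η = wt (a + a') (b + b') η :=
  rwt_mul _ _ _ _ (norm_pos_iff.2 h)

theorem wt_le_wt {d : ℕ} {a b a' b' : ℝ} (ha : a' ≤ a) (hb : b ≤ b') {η : Rd d} (h : η ≠ 0) :
    wt a b η ≤ wt a' b' η := rwt_le_rwt ha hb (norm_pos_iff.2 h)

namespace Params
variable {d : ℕ} {s δ : ℝ} (P : Params d s δ)
include P

/-- The range of `σ` reaches `s + 1`, beyond what the linearization uses, because the envelope
weights shift `σ = s` by `±2δ`. -/
theorem source_bilinear {σ : ℝ} (h1 : (d : ℝ) / 2 - 2 ≤ σ) (h2 : σ ≤ s + 1)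
    {ζ η : Rd d} (hζ : ζ ≠ 0) (hη : η ≠ 0) (hξ : ζ + η ≠ 0) :
    wt (deltaD d δ - 1) σ (ζ + η) ≤ 2 ^ ((d : ℝ) + s + 4) *
      (wt (lowExp d δ) (s + 1) ζ * wt (deltaD d δ - 1) σ η *
      (wt (-lowExp d δ) (-s) (ζ + η) + wt (-lowExp d δ) (-s) ζ + wt (-lowExp d δ) (-s) η)) := by
  have := P.two_le_real; have := P.lt_s; have := P.pos; have := P.lt_quarter
  have := P.one_sub_deltaD_le; have := P.deltaD_nonneg; have := P.deltaD_lt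
  have e : lowExp d δ = (d : ℝ) / 2 - δ := rfl
  refine P.wt_bilinear ?_ ?_ ?_ ?_ ?_ ?_ ?_ ?_ ⟨?_, ?_⟩ ⟨?_, ?_⟩ ⟨?_, ?_⟩ ⟨?_, ?_⟩ hζ hη hξ <;>
    linarith

theorem admWeight {σ : ℝ} (h1 : (d : ℝ) / 2 - 2 ≤ σ) (h2 : σ ≤ s) :
    AdmWeight d s δ (wt (deltaD d δ - 1) σ) (wt (deltaD d δ) (σ + 1)) where
  measZ := measurable_sobolevSymbol _ _
  measY := measurable_sobolevSymbol _ _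
  evenZ := sobolevSymbol_neg _ _
  evenY := sobolevSymbol_neg _ _
  mul_norm η hη := by
    rw [abs_of_nonneg (wt_nonneg _ _ _), abs_of_nonneg (wt_nonneg _ _ _), wt_mul_norm _ _ hη]
  le_top η hη := by
    rw [abs_of_nonneg (wt_nonneg _ _ _), abs_of_nonneg (wt_nonneg _ _ _)]
    exact wt_le_wt le_rfl (by linarith) hη
  bilinear ζ η hζ hη hξ := by
    simp only [abs_of_nonneg (wt_nonneg _ _ _)]
    exact P.source_bilinear h1 (by linarith) hζ hη hξ

end Params

/-! ### Envelope weights. -/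

/-- The envelope weight `min (t, 1/t)` with `t = (c⟨η⟩)^{2δ}`. -/
noncomputable def envWt {d : ℕ} (δ c : ℝ) (η : Rd d) : ℝ :=
  min (c ^ (2 * δ) * wt 0 (2 * δ) η) (c ^ (-(2 * δ)) * wt 0 (-(2 * δ)) η)

theorem envWt_nonneg {d : ℕ} (δ : ℝ) {c : ℝ} (hc : 0 < c) (η : Rd d) : 0 ≤ envWt δ c η :=
  le_min (mul_nonneg (by positivity) (wt_nonneg _ _ _))
    (mul_nonneg (by positivity) (wt_nonneg _ _ _))

theorem measurable_envWt {d : ℕ} (δ c : ℝ) : Measurable (envWt δ c : Rd d → ℝ) :=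
  ((measurable_sobolevSymbol _ _).const_mul _).min ((measurable_sobolevSymbol _ _).const_mul _)

theorem envWt_neg {d : ℕ} (δ c : ℝ) (η : Rd d) : envWt δ c (-η) = envWt δ c η := by
  simp only [envWt, wt, sobolevSymbol_neg]

/-- The two entries of the minimum are reciprocal. -/
theorem envWt_le_one {d : ℕ} (δ : ℝ) {c : ℝ} (hc : 0 < c) {η : Rd d} (hη : η ≠ 0) :
    envWt δ c η ≤ 1 := by
  have h : (c ^ (2 * δ) * wt 0 (2 * δ) η) * (c ^ (-(2 * δ)) * wt 0 (-(2 * δ)) η) = 1 := by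
    have h1 := wt_mul 0 (2 * δ) 0 (-(2 * δ)) hη
    have h2 : c ^ (2 * δ) * c ^ (-(2 * δ)) = 1 := by rw [← Real.rpow_add hc]; simp
    have h3 : wt (0 + 0) (2 * δ + -(2 * δ)) η = 1 := by simp [wt_eq, rwt_zero]
    rw [h3] at h1
    calc _ = (c ^ (2 * δ) * c ^ (-(2 * δ))) * (wt 0 (2 * δ) η * wt 0 (-(2 * δ)) η) := by ring
      _ = 1 := by rw [h1, h2]; norm_num
  have hpos : 0 < c ^ (2 * δ) * wt 0 (2 * δ) η := mul_pos (by positivity) (wt_pos _ _ hη)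
  by_contra hcon
  push Not at hcon
  have h1 := (lt_min_iff.1 hcon).1
  have h2 := (lt_min_iff.1 hcon).2
  nlinarith

namespace Params
variable {d : ℕ} {s δ : ℝ} (P : Params d s δ)
include P

/-- The branch of the minimum that is attained at the input frequency `η` is an upper bound at the
output frequency. On that branch the envelope weight is a constant times `⟨η⟩^{±2δ}`, and the claim
is `source_bilinear` with shifted regularity. The constant does not depend on `c`. -/
theorem env_bilinear {c : ℝ} (hc : 0 < c) {ζ η : Rd d} (hζ : ζ ≠ 0) (hη : η ≠ 0)
    (hξ : ζ + η ≠ 0) :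
    envWt δ c (ζ + η) * wt (deltaD d δ - 1) s (ζ + η) ≤ 2 ^ ((d : ℝ) + s + 4) *
      (wt (lowExp d δ) (s + 1) ζ * (envWt δ c η * wt (deltaD d δ - 1) s η) *
      (wt (-lowExp d δ) (-s) (ζ + η) + wt (-lowExp d δ) (-s) ζ + wt (-lowExp d δ) (-s) η)) := by
  have := P.two_le_real; have := P.lt_s; have := P.pos; have := P.lt_quarter
  have key : ∀ τ : ℝ, |τ| ≤ 1 / 2 → envWt δ c (ζ + η) ≤ c ^ τ * wt 0 τ (ζ + η) →
      envWt δ c η = c ^ τ * wt 0 τ η → envWt δ c (ζ + η) * wt (deltaD d δ - 1) s (ζ + η) ≤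
        2 ^ ((d : ℝ) + s + 4) *
      (wt (lowExp d δ) (s + 1) ζ * (envWt δ c η * wt (deltaD d δ - 1) s η) *
      (wt (-lowExp d δ) (-s) (ζ + η) + wt (-lowExp d δ) (-s) ζ + wt (-lowExp d δ) (-s) η)) := by
    intro τ hτ hle heq
    have hτ' := abs_le.1 hτ
    have h1 := P.source_bilinear (σ := τ + s) (by linarith) (by linarith) hζ hη hξ
    rw [← zero_add (deltaD d δ - 1), ← wt_mul _ _ _ _ hη, ← wt_mul _ _ _ _ hξ] at h1
    rw [heq]
    calc _ ≤ (c ^ τ * wt 0 τ (ζ + η)) * wt (deltaD d δ - 1) s (ζ + η) :=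
          mul_le_mul_of_nonneg_right hle (wt_nonneg _ _ _)
      _ = c ^ τ * (wt 0 τ (ζ + η) * wt (deltaD d δ - 1) s (ζ + η)) := by ring
      _ ≤ _ := mul_le_mul_of_nonneg_left h1 (by positivity)
      _ = _ := by ring
  rcases min_choice (c ^ (2 * δ) * wt 0 (2 * δ) η) (c ^ (-(2 * δ)) * wt 0 (-(2 * δ)) η) with h | h
  · exact key (2 * δ) (by rw [abs_of_nonneg] <;> linarith) (min_le_left _ _) h
  · exact key (-(2 * δ)) (by rw [abs_neg, abs_of_nonneg] <;> linarith) (min_le_right _ _) h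

theorem admWeight_env {c : ℝ} (hc : 0 < c) :
    AdmWeight d s δ (fun η => envWt δ c η * wt (deltaD d δ - 1) s η)
      (fun η => envWt δ c η * wt (deltaD d δ) (s + 1) η) where
  measZ := (measurable_envWt _ _).mul (measurable_sobolevSymbol _ _)
  measY := (measurable_envWt _ _).mul (measurable_sobolevSymbol _ _)
  evenZ η := by simp only [envWt_neg, wt, sobolevSymbol_neg]
  evenY η := by simp only [envWt_neg, wt, sobolevSymbol_neg]
  mul_norm η hη := by
    rw [abs_of_nonneg (mul_nonneg (envWt_nonneg _ hc _) (wt_nonneg _ _ _)),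
      abs_of_nonneg (mul_nonneg (envWt_nonneg _ hc _) (wt_nonneg _ _ _)), mul_assoc,
      wt_mul_norm _ _ hη]
  le_top η hη := by
    rw [abs_of_nonneg (mul_nonneg (envWt_nonneg _ hc _) (wt_nonneg _ _ _)),
      abs_of_nonneg (wt_nonneg _ _ _)]
    exact mul_le_of_le_one_left (wt_nonneg _ _ _) (envWt_le_one _ hc hη)
  bilinear ζ η hζ hη hξ := by
    rw [abs_of_nonneg (mul_nonneg (envWt_nonneg _ hc _) (wt_nonneg _ _ _)),
      abs_of_nonneg (mul_nonneg (envWt_nonneg _ hc _) (wt_nonneg _ _ _)),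
      abs_of_nonneg (wt_nonneg _ _ _)]
    exact P.env_bilinear hc hζ hη hξ

/-- The envelope weight is carried by the factor of larger frequency. On the increasing branch
`|ζ+η| ≤ 2|η|` compares the weights directly; on the decreasing branch the weight amounts to
lowering the regularity of that factor by `2δ`. -/
theorem env_form_bilinear_aux {c : ℝ} (hc : 0 < c) {ζ η : Rd d} (hζ : ζ ≠ 0) (hη : η ≠ 0)
    (hξ : ζ + η ≠ 0) (hle : ‖ζ‖ ≤ ‖η‖) :
    envWt δ c (ζ + η) * wt (deltaD d δ - 1) s (ζ + η) ≤ (2 * 2 ^ ((d : ℝ) + s + 4)) *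
      (wt 0 s ζ * (envWt δ c η * wt 0 s η) *
      (wt (-lowExp d δ) (-s) (ζ + η) + wt (-lowExp d δ) (-s) ζ + wt (-lowExp d δ) (-s) η)) := by
  have := P.two_le_real; have := P.lt_s; have := P.pos; have := P.lt_quarter
  have := P.one_sub_deltaD_le; have := P.deltaD_nonneg; have := P.deltaD_lt
  have e : lowExp d δ = (d : ℝ) / 2 - δ := rfl
  set m := (wt (-lowExp d δ) (-s) (ζ + η) + wt (-lowExp d δ) (-s) ζ + wt (-lowExp d δ) (-s) η)
    with hm
  have hm0 : 0 ≤ m := add_nonneg (add_nonneg (wt_nonneg _ _ _) (wt_nonneg _ _ _)) (wt_nonneg _ _ _)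
  have hw1 := wt_nonneg 0 s ζ
  have hw2 := wt_nonneg 0 s η
  rcases min_choice (c ^ (2 * δ) * wt 0 (2 * δ) η) (c ^ (-(2 * δ)) * wt 0 (-(2 * δ)) η) with h | h
  -- A shift of exponents is not possible here: the output regularity `s + 2δ` would exceed that of
  -- the factor at `ζ`.
  · have hω : envWt δ c (ζ + η) ≤ 2 * envWt δ c η := by
      have hη0 := norm_pos_iff.2 hη
      have hξ0 := norm_pos_iff.2 hξ
      have hn : ‖ζ + η‖ ≤ 2 * ‖η‖ := (norm_add_le _ _).trans (by linarith)
      have h2 : wt 0 (2 * δ) (ζ + η) ≤ 2 * wt 0 (2 * δ) η := by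
        simp only [wt_eq]
        rw [rwt_eq _ _ hη0, rwt_eq _ _ hξ0, Real.rpow_zero, Real.rpow_zero, one_mul, one_mul]
        calc √(1 + ‖ζ + η‖ ^ 2) ^ (2 * δ) ≤ (2 * √(1 + ‖η‖ ^ 2)) ^ (2 * δ) :=
              Real.rpow_le_rpow (by positivity) (sqrt_le_two hξ0 hn) (by linarith)
          _ = 2 ^ (2 * δ) * √(1 + ‖η‖ ^ 2) ^ (2 * δ) := Real.mul_rpow (by norm_num) (by positivity)
          _ ≤ 2 ^ (1 : ℝ) * √(1 + ‖η‖ ^ 2) ^ (2 * δ) := by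
              gcongr
              · norm_num
              · linarith
          _ = _ := by rw [Real.rpow_one]
      calc envWt δ c (ζ + η) ≤ c ^ (2 * δ) * wt 0 (2 * δ) (ζ + η) := min_le_left _ _
        _ ≤ c ^ (2 * δ) * (2 * wt 0 (2 * δ) η) := by gcongr
        _ = 2 * envWt δ c η := by rw [envWt, h]; ring
    have h1 : wt (deltaD d δ - 1) s (ζ + η) ≤ 2 ^ ((d : ℝ) + s + 4) * (wt 0 s ζ * wt 0 s η * m) := by
      refine P.wt_bilinear ?_ ?_ ?_ ?_ ?_ ?_ ?_ ?_ ⟨?_, ?_⟩ ⟨?_, ?_⟩ ⟨?_, ?_⟩ ⟨?_, ?_⟩ hζ hη hξ <;>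
        linarith
    calc _ ≤ (2 * envWt δ c η) * (2 ^ ((d : ℝ) + s + 4) * (wt 0 s ζ * wt 0 s η * m)) :=
          mul_le_mul hω h1 (wt_nonneg _ _ _) (mul_nonneg (by norm_num) (envWt_nonneg _ hc _))
      _ = _ := by ring
  -- Here both the output and the `η` factor are taken at regularity `s - 2δ`, while the `ζ` factor
  -- keeps regularity `s`.
  · have h1 : wt (deltaD d δ - 1) (-(2 * δ) + s) (ζ + η) ≤
        2 ^ ((d : ℝ) + s + 4) * (wt 0 s ζ * wt 0 (-(2 * δ) + s) η * m) := by
      refine P.wt_bilinear ?_ ?_ ?_ ?_ ?_ ?_ ?_ ?_ ⟨?_, ?_⟩ ⟨?_, ?_⟩ ⟨?_, ?_⟩ ⟨?_, ?_⟩ hζ hη hξ <;>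
        linarith
    rw [← zero_add (deltaD d δ - 1), ← wt_mul _ _ _ _ hξ] at h1
    have h2 : wt 0 (-(2 * δ) + s) η = wt 0 (-(2 * δ)) η * wt 0 s η := by
      rw [wt_mul _ _ _ _ hη, add_zero]
    rw [h2] at h1
    have hE : envWt δ c η = c ^ (-(2 * δ)) * wt 0 (-(2 * δ)) η := h
    have hω : envWt δ c (ζ + η) ≤ c ^ (-(2 * δ)) * wt 0 (-(2 * δ)) (ζ + η) := min_le_right _ _
    have hnn : 0 ≤ 2 ^ ((d : ℝ) + s + 4) * (wt 0 s ζ * (envWt δ c η * wt 0 s η) * m) := by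
      have := envWt_nonneg δ hc η
      positivity
    calc _ ≤ (c ^ (-(2 * δ)) * wt 0 (-(2 * δ)) (ζ + η)) * wt (deltaD d δ - 1) s (ζ + η) :=
          mul_le_mul_of_nonneg_right hω (wt_nonneg _ _ _)
      _ = c ^ (-(2 * δ)) * (wt 0 (-(2 * δ)) (ζ + η) * wt (deltaD d δ - 1) s (ζ + η)) := by ring
      _ ≤ _ := mul_le_mul_of_nonneg_left h1 (by positivity)
      _ = 2 ^ ((d : ℝ) + s + 4) * (wt 0 s ζ * (envWt δ c η * wt 0 s η) * m) := by rw [hE]; ring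
      _ ≤ _ := by linarith

/-- Either factor may carry the larger frequency and with it the envelope weight; hence two terms on
the right and the need for `multiplierNorm_mul_le_add` in its two-term form. -/
theorem norm_form_mul_form_env {c : ℝ} (hc : 0 < c) {u v : Rd d → ℂ} (hu : FL u) (hv : FL v) :
    multiplierNorm (fun η => envWt δ c η * wt (deltaD d δ - 1) s η) (u * v) ≤
      2 * prodConst d s δ *
      (multiplierNorm (wt 0 s) u * multiplierNorm (fun η => envWt δ c η * wt 0 s η) v +
       multiplierNorm (fun η => envWt δ c η * wt 0 s η) u * multiplierNorm (wt 0 s) v) := by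
  have hmE : Measurable (fun η : Rd d => envWt δ c η * wt 0 s η) :=
    (measurable_envWt _ _).mul (measurable_sobolevSymbol _ _)
  have h0 := multiplierNorm_mul_le_add (W := fun η => envWt δ c η * wt (deltaD d δ - 1) s η)
    (C := 2 * 2 ^ ((d : ℝ) + s + 4)) (M := wt (-lowExp d δ) (-s)) P.two_le
    (measurable_sobolevSymbol 0 (s - 0)) hmE hmE
    (measurable_sobolevSymbol 0 (s - 0)) (measurable_sobolevSymbol _ _)
    (wt_nonneg (-lowExp d δ) (-s)) (by positivity)
    (fun ζ η hζ hη hξ => by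
      have e : ∀ (a b : ℝ) (η : Rd d), |envWt δ c η * wt a b η| = envWt δ c η * wt a b η :=
        fun a b η => abs_of_nonneg (mul_nonneg (envWt_nonneg _ hc _) (wt_nonneg _ _ _))
      rw [e, e, e, abs_of_nonneg (wt_nonneg _ _ _), abs_of_nonneg (wt_nonneg _ _ _)]
      have hm0 : 0 ≤ (wt (-lowExp d δ) (-s) (ζ + η) + wt (-lowExp d δ) (-s) ζ +
          wt (-lowExp d δ) (-s) η) :=
        add_nonneg (add_nonneg (wt_nonneg _ _ _) (wt_nonneg _ _ _)) (wt_nonneg _ _ _)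
      have hw1 := wt_nonneg 0 s ζ
      have hw2 := wt_nonneg 0 s η
      have ho1 := envWt_nonneg δ hc ζ
      have ho2 := envWt_nonneg δ hc η
      rcases le_total ‖ζ‖ ‖η‖ with h | h
      · refine (P.env_form_bilinear_aux hc hζ hη hξ h).trans ?_
        gcongr
        have : 0 ≤ envWt δ c ζ * wt 0 s ζ * wt 0 s η := by positivity
        linarith
      · have h1 := P.env_form_bilinear_aux hc hη hζ (by rwa [add_comm]) h
        rw [add_comm η ζ] at h1
        refine h1.trans ?_
        have : 0 ≤ wt 0 s ζ * (envWt δ c η * wt 0 s η) := by positivity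
        refine mul_le_mul_of_nonneg_left ?_ (by positivity)
        rw [show wt (-lowExp d δ) (-s) (ζ + η) + wt (-lowExp d δ) (-s) η + wt (-lowExp d δ) (-s) ζ =
          wt (-lowExp d δ) (-s) (ζ + η) + wt (-lowExp d δ) (-s) ζ + wt (-lowExp d δ) (-s) η by ring]
        refine mul_le_mul_of_nonneg_right ?_ hm0
        linarith) hu hv
  refine h0.trans (le_of_eq ?_)
  rw [prodConst, ENNReal.ofReal_mul (by norm_num)]
  simp only [ENNReal.ofReal_ofNat]
  ring

/-! ### Regularity from finite norms -/

/-- Cauchy-Schwarz: `|ξ|` is at most the weight `wt a b` times the square integrable weight. -/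
theorem integrable_norm_mul {a b : ℝ} (ha : a ≤ lowExp d δ + 1) (hb : s + 1 ≤ b)
    {w : Rd d → ℂ} (hw : Integrable w volume)
    (h : eLpNorm (fun ξ : Rd d => (wt a b ((2 * Real.pi) • ξ) : ℂ) * w ξ) 2 volume ≠ ⊤) :
    Integrable (fun ξ => ‖ξ‖ * ‖w ξ‖) volume := by
  refine ⟨(continuous_norm.aestronglyMeasurable.mul hw.1.norm), ?_⟩
  rw [eLpNorm_two_eq_l2] at h
  have hm : Measurable (fun ξ : Rd d => ENNReal.ofReal (wt (-lowExp d δ) (-s) ((2 * Real.pi) • ξ))) :=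
    ((measurable_sobolevSymbol _ _).comp (measurable_const_smul _)).ennreal_ofReal
  have hf := (aestronglyMeasurable_multiplier (measurable_sobolevSymbol a (b - a)) hw).enorm
  refine lt_of_le_of_lt ?_ (ENNReal.mul_lt_top (P.l2_weight_ne_top).lt_top h.lt_top)
  refine le_trans ?_ (lintegral_mul_le_l2 hm.aemeasurable hf)
  refine lintegral_mono_ae ?_
  filter_upwards [ae_ne_zero P.two_le] with ξ hξ
  have hξ' := two_pi_smul_ne_zero hξ
  set η := (2 * Real.pi) • ξ with hη
  have h1 : ‖ξ‖ ≤ ‖η‖ := by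
    rw [hη, norm_smul, Real.norm_of_nonneg (by positivity)]
    have := Real.pi_gt_three
    nlinarith [norm_nonneg ξ]
  have h2 : ‖η‖ ≤ wt (-lowExp d δ) (-s) η * wt a b η := by
    rw [wt_mul _ _ _ _ hξ']
    calc ‖η‖ = wt 1 1 η := by rw [wt_eq, rwt_one]
      _ ≤ _ := wt_le_wt (by linarith) (by linarith) hξ'
  rw [enorm_mul, enorm_norm, enorm_norm, enorm_mul, ← mul_assoc]
  refine mul_le_mul_left ?_ _
  rw [← ofReal_norm, ← ofReal_norm, ← ENNReal.ofReal_mul (wt_nonneg _ _ _)]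
  apply ENNReal.ofReal_le_ofReal
  rw [Complex.norm_real, Real.norm_of_nonneg (wt_nonneg _ _ _)]
  exact h1.trans h2

/-- This makes all metrics and connections of the relevant classes differentiable functions, so that
the equations can be read pointwise. -/
theorem fl1_of_ne_top {a b : ℝ} (ha : a ≤ lowExp d δ + 1) (hb : s + 1 ≤ b)
    {u : Rd d → ℂ} (h : multiplierNorm (wt a b) u ≠ ⊤) : FL1 u := by
  obtain ⟨w, hw, rfl⟩ := fl_of_multiplierNorm_ne_top h
  rw [multiplierNorm_fourierInv _ hw] at h
  exact ⟨w, hw, P.integrable_norm_mul ha hb hw h, rfl⟩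

/-- Sup norm bound by a weighted norm. -/
theorem enorm_apply_le {a b : ℝ} (ha : a ≤ lowExp d δ) (hb : s ≤ b) {u : Rd d → ℂ} (hu : FL u)
    (x : Rd d) :
    ‖u x‖ₑ ≤ l2 (fun ξ : Rd d => ENNReal.ofReal (wt (-lowExp d δ) (-s) ((2 * Real.pi) • ξ))) *
      multiplierNorm (wt a b) u := by
  obtain ⟨w, hw, rfl⟩ := hu
  rw [multiplierNorm_fourierInv _ hw, eLpNorm_two_eq_l2]
  have hm : Measurable (fun ξ : Rd d => ENNReal.ofReal (wt (-lowExp d δ) (-s) ((2 * Real.pi) • ξ))) :=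
    ((measurable_sobolevSymbol _ _).comp (measurable_const_smul _)).ennreal_ofReal
  have hf := (aestronglyMeasurable_multiplier (measurable_sobolevSymbol a (b - a)) hw).enorm
  refine (enorm_fourierInv_le w x).trans (le_trans ?_ (lintegral_mul_le_l2 hm.aemeasurable hf))
  refine lintegral_mono_ae ?_
  filter_upwards [ae_ne_zero P.two_le] with ξ hξ
  have hξ' := two_pi_smul_ne_zero hξ
  have h2 : 1 ≤ wt (-lowExp d δ) (-s) ((2 * Real.pi) • ξ) * wt a b ((2 * Real.pi) • ξ) := by
    rw [wt_mul _ _ _ _ hξ']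
    calc (1 : ℝ) = wt 0 0 ((2 * Real.pi) • ξ) := by rw [wt_eq, rwt_zero]
      _ ≤ _ := wt_le_wt (by linarith) (by linarith) hξ'
  rw [enorm_mul, ← mul_assoc]
  refine le_mul_of_one_le_left' ?_
  rw [← ofReal_norm, ← ENNReal.ofReal_mul (wt_nonneg _ _ _), Complex.norm_real,
    Real.norm_of_nonneg (wt_nonneg _ _ _)]
  exact ENNReal.one_le_ofReal.2 h2

end Params

/-! ### The flat div-curl system -/

theorem l2_sum_le {d : ℕ} {ι : Type*} (t : Finset ι) {f : ι → Rd d → ℝ≥0∞}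
    (hf : ∀ i ∈ t, AEMeasurable (f i) volume) : l2 (∑ i ∈ t, f i) ≤ ∑ i ∈ t, l2 (f i) := by
  classical
  induction t using Finset.induction_on with
  | empty => simp [l2]
  | insert a t ha ih =>
    rw [Finset.sum_insert ha, Finset.sum_insert ha]
    have h1 : AEMeasurable (∑ i ∈ t, f i) volume :=
      Finset.aemeasurable_sum _ fun i hi => hf i (by simp [hi])
    refine (l2_add_le (hf a (by simp)) h1).trans ?_
    gcongr
    exact ih fun i hi => hf i (by simp [hi])

theorem sum_sq_eq_norm_sq {d : ℕ} (ξ : Rd d) : ∑ α, (ξ α : ℂ) * (ξ α : ℂ) = ((‖ξ‖ ^ 2 : ℝ) : ℂ) := by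
  rw [EuclideanSpace.norm_sq_eq]
  push_cast
  refine Finset.sum_congr rfl fun i _ => ?_
  rw [← Complex.ofReal_mul, ← Complex.ofReal_pow, Real.norm_eq_abs, sq_abs, sq]

/-- The symbol `(∑ ξ_α f_{αβ} + ξ_β g) / |ξ|²` is bounded by the sources over `|ξ|`. -/
theorem norm_mul_le_sum {d : ℕ} (ξ : Rd d) (hξ : ξ ≠ 0) (f : Fin d → ℂ) (g b : ℂ) (β : Fin d)
    (h : (2 * Real.pi * Complex.I) * ((‖ξ‖ ^ 2 : ℝ) : ℂ) * b = ∑ α, (ξ α : ℂ) * f α + ξ β * g) :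
    2 * Real.pi * ‖ξ‖ * ‖b‖ ≤ ∑ α, ‖f α‖ + ‖g‖ := by
  have hx := norm_pos_iff.2 hξ
  have h1 : ‖ξ‖ * (2 * Real.pi * ‖ξ‖ * ‖b‖) ≤ ‖ξ‖ * (∑ α, ‖f α‖ + ‖g‖) := by
    calc ‖ξ‖ * (2 * Real.pi * ‖ξ‖ * ‖b‖)
        = ‖(2 * Real.pi * Complex.I) * ((‖ξ‖ ^ 2 : ℝ) : ℂ) * b‖ := by
          simp only [norm_mul, Complex.norm_real, Complex.norm_I, Complex.norm_ofNat, norm_pow,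
            norm_norm, Real.norm_of_nonneg Real.pi_pos.le]
          ring
      _ = ‖∑ α, (ξ α : ℂ) * f α + ξ β * g‖ := by rw [h]
      _ ≤ ∑ α, ‖(ξ α : ℂ) * f α‖ + ‖(ξ β : ℂ) * g‖ :=
          (norm_add_le _ _).trans (add_le_add_left (norm_sum_le _ _) _)
      _ ≤ ∑ α, ‖ξ‖ * ‖f α‖ + ‖ξ‖ * ‖g‖ := by
          have hle : ∀ i, ‖(ξ i : ℂ)‖ ≤ ‖ξ‖ := fun i => by
            rw [Complex.norm_real]; exact PiLp.norm_apply_le ξ i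
          refine add_le_add (Finset.sum_le_sum fun i _ => ?_) ?_ <;> rw [norm_mul] <;>
            exact mul_le_mul_of_nonneg_right (hle _) (norm_nonneg _)
      _ = _ := by rw [← Finset.mul_sum]; ring
  exact le_of_mul_le_mul_left h1 hx

/-- Dividing a first order numerator by `|ξ|²` gains one power of `|ξ|`, which is exactly the ratio
of the symbols `Y` and `Z`. -/
theorem l2_solution_le {d : ℕ} (hd : 2 ≤ d) {Z Y : Rd d → ℝ} (hZ : Measurable Z)
    (hY : ∀ η, η ≠ 0 → |Z η| * ‖η‖ = |Y η|) {f : Fin d → Rd d → ℂ} {g b : Rd d → ℂ}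
    (hf : ∀ α, Integrable (f α) volume) (hg : Integrable g volume) (β : Fin d)
    (h : ∀ ξ : Rd d, ξ ≠ 0 → (2 * Real.pi * Complex.I) * ((‖ξ‖ ^ 2 : ℝ) : ℂ) * b ξ =
      ∑ α, (ξ α : ℂ) * f α ξ + ξ β * g ξ) :
    eLpNorm (fun ξ : Rd d => (Y ((2 * Real.pi) • ξ) : ℂ) * b ξ) 2 volume ≤
      ∑ α, eLpNorm (fun ξ : Rd d => (Z ((2 * Real.pi) • ξ) : ℂ) * f α ξ) 2 volume +
        eLpNorm (fun ξ : Rd d => (Z ((2 * Real.pi) • ξ) : ℂ) * g ξ) 2 volume := by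
  simp only [eLpNorm_two_eq_l2]
  have mf := fun α => (aestronglyMeasurable_multiplier hZ (hf α)).enorm
  have mg := (aestronglyMeasurable_multiplier hZ hg).enorm
  refine le_trans ?_ (add_le_add_left (l2_sum_le Finset.univ fun α _ => mf α) _)
  refine le_trans ?_ (l2_add_le (Finset.aemeasurable_sum _ fun α _ => mf α) mg)
  refine l2_mono ?_
  filter_upwards [ae_ne_zero hd] with ξ hξ
  have h1 := norm_mul_le_sum ξ hξ (fun α => f α ξ) (g ξ) (b ξ) β (h ξ hξ)
  have h2 := hY _ (two_pi_smul_ne_zero hξ)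
  simp only [Pi.add_apply, Finset.sum_apply, ← ofReal_norm]
  rw [← ENNReal.ofReal_sum_of_nonneg (fun _ _ => norm_nonneg _),
    ← ENNReal.ofReal_add (Finset.sum_nonneg fun _ _ => norm_nonneg _) (norm_nonneg _)]
  apply ENNReal.ofReal_le_ofReal
  simp only [norm_mul, Complex.norm_real, Real.norm_eq_abs]
  rw [← h2, norm_smul, Real.norm_of_nonneg (by positivity : 0 ≤ 2 * Real.pi), ← Finset.mul_sum,
    ← mul_add, mul_assoc]
  exact mul_le_mul_of_nonneg_left h1 (abs_nonneg _)

/-- The elliptic estimate for the flat div-curl system. -/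
theorem norm_le_div_curl {d : ℕ} (hd : 2 ≤ d) {Z Y : Rd d → ℝ} (hZ : Measurable Z)
    (hY : ∀ η, η ≠ 0 → |Z η| * ‖η‖ = |Y η|) {B : Fin d → Rd d → ℂ} (hB : ∀ i, FL1 (B i))
    (β : Fin d) :
    multiplierNorm Y (B β) ≤ ∑ α, multiplierNorm Z (pdC α (B β) - pdC β (B α)) +
      multiplierNorm Z (∑ α, pdC α (B α)) := by
  choose b hb hb1 hbB using hB
  set D : Fin d → Fin d → Rd d → ℂ :=
    fun α β ξ => (2 * Real.pi * Complex.I * (ξ α : ℂ)) * b β ξ with hDdef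
  have hD : ∀ α β, pdC α (B β) = 𝓕⁻ (D α β) := fun α β => by
    rw [hbB β]; exact (fourierInv_pd (hb β) (hb1 β)).2 α
  have hi : ∀ α β, Integrable (D α β) volume :=
    fun α β => integrable_symbol_mul (hb β) (hb1 β) α
  have hF : ∀ α β, pdC α (B β) - pdC β (B α) = 𝓕⁻ (D α β - D β α) := fun α β => by
    rw [hD, hD, sub_eq_iff_eq_add, ← fourierInv_add ((hi α β).sub (hi β α)) (hi β α),
      sub_add_cancel]
  have hG : ∑ α, pdC α (B α) = 𝓕⁻ (fun ξ => ∑ α, D α α ξ) := by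
    simp_rw [hD]
    funext x
    simp only [Finset.sum_apply, Real.fourierInv_eq, Finset.smul_sum]
    rw [integral_finsetSum]
    intro α _
    have := (Real.fourierIntegral_convergent_iff (-x)).2 (hi α α)
    simpa using this
  have hn : ∀ α β, multiplierNorm Z (pdC α (B β) - pdC β (B α)) = eLpNorm (fun ξ : Rd d =>
      (Z ((2 * Real.pi) • ξ) : ℂ) * (D α β - D β α) ξ) 2 volume := fun α β => by
    rw [hF, multiplierNorm_fourierInv _ ((hi α β).sub (hi β α))]
  simp_rw [hn]
  rw [hG, hbB β, multiplierNorm_fourierInv _ (hb β),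
    multiplierNorm_fourierInv _ (integrable_finsetSum _ fun α _ => hi α α)]
  refine l2_solution_le hd hZ hY (fun α => (hi α β).sub (hi β α))
    (integrable_finsetSum _ fun α _ => hi α α) β fun ξ _ => ?_
  -- What remains is the Fourier form of `Δ B_β = ∂_α (∂_α B_β - ∂_β B_α) + ∂_β (∂_α B_α)`.
  rw [← sum_sq_eq_norm_sq]
  simp only [Finset.mul_sum, Finset.sum_mul, ← Finset.sum_add_distrib]
  refine Finset.sum_congr rfl fun α _ => ?_
  simp only [Pi.sub_apply, hDdef]
  ring

/-! ### Closed forms on the Fourier side -/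

theorem integral_fourierInv_mul {d : ℕ} {f g : Rd d → ℂ} (hf : Integrable f volume)
    (hg : Integrable g volume) : ∫ x, 𝓕⁻ f x * g x = ∫ ξ, f ξ * 𝓕⁻ g ξ := by
  have hn : Integrable (fun x => g (-x)) volume := hg.comp_neg
  have := VectorFourier.integral_fourierIntegral_smul_eq_flip (μ := (volume : Measure (Rd d)))
      (ν := (volume : Measure (Rd d)))
      (L := innerₗ (Rd d)) Real.continuous_fourierChar continuous_inner hf hn
  rw [flip_innerₗ] at this
  have h1 : ∫ x, 𝓕⁻ f x * g x = ∫ x, 𝓕 f x * g (-x) := by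
    rw [← integral_neg_eq_self (fun x => 𝓕 f x * g (-x))]
    simp only [Real.fourierInv_eq_fourier_neg, neg_neg]
  rw [h1]
  rw [Real.fourierInv_eq_fourier_comp_neg]
  exact this

theorem fourierInv_translate {d : ℕ} (g : Rd d → ℂ) (y ξ : Rd d) :
    𝓕⁻ (fun x => g (x - y)) ξ = (Real.fourierChar (inner ℝ y ξ) : ℂ) * 𝓕⁻ g ξ := by
  simp only [Real.fourierInv_eq]
  rw [← integral_const_mul,
    ← integral_sub_right_eq_self (fun v => (Real.fourierChar (inner ℝ y ξ) : ℂ) *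
      (Real.fourierChar (inner ℝ v ξ) • g v)) y]
  congr 1; funext v
  have h1 : (Real.fourierChar (inner ℝ v ξ) : ℂ) =
      (Real.fourierChar (inner ℝ y ξ) : ℂ) * (Real.fourierChar (inner ℝ (v - y) ξ) : ℂ) := by
    rw [← Circle.coe_mul, ← AddChar.map_add_eq_mul, ← inner_add_left, add_sub_cancel]
  simp only [Circle.smul_def, smul_eq_mul]
  rw [h1, mul_assoc]

theorem fourierInv_pdC {d : ℕ} {g : Rd d → ℂ} (hg : ContDiff ℝ ∞ g) (hc : HasCompactSupport g)
    (γ : Fin d) (ξ : Rd d) :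
    𝓕⁻ (pdC γ g) ξ = -(2 * Real.pi * Complex.I * (ξ γ : ℂ)) * 𝓕⁻ g ξ := by
  have h1 : Integrable g volume := hg.continuous.integrable_of_hasCompactSupport hc
  have h2 : Integrable (fderiv ℝ g) volume :=
    (hg.continuous_fderiv (by simp)).integrable_of_hasCompactSupport (hc.fderiv ℝ)
  have h3 := Real.fourier_fderiv h1 (hg.differentiable (by simp)) h2
  have h4 := Real.fourier_continuousLinearMap_apply h2 (a := (EuclideanSpace.single γ (1:ℝ)))
    (v := -ξ)
  rw [Real.fourierInv_eq_fourier_neg, Real.fourierInv_eq_fourier_neg]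
  have h5 : 𝓕 (pdC γ g) (-ξ) = (𝓕 (fderiv ℝ g) (-ξ)) (EuclideanSpace.single γ (1:ℝ)) := h4.symm
  rw [h5, h3, VectorFourier.fourierSMulRight_apply]
  have h6 : (-innerSL ℝ : Rd d →L[ℝ] Rd d →L[ℝ] ℝ) (-ξ) (EuclideanSpace.single γ (1 : ℝ)) = ξ γ := by
    rw [_root_.neg_apply, map_neg, neg_neg, innerSL_apply_apply,
      EuclideanSpace.inner_single_right]; simp
  rw [h6]
  simp
  ring

theorem pdC_ofReal {d : ℕ} {f : Rd d → ℝ} {x : Rd d} (hf : DifferentiableAt ℝ f x) (α : Fin d) :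
    pdC α (fun y => (f y : ℂ)) x = (pd α f x : ℂ) := by
  unfold pdC pd
  have h : HasFDerivAt (fun y => (f y : ℂ)) (Complex.ofRealCLM.comp (fderiv ℝ f x)) x :=
    Complex.ofRealCLM.hasFDerivAt.comp x hf.hasFDerivAt
  rw [h.fderiv]; rfl

/-- Testing closedness against all translates of `ψ` says that the inverse transform of the cyclic
sum, multiplied by that of `ψ`, vanishes at every point; injectivity then gives zero almost
everywhere. -/
theorem fourier_closed_mul {d : ℕ} {F : Fin d → Fin d → Rd d → ℝ} (hcl : IsWeaklyClosed F)
    {f : Fin d → Fin d → Rd d → ℂ} (hf : ∀ α β, Integrable (f α β) volume)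
    (hF : ∀ α β, (fun x => (F α β x : ℂ)) = 𝓕⁻ (f α β)) (α β γ : Fin d)
    {ψ : Rd d → ℝ} (hψ : ContDiff ℝ ∞ ψ) (hc : HasCompactSupport ψ) :
    ∀ᵐ ξ : Rd d ∂volume, (f α β ξ * ξ γ + f β γ ξ * ξ α + f γ α ξ * ξ β) *
      𝓕⁻ (fun x => (ψ x : ℂ)) ξ = 0 := by
  set g : Rd d → ℂ := fun x => (ψ x : ℂ) with hg
  have hgC : ContDiff ℝ ∞ g := Complex.ofRealCLM.contDiff.comp hψ
  have hgc : HasCompactSupport g := hc.comp_left (g := fun t : ℝ => (t : ℂ)) (by simp)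
  have hdg : ∀ γ, Integrable (pdC γ g) volume := fun γ => by
    have h2 : Integrable (fderiv ℝ g) volume :=
      (hgC.continuous_fderiv (by simp)).integrable_of_hasCompactSupport (hgc.fderiv ℝ)
    exact (ContinuousLinearMap.apply ℝ ℂ (EuclideanSpace.single γ (1:ℝ))).integrable_comp h2
  have hK : ∀ a b c, Integrable (fun ξ => f a b ξ * 𝓕⁻ (pdC c g) ξ) volume := fun a b c => by
    refine (hf a b).mul_bdd (c := ∫ x, ‖pdC c g x‖)
      (continuous_fourierInv (hdg c)).aestronglyMeasurable (.of_forall fun ξ => ?_)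
    rw [Real.fourierInv_eq]
    refine (norm_integral_le_integral_norm _).trans (le_of_eq ?_)
    congr 1; funext v; simp [Circle.norm_smul]
  have hfy : ∀ a b c (y : Rd d), 𝓕⁻ (fun ξ => f a b ξ * 𝓕⁻ (pdC c g) ξ) y =
      ((∫ x, F a b x * pd c (fun x => ψ (x - y)) x : ℝ) : ℂ) := by
    intro a b c y
    have e1 : ∀ x, pdC c g (x - y) = ((pd c (fun x => ψ (x - y)) x : ℝ) : ℂ) := fun x => by
      rw [hg, pdC_ofReal (hψ.differentiable (by simp) _)]
      unfold pd
      rw [fderiv_comp_sub]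
    have hty : Integrable (fun x => pdC c g (x - y)) volume := (hdg c).comp_sub_right y
    rw [← integral_complex_ofReal]
    push_cast
    have e2 : ∀ x, (F a b x : ℂ) = 𝓕⁻ (f a b) x := fun x => congrFun (hF a b) x
    simp_rw [← e1, e2]
    rw [integral_fourierInv_mul (hf a b) hty, Real.fourierInv_eq]
    congr 1; funext ξ
    rw [fourierInv_translate, Circle.smul_def, smul_eq_mul, real_inner_comm]
    ring
  have hFc : ∀ a b, Continuous (F a b) := fun a b => by
    have h1 : Continuous (fun x => (F a b x : ℂ)) := by
      rw [hF]; exact continuous_fourierInv (hf a b)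
    have h2 := Complex.continuous_re.comp h1
    simpa [Function.comp_def] using h2
  set K : Rd d → ℂ := (fun ξ => f α β ξ * 𝓕⁻ (pdC γ g) ξ) + (fun ξ => f β γ ξ * 𝓕⁻ (pdC α g) ξ) +
    (fun ξ => f γ α ξ * 𝓕⁻ (pdC β g) ξ) with hKdef
  have hKi : Integrable K volume := ((hK _ _ _).add (hK _ _ _)).add (hK _ _ _)
  have hK0 : 𝓕⁻ K = 𝓕⁻ (0 : Rd d → ℂ) := by
    rw [hKdef, fourierInv_add ((hK _ _ _).add (hK _ _ _)) (hK _ _ _),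
      fourierInv_add (hK _ _ _) (hK _ _ _)]
    funext y
    simp only [Pi.add_apply, hfy]
    have hψy : ContDiff ℝ ∞ (fun x => ψ (x - y)) := hψ.comp (contDiff_id.sub contDiff_const)
    have hcy : HasCompactSupport (fun x => ψ (x - y)) :=
      hc.comp_homeomorph (Homeomorph.subRight y)
    have := hcl _ hψy hcy α β γ
    have hint : ∀ a b c, Integrable (fun x => F a b x * pd c (fun x => ψ (x - y)) x) volume := by
      intro a b c
      have hcd : Continuous (fun x => pd c (fun x => ψ (x - y)) x) :=
        (hψy.continuous_fderiv (by simp)).clm_apply continuous_const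
      refine ((hFc a b).mul hcd).integrable_of_hasCompactSupport ?_
      refine HasCompactSupport.mul_left ?_
      have := hcy.fderiv ℝ
      exact this.comp_left (g := fun L : Rd d →L[ℝ] ℝ => L (EuclideanSpace.single c 1)) (by simp)
    have h12 : Integrable (fun x => F α β x * pd γ (fun x => ψ (x - y)) x +
      F β γ x * pd α (fun x => ψ (x - y)) x) volume := (hint _ _ _).add (hint _ _ _)
    rw [integral_add h12 (hint _ _ _), integral_add (hint _ _ _) (hint _ _ _)] at this
    rw [← Complex.ofReal_add, ← Complex.ofReal_add, this]
    simp [Real.fourierInv_eq]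
  filter_upwards [fourierInv_injective hKi (integrable_zero _ _ _) hK0] with ξ hξ
  simp only [hKdef, Pi.add_apply, fourierInv_pdC hgC hgc, Pi.zero_apply] at hξ
  have hne : (-(2 * Real.pi * Complex.I) : ℂ) ≠ 0 := by simp [Real.pi_ne_zero]
  apply mul_left_cancel₀ hne
  rw [mul_zero, ← hξ]
  ring

/-- The transform of a single bump may vanish somewhere. The bumps `ψ((n+1)x)` have transforms
proportional to that of `ψ` at `ξ/(n+1)`, which converges to the nonzero integral of `ψ`, so at each
frequency some `n` allows division. -/
theorem fourier_closed {d : ℕ} {F : Fin d → Fin d → Rd d → ℝ} (hcl : IsWeaklyClosed F)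
    {f : Fin d → Fin d → Rd d → ℂ} (hf : ∀ α β, Integrable (f α β) volume)
    (hF : ∀ α β, (fun x => (F α β x : ℂ)) = 𝓕⁻ (f α β)) (α β γ : Fin d) :
    ∀ᵐ ξ : Rd d ∂volume, f α β ξ * ξ γ + f β γ ξ * ξ α + f γ α ξ * ξ β = 0 := by
  let B : ContDiffBump (0 : Rd d) := ⟨1, 2, one_pos, one_lt_two⟩
  set ψ : Rd d → ℝ := fun x => B x with hψ
  have hψc : ContDiff ℝ ∞ ψ := B.contDiff
  have hψs : HasCompactSupport ψ := B.hasCompactSupport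
  have hall : ∀ n : ℕ, ∀ᵐ ξ : Rd d ∂volume,
      (f α β ξ * ξ γ + f β γ ξ * ξ α + f γ α ξ * ξ β) *
        𝓕⁻ (fun x => ((ψ (((n : ℝ) + 1) • x) : ℝ) : ℂ)) ξ = 0 := fun n => by
    have hn : (n : ℝ) + 1 ≠ 0 := by positivity
    refine fourier_closed_mul hcl hf hF α β γ (ψ := fun x => ψ (((n : ℝ) + 1) • x)) ?_ ?_
    · exact hψc.comp (contDiff_const_smul _)
    · exact hψs.comp_homeomorph (Homeomorph.smulOfNeZero _ hn)
  have hscale : ∀ (n : ℕ) (ξ : Rd d), 𝓕⁻ (fun x => ((ψ (((n : ℝ) + 1) • x) : ℝ) : ℂ)) ξ =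
      |(((n : ℝ) + 1) ^ (Module.finrank ℝ (Rd d)))⁻¹| •
        𝓕⁻ (fun x => (ψ x : ℂ)) (((n : ℝ) + 1)⁻¹ • ξ) := fun n ξ => by
    have hn : (n : ℝ) + 1 ≠ 0 := by positivity
    rw [Real.fourierInv_eq, Real.fourierInv_eq, ← Measure.integral_comp_smul]
    congr 1; funext v
    rw [real_inner_smul_left, real_inner_smul_right, mul_inv_cancel_left₀ hn]
  have hi : Integrable (fun x => (ψ x : ℂ)) volume :=
    (hψc.continuous.integrable_of_hasCompactSupport hψs).ofReal
  have h0 : 𝓕⁻ (fun x => (ψ x : ℂ)) 0 ≠ 0 := by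
    rw [Real.fourierInv_eq]
    simp only [inner_zero_right, AddChar.map_zero_eq_one, one_smul]
    rw [integral_complex_ofReal]
    have := B.integral_pos (μ := (volume : Measure (Rd d)))
    exact_mod_cast this.ne'
  filter_upwards [ae_all_iff.2 hall] with ξ hξ
  have hlim : Tendsto (fun n : ℕ => 𝓕⁻ (fun x => (ψ x : ℂ)) (((n : ℝ) + 1)⁻¹ • ξ)) atTop
      (𝓝 (𝓕⁻ (fun x => (ψ x : ℂ)) 0)) := by
    refine ((continuous_fourierInv hi).tendsto 0).comp ?_
    have h1 : Tendsto (fun n : ℕ => ((n : ℝ) + 1)⁻¹) atTop (𝓝 0) := by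
      simpa using tendsto_one_div_add_atTop_nhds_zero_nat (𝕜 := ℝ)
    simpa using h1.smul_const ξ
  obtain ⟨n, hn⟩ := (hlim.eventually_ne h0).exists
  have h1 := hξ n
  rw [hscale] at h1
  refine (mul_eq_zero.1 h1).resolve_right ?_
  refine smul_ne_zero ?_ hn
  have : ((n : ℝ) + 1) ≠ 0 := by positivity
  exact abs_ne_zero.2 (inv_ne_zero (pow_ne_zero _ this))

namespace Params
variable {d : ℕ} {s δ : ℝ} (P : Params d s δ)
include P

/-- A function built on the Fourier side, by division by a symbol or as an `L²` limit, must be shown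
integrable before it represents an element of the space. The conditions on `a` and `b` make this a
Cauchy-Schwarz estimate. -/
theorem integrable_of_l2 {a b : ℝ} (ha : a ≤ lowExp d δ) (hb : s ≤ b) {w : Rd d → ℂ}
    (hw : AEStronglyMeasurable w volume)
    (h : eLpNorm (fun ξ : Rd d => (wt a b ((2 * Real.pi) • ξ) : ℂ) * w ξ) 2 volume ≠ ⊤) :
    Integrable w volume := by
  refine ⟨hw, ?_⟩
  rw [eLpNorm_two_eq_l2] at h
  have hm : Measurable (fun ξ : Rd d => ENNReal.ofReal (wt (-lowExp d δ) (-s) ((2 * Real.pi) • ξ))) :=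
    ((measurable_sobolevSymbol _ _).comp (measurable_const_smul _)).ennreal_ofReal
  have hf : AEMeasurable (fun ξ : Rd d => ‖(wt a b ((2 * Real.pi) • ξ) : ℂ) * w ξ‖ₑ) volume := by
    refine AEStronglyMeasurable.enorm (AEStronglyMeasurable.mul ?_ hw)
    exact (Complex.measurable_ofReal.comp
      ((measurable_sobolevSymbol _ _).comp (measurable_const_smul _))).aestronglyMeasurable
  refine lt_of_le_of_lt ?_ (ENNReal.mul_lt_top (P.l2_weight_ne_top).lt_top h.lt_top)
  refine le_trans ?_ (lintegral_mul_le_l2 hm.aemeasurable hf)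
  refine lintegral_mono_ae ?_
  filter_upwards [ae_ne_zero P.two_le] with ξ hξ
  have hξ' := two_pi_smul_ne_zero hξ
  have h2 : 1 ≤ wt (-lowExp d δ) (-s) ((2 * Real.pi) • ξ) * wt a b ((2 * Real.pi) • ξ) := by
    rw [wt_mul _ _ _ _ hξ']
    calc (1 : ℝ) = wt 0 0 ((2 * Real.pi) • ξ) := by rw [wt_eq, rwt_zero]
      _ ≤ _ := wt_le_wt (by linarith) (by linarith) hξ'
  rw [enorm_mul, ← mul_assoc]
  refine le_mul_of_one_le_left' ?_
  rw [← ofReal_norm, ← ENNReal.ofReal_mul (wt_nonneg _ _ _), Complex.norm_real,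
    Real.norm_of_nonneg (wt_nonneg _ _ _)]
  exact ENNReal.one_le_ofReal.2 h2

/-- Solvability of the flat div-curl system with a closed right-hand side. -/
theorem exists_flat_solution {F : Fin d → Fin d → Rd d → ℝ} (hcl : IsWeaklyClosed F)
    (hanti : ∀ α β x, F α β x = -F β α x)
    (hF : ∀ α β, multiplierNorm (wt (deltaD d δ - 1) s) (fun x => (F α β x : ℂ)) ≠ ⊤)
    {G : Rd d → ℂ} (hG : multiplierNorm (wt (deltaD d δ - 1) s) G ≠ ⊤) :
    ∃ B : Fin d → Rd d → ℂ, (∀ i, multiplierNorm (wt (deltaD d δ) (s + 1)) (B i) ≠ ⊤) ∧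
      ∑ α, pdC α (B α) = G ∧
      ∀ α β, pdC α (B β) - pdC β (B α) = fun x => (F α β x : ℂ) := by
  have hδ := P.deltaD_nonneg
  have hδ1 := P.deltaD_lt
  have hp := P.one_sub_deltaD_le
  choose f hf hFf using fun α β => fl_of_multiplierNorm_ne_top (hF α β)
  obtain ⟨g, hg, rfl⟩ := fl_of_multiplierNorm_ne_top hG
  have hfn : ∀ α β, eLpNorm (fun ξ : Rd d =>
      (wt (deltaD d δ - 1) s ((2 * Real.pi) • ξ) : ℂ) * f α β ξ) 2 volume ≠ ⊤ := fun α β => by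
    rw [← multiplierNorm_fourierInv _ (hf α β), ← hFf]; exact hF α β
  rw [multiplierNorm_fourierInv _ hg] at hG
  -- The only candidate: the symbol of `Δ⁻¹ (∂_α F_{αβ} + ∂_β G)`.
  set b : Fin d → Rd d → ℂ := fun β ξ => (∑ α, (ξ α : ℂ) * f α β ξ + ξ β * g ξ) *
    ((2 * Real.pi * Complex.I) * ((‖ξ‖ ^ 2 : ℝ) : ℂ))⁻¹ with hb
  have hden : ∀ ξ : Rd d, ξ ≠ 0 → ((2 * Real.pi * Complex.I) * ((‖ξ‖ ^ 2 : ℝ) : ℂ)) ≠ 0 :=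
    fun ξ hξ => by
      have := norm_pos_iff.2 hξ
      simp [Real.pi_ne_zero, hξ]
  have hbm : ∀ β, AEStronglyMeasurable (b β) volume := fun β => by
    have hc : ∀ α : Fin d, AEStronglyMeasurable (fun ξ : Rd d => (ξ α : ℂ)) volume := fun α => by
      apply Continuous.aestronglyMeasurable; fun_prop
    refine AEStronglyMeasurable.mul (AEStronglyMeasurable.add ?_ ((hc β).mul hg.1)) ?_
    · exact Finset.aestronglyMeasurable_fun_sum _ fun α _ => (hc α).mul (hf α β).1
    · exact (by fun_prop : Measurable fun ξ : Rd d =>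
        ((2 * Real.pi * Complex.I) * ((‖ξ‖ ^ 2 : ℝ) : ℂ))⁻¹).aestronglyMeasurable
  have hbeq : ∀ β (ξ : Rd d), ξ ≠ 0 → (2 * Real.pi * Complex.I) * ((‖ξ‖ ^ 2 : ℝ) : ℂ) * b β ξ =
      ∑ α, (ξ α : ℂ) * f α β ξ + ξ β * g ξ := fun β ξ hξ => by
    simp only [hb]
    rw [mul_comm, mul_assoc, inv_mul_cancel₀ (hden ξ hξ), mul_one]
  have hA := P.admWeight (σ := s) (by have := P.lt_s; linarith) le_rfl
  have hbn : ∀ β, eLpNorm (fun ξ : Rd d =>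
      (wt (deltaD d δ) (s + 1) ((2 * Real.pi) • ξ) : ℂ) * b β ξ) 2 volume ≠ ⊤ := fun β => by
    refine ne_top_of_le_ne_top ?_ (l2_solution_le P.two_le hA.measZ hA.mul_norm
      (fun α => hf α β) hg β (hbeq β))
    exact ENNReal.add_ne_top.2 ⟨ENNReal.sum_ne_top.2 fun α _ => hfn α β, hG⟩
  have hbi : ∀ β, Integrable (b β) volume := fun β =>
    P.integrable_of_l2 (by linarith) (by linarith) (hbm β) (hbn β)
  have hbi1 : ∀ β, Integrable (fun ξ => ‖ξ‖ * ‖b β ξ‖) volume := fun β =>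
    P.integrable_norm_mul (by linarith) le_rfl (hbi β) (hbn β)
  have hi : ∀ α β, Integrable (fun ξ : Rd d => (2 * Real.pi * Complex.I * (ξ α : ℂ)) * b β ξ) volume :=
    fun α β => integrable_symbol_mul (hbi β) (hbi1 β) α
  have hae_anti : ∀ α β, ∀ᵐ ξ : Rd d ∂volume, f α β ξ = -f β α ξ := fun α β => by
    have h1 : 𝓕⁻ (f α β) = 𝓕⁻ (fun ξ => (-1) * f β α ξ) := by
      rw [fourierInv_const_mul, ← hFf, ← hFf]
      funext x; rw [hanti]; push_cast; ring
    filter_upwards [fourierInv_injective (hf α β) ((hf β α).const_mul (-1)) h1] with ξ hξ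
    rw [hξ]; ring
  have hae_closed := fun α β γ => fourier_closed hcl hf hFf α β γ
  refine ⟨fun β => 𝓕⁻ (b β), fun β => ?_, ?_, fun α β => ?_⟩
  · rw [multiplierNorm_fourierInv _ (hbi β)]; exact hbn β
  · funext x
    simp only [Finset.sum_apply, (fourierInv_pd (hbi _) (hbi1 _)).2]
    have h1 : ∑ α, 𝓕⁻ (fun ξ : Rd d => (2 * Real.pi * Complex.I * (ξ α : ℂ)) * b α ξ) x =
        𝓕⁻ (fun ξ => ∑ α, (2 * Real.pi * Complex.I * (ξ α : ℂ)) * b α ξ) x := by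
      simp only [Real.fourierInv_eq, Finset.smul_sum]
      rw [integral_finsetSum]
      intro α _
      have := (Real.fourierIntegral_convergent_iff (-x)).2 (hi α α)
      simpa using this
    rw [h1]
    refine Real.fourierInv_congr_ae ?_ x
    filter_upwards [ae_ne_zero P.two_le, ae_all_iff.2 fun α => ae_all_iff.2 fun β => hae_anti α β]
      with ξ hξ hanti'
    -- The double divergence of `F` vanishes by antisymmetry, so the divergence of the candidate is
    -- `G`.
    have h0 : ∑ β, ∑ α, (ξ β : ℂ) * (ξ α * f α β ξ) = 0 := by
      have h2 : ∑ β, ∑ α, (ξ β : ℂ) * (ξ α * f α β ξ) =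
          -∑ β, ∑ α, (ξ β : ℂ) * (ξ α * f α β ξ) := by
        conv_lhs => rw [Finset.sum_comm]
        rw [← Finset.sum_neg_distrib]
        refine Finset.sum_congr rfl fun β _ => ?_
        rw [← Finset.sum_neg_distrib]
        refine Finset.sum_congr rfl fun α _ => ?_
        rw [hanti' β α]; ring
      exact self_eq_neg.1 h2
    apply mul_left_cancel₀ (hden ξ hξ)
    rw [Finset.mul_sum]
    calc _ = ∑ β, (2 * Real.pi * Complex.I * (ξ β : ℂ)) *
          ((2 * Real.pi * Complex.I) * ((‖ξ‖ ^ 2 : ℝ) : ℂ) * b β ξ) := by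
            refine Finset.sum_congr rfl fun β _ => ?_; ring
      _ = (2 * Real.pi * Complex.I) * ∑ β, ∑ α, (ξ β : ℂ) * (ξ α * f α β ξ) +
          (2 * Real.pi * Complex.I) * (∑ β, (ξ β : ℂ) * ξ β) * g ξ := by
            rw [Finset.mul_sum, Finset.mul_sum, Finset.sum_mul, ← Finset.sum_add_distrib]
            refine Finset.sum_congr rfl fun β _ => ?_
            rw [hbeq β ξ hξ, ← Finset.mul_sum]; ring
      _ = _ := by rw [h0, sum_sq_eq_norm_sq]; ring
  · rw [(fourierInv_pd (hbi _) (hbi1 _)).2, (fourierInv_pd (hbi _) (hbi1 _)).2, hFf,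
      sub_eq_iff_eq_add, ← fourierInv_add (hf α β) (hi β α)]
    funext x
    refine Real.fourierInv_congr_ae ?_ x
    filter_upwards [ae_ne_zero P.two_le, ae_all_iff.2 fun α => ae_all_iff.2 fun β => hae_anti α β,
      ae_all_iff.2 fun γ => hae_closed α β γ]
      with ξ hξ hanti' hcl'
    apply mul_left_cancel₀ (hden ξ hξ)
    simp only [Pi.add_apply]
    have e1 := hbeq β ξ hξ
    have e2 := hbeq α ξ hξ
    -- Contracting the cyclic identity with `ξ_γ`, together with antisymmetry, recovers `|ξ|²
    -- f_{αβ}`; this is where closedness is needed.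
    have e3 : (ξ α : ℂ) * ∑ γ, (ξ γ : ℂ) * f γ β ξ - ξ β * ∑ γ, (ξ γ : ℂ) * f γ α ξ =
        ((‖ξ‖ ^ 2 : ℝ) : ℂ) * f α β ξ := by
      rw [← sum_sq_eq_norm_sq, Finset.mul_sum, Finset.mul_sum, Finset.sum_mul,
        ← Finset.sum_sub_distrib]
      refine Finset.sum_congr rfl fun γ _ => ?_
      have := hcl' γ
      rw [hanti' γ β]
      linear_combination (-(ξ γ : ℂ)) * this
    linear_combination (2 * Real.pi * Complex.I * (ξ α : ℂ)) * e1 -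
      (2 * Real.pi * Complex.I * (ξ β : ℂ)) * e2 + (2 * Real.pi * Complex.I) * e3

end Params

/-! ### Completeness -/

theorem multiplierNorm_fourierInv_sub {d : ℕ} {m : Rd d → ℝ} {w z : Rd d → ℂ}
    (hw : Integrable w volume) (hz : Integrable z volume) :
    multiplierNorm m (𝓕⁻ w - 𝓕⁻ z) =
      eLpNorm ((fun ξ : Rd d => (m ((2 * Real.pi) • ξ) : ℂ) * w ξ) -
        fun ξ : Rd d => (m ((2 * Real.pi) • ξ) : ℂ) * z ξ) 2 volume := by
  have h : 𝓕⁻ w - 𝓕⁻ z = 𝓕⁻ (w - z) := by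
    rw [sub_eq_iff_eq_add, ← fourierInv_add (hw.sub hz) hz, sub_add_cancel]
  rw [h, multiplierNorm_fourierInv _ (hw.sub hz)]
  congr 1; funext ξ
  simp [mul_sub]

/-- The weighted transforms converge in `L²`, and dividing the limit by the weight gives an
integrable function because `a` is below `d/2` and `b` above it. General filters are allowed since
the lemma serves both iterations and difference quotients as `t → 0`. -/
theorem Params.exists_limit {d : ℕ} {s δ : ℝ} (P : Params d s δ) {a b : ℝ} (ha : a ≤ lowExp d δ)
    (hb : s ≤ b) {ι : Type*} {l : Filter ι} [NeBot l] {f : ι → Rd d → ℂ}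
    (hf : ∀ᶠ i in l, multiplierNorm (wt a b) (f i) ≠ ⊤)
    (hc : Tendsto (fun q : ι × ι => multiplierNorm (wt a b) (f q.1 - f q.2)) (l ×ˢ l) (𝓝 0)) :
    ∃ u : Rd d → ℂ, multiplierNorm (wt a b) u ≠ ⊤ ∧
      Tendsto (fun i => multiplierNorm (wt a b) (f i - u)) l (𝓝 0) := by
  classical
  have hmW : Measurable (wt a b : Rd d → ℝ) := measurable_sobolevSymbol _ _
  set Wc : Rd d → ℂ := fun ξ => (wt a b ((2 * Real.pi) • ξ) : ℂ) with hWc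
  -- Indices with infinite norm receive the dummy representative zero, so that the family in `L²` is
  -- defined for every index.
  have hex : ∀ i, ∃ w : Rd d → ℂ, Integrable w volume ∧
      MemLp (fun ξ => Wc ξ * w ξ) 2 volume ∧
      (multiplierNorm (wt a b) (f i) ≠ ⊤ → f i = 𝓕⁻ w) := fun i => by
    by_cases h : multiplierNorm (wt a b) (f i) = ⊤
    · exact ⟨0, integrable_zero _ _ _, by simp, fun h' => absurd h h'⟩
    · obtain ⟨w, hw, hfw⟩ := fl_of_multiplierNorm_ne_top h
      refine ⟨w, hw, ⟨aestronglyMeasurable_multiplier hmW hw, ?_⟩, fun _ => hfw⟩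
      rw [hfw, multiplierNorm_fourierInv _ hw] at h
      exact lt_top_iff_ne_top.2 h
  choose w hw hwL hfw using hex
  set g : ι → Lp ℂ 2 (volume : Measure (Rd d)) := fun i => (hwL i).toLp with hg
  have hCauchy : Cauchy (map g l) := by
    rw [cauchy_map_iff]
    refine ⟨inferInstance, ?_⟩
    rw [uniformity_basis_edist.tendsto_right_iff]
    intro ε hε
    have h1 := (tendsto_order.1 hc).2 ε hε
    filter_upwards [h1, hf.prod_mk hf] with q hq hq2
    have e : edist (g q.1) (g q.2) = multiplierNorm (wt a b) (f q.1 - f q.2) := by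
      rw [hfw _ hq2.1, hfw _ hq2.2, multiplierNorm_fourierInv_sub (hw _) (hw _), hg,
        Lp.edist_toLp_toLp]
    simpa [e] using hq
  obtain ⟨G, hG⟩ := CompleteSpace.complete hCauchy
  have hG' : Tendsto g l (𝓝 G) := hG
  set z : Rd d → ℂ := fun ξ => (Wc ξ)⁻¹ * G ξ with hz
  have hWm : Measurable Wc := Complex.measurable_ofReal.comp (hmW.comp (measurable_const_smul _))
  have hzm : AEStronglyMeasurable z volume :=
    hWm.inv.aestronglyMeasurable.mul (Lp.aestronglyMeasurable G)
  have hWz : (fun ξ => Wc ξ * z ξ) =ᵐ[volume] G := by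
    filter_upwards [ae_ne_zero P.two_le] with ξ hξ
    have h0 : Wc ξ ≠ 0 := by
      exact Complex.ofReal_ne_zero.2 (wt_pos a b (two_pi_smul_ne_zero hξ)).ne'
    simp only [hz]
    rw [mul_inv_cancel_left₀ h0]
  have hzL : eLpNorm (fun ξ => Wc ξ * z ξ) 2 volume ≠ ⊤ := by
    rw [eLpNorm_congr_ae hWz]; exact Lp.eLpNorm_ne_top G
  have hzi : Integrable z volume := P.integrable_of_l2 ha hb hzm hzL
  refine ⟨𝓕⁻ z, by rw [multiplierNorm_fourierInv _ hzi]; exact hzL, ?_⟩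
  have h2 : Tendsto (fun i => edist (g i) G) l (𝓝 0) := by
    have := (hG'.edist tendsto_const_nhds : Tendsto (fun i => edist (g i) G) l (𝓝 (edist G G)))
    simpa using this
  refine h2.congr' ?_
  filter_upwards [hf] with i hi
  rw [hfw i hi, multiplierNorm_fourierInv_sub (hw i) hzi, Lp.edist_def]
  refine eLpNorm_congr_ae ?_
  filter_upwards [hWz, (hwL i).coeFn_toLp] with ξ h3 h4
  simp only [Pi.sub_apply, hg]
  rw [h4, ← h3]

/-- Convergence in a weighted norm implies pointwise convergence. -/
theorem Params.tendsto_apply {d : ℕ} {s δ : ℝ} (P : Params d s δ) {a b : ℝ} (ha : a ≤ lowExp d δ)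
    (hb : s ≤ b) {ι : Type*} {l : Filter ι} {f : ι → Rd d → ℂ} {u : Rd d → ℂ}
    (h : Tendsto (fun i => multiplierNorm (wt a b) (f i - u)) l (𝓝 0)) (x : Rd d) :
    Tendsto (fun i => f i x) l (𝓝 (u x)) := by
  rw [tendsto_iff_edist_tendsto_0]
  have h1 : Tendsto (fun i => l2 (fun ξ : Rd d =>
      ENNReal.ofReal (wt (-lowExp d δ) (-s) ((2 * Real.pi) • ξ))) *
      multiplierNorm (wt a b) (f i - u)) l (𝓝 0) := by
    have := ENNReal.Tendsto.const_mul h (Or.inr P.l2_weight_ne_top)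
    simpa using this
  refine tendsto_of_tendsto_of_tendsto_of_le_of_le' tendsto_const_nhds h1
    (.of_forall fun _ => zero_le) ?_
  filter_upwards [(tendsto_order.1 h).2 ⊤ ENNReal.zero_lt_top] with i hi
  rw [edist_eq_enorm_sub]
  exact P.enorm_apply_le ha hb (fl_of_multiplierNorm_ne_top hi.ne) x

/-! ### Linearity of the partial derivatives. -/

theorem pdC_sub {d : ℕ} {u v : Rd d → ℂ} (hu : Differentiable ℝ u) (hv : Differentiable ℝ v)
    (α : Fin d) : pdC α (u - v) = pdC α u - pdC α v := by
  funext x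
  simp [pdC, fderiv_sub (hu x) (hv x)]

theorem pdC_add {d : ℕ} {u v : Rd d → ℂ} (hu : Differentiable ℝ u) (hv : Differentiable ℝ v)
    (α : Fin d) : pdC α (u + v) = pdC α u + pdC α v := by
  funext x
  simp [pdC, fderiv_add (hu x) (hv x)]

theorem pdC_const_mul {d : ℕ} {u : Rd d → ℂ} (hu : Differentiable ℝ u) (c : ℂ)
    (α : Fin d) : pdC α (fun x => c * u x) = fun x => c * pdC α u x := by
  funext x
  simp only [pdC]
  rw [fderiv_const_mul (hu x)]; simp

/-! ### Sums of norms of components -/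

/-- The sum of the multiplier norms of the components of a tensor. -/
noncomputable def sumNorm {d : ℕ} {ι : Type} [Fintype ι] (m : Rd d → ℝ) (u : ι → Rd d → ℂ) : ℝ≥0∞ :=
  ∑ i, multiplierNorm m (u i)

section SumNorm
variable {d : ℕ} {ι : Type} [Fintype ι] {m : Rd d → ℝ}

theorem le_sumNorm (u : ι → Rd d → ℂ) (i : ι) : multiplierNorm m (u i) ≤ sumNorm m u :=
  Finset.single_le_sum (f := fun i => multiplierNorm m (u i)) (fun _ _ => zero_le)
    (Finset.mem_univ i)

theorem ne_top_of_sumNorm {u : ι → Rd d → ℂ} (h : sumNorm m u ≠ ⊤) (i : ι) :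
    multiplierNorm m (u i) ≠ ⊤ := ne_top_of_le_ne_top h (le_sumNorm u i)

theorem sumNorm_ne_top {u : ι → Rd d → ℂ} (h : ∀ i, multiplierNorm m (u i) ≠ ⊤) :
    sumNorm m u ≠ ⊤ := ENNReal.sum_ne_top.2 fun i _ => h i

theorem le_tensorNorm (u : ι → Rd d → ℂ) (i : ι) : multiplierNorm m (u i) ≤ tensorNorm m u := by
  unfold tensorNorm
  calc multiplierNorm m (u i) = (multiplierNorm m (u i) ^ 2) ^ (1 / 2 : ℝ) := by
        rw [← ENNReal.rpow_natCast, ← ENNReal.rpow_mul]; norm_num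
    _ ≤ _ := by
        refine ENNReal.rpow_le_rpow ?_ (by norm_num)
        exact Finset.single_le_sum (f := fun i => multiplierNorm m (u i) ^ 2)
          (fun _ _ => zero_le) (Finset.mem_univ i)

/-- The estimates run in the sum of the component norms, which adds up termwise; it is equivalent to
the `ℓ²` tensor norm up to the number of components. -/
theorem sumNorm_le_tensorNorm (u : ι → Rd d → ℂ) :
    sumNorm m u ≤ Fintype.card ι * tensorNorm m u := by
  refine (Finset.sum_le_sum fun i _ => le_tensorNorm u i).trans ?_
  simp

theorem tensorNorm_le_sumNorm (u : ι → Rd d → ℂ) : tensorNorm m u ≤ sumNorm m u := by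
  unfold tensorNorm
  have h : ∑ i, multiplierNorm m (u i) ^ 2 ≤ sumNorm m u ^ 2 := by
    calc ∑ i, multiplierNorm m (u i) ^ 2 ≤ ∑ i, multiplierNorm m (u i) * sumNorm m u := by
          refine Finset.sum_le_sum fun i _ => ?_
          rw [sq]; exact mul_le_mul_right (le_sumNorm u i) _
      _ = _ := by rw [← Finset.sum_mul, sq]; rfl
  refine (ENNReal.rpow_le_rpow h (by norm_num)).trans (le_of_eq ?_)
  rw [← ENNReal.rpow_natCast, ← ENNReal.rpow_mul]; norm_num

theorem sumNorm_add_le (hm : Measurable m) (u v : ι → Rd d → ℂ) :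
    sumNorm m (u + v) ≤ sumNorm m u + sumNorm m v := by
  unfold sumNorm
  rw [← Finset.sum_add_distrib]
  exact Finset.sum_le_sum fun i _ => multiplierNorm_add_le hm _ _

theorem sumNorm_neg (u : ι → Rd d → ℂ) : sumNorm m (-u) = sumNorm m u :=
  Finset.sum_congr rfl fun i _ => multiplierNorm_neg m (u i)

theorem sumNorm_sub_le (hm : Measurable m) (u v : ι → Rd d → ℂ) :
    sumNorm m (u - v) ≤ sumNorm m u + sumNorm m v := by
  rw [sub_eq_add_neg, ← sumNorm_neg v]; exact sumNorm_add_le hm _ _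

end SumNorm

/-- Absorption. Finiteness of `x` is essential, so each a priori estimate has to know beforehand
that its left side is finite. -/
theorem le_two_mul_of_le_add_half {x a : ℝ≥0∞} (hx : x ≠ ⊤) (h : x ≤ a + 2⁻¹ * x) : x ≤ 2 * a := by
  by_cases ha : a = ⊤
  · rw [ha]; simp
  lift x to NNReal using hx
  lift a to NNReal using ha
  have h2 : (2 : ℝ≥0∞)⁻¹ = ((2⁻¹ : NNReal) : ℝ≥0∞) := by simp
  rw [h2] at h
  have h' : x ≤ a + 2⁻¹ * x := by exact_mod_cast h
  have : x ≤ 2 * a := by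
    rw [← NNReal.coe_le_coe] at h' ⊢
    push_cast at h' ⊢
    linarith
  exact_mod_cast this

/-- Contraction principle in the weighted spaces. -/
theorem Params.exists_fixedPoint {d : ℕ} {s δ : ℝ} (P : Params d s δ) {a b : ℝ}
    (ha : a ≤ lowExp d δ) (hb : s ≤ b) {ι : Type} [Fintype ι]
    (T : (ι → Rd d → ℂ) → ι → Rd d → ℂ)
    (hfin : ∀ u, sumNorm (wt a b) u ≠ ⊤ → sumNorm (wt a b) (T u) ≠ ⊤)
    (hT : ∀ u v, sumNorm (wt a b) u ≠ ⊤ → sumNorm (wt a b) v ≠ ⊤ →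
      sumNorm (wt a b) (T u - T v) ≤ 2⁻¹ * sumNorm (wt a b) (u - v)) :
    ∃ u, sumNorm (wt a b) u ≠ ⊤ ∧ T u = u := by
  have hm : Measurable (wt a b : Rd d → ℝ) := measurable_sobolevSymbol _ _
  set S : (ι → Rd d → ℂ) → ℝ≥0∞ := sumNorm (wt a b) with hS
  set u : ℕ → ι → Rd d → ℂ := fun n => T^[n] 0 with hu
  have hsucc : ∀ n, u (n + 1) = T (u n) := fun n => Function.iterate_succ_apply' T n 0
  have h00 : S (0 : ι → Rd d → ℂ) = 0 := by simp [hS, sumNorm, multiplierNorm_zero]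
  have hufin : ∀ n, S (u n) ≠ ⊤ := fun n => by
    induction n with
    | zero => simp only [hu, Function.iterate_zero, id, h00]; simp
    | succ n ih => rw [hsucc]; exact hfin _ ih
  set c := S (u 1 - u 0) with hc
  have hctop : c ≠ ⊤ := ne_top_of_le_ne_top (ENNReal.add_ne_top.2 ⟨hufin 1, hufin 0⟩)
    (sumNorm_sub_le hm _ _)
  -- The bound `2c` is the fixed point of `x ↦ x/2 + c`.
  have h1 : ∀ n, S (u n - u 0) ≤ 2 * c := fun n => by
    induction n with
    | zero => rw [sub_self, h00]; exact zero_le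
    | succ n ih =>
      have e : u (n + 1) - u 0 = (T (u n) - T (u 0)) + (u 1 - u 0) := by
        rw [hsucc n, hsucc 0]; abel
      rw [e]
      refine (sumNorm_add_le hm _ _).trans ?_
      refine (add_le_add_left ((hT _ _ (hufin _) (hufin _)).trans (mul_le_mul_right ih _)) _).trans ?_
      rw [← mul_assoc, ENNReal.inv_mul_cancel (by norm_num) (by norm_num), one_mul, two_mul]
  have h2 : ∀ n j, S (u (n + j) - u n) ≤ 2⁻¹ ^ n * (2 * c) := fun n => by
    induction n with
    | zero => intro j; simpa using h1 j
    | succ n ih =>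
      intro j
      rw [show n + 1 + j = (n + j) + 1 by ring, hsucc, hsucc, pow_succ', mul_assoc]
      exact (hT _ _ (hufin _) (hufin _)).trans (mul_le_mul_right (ih j) _)
  have h2' : ∀ N n, N ≤ n → S (u n - u N) ≤ 2⁻¹ ^ N * (2 * c) := fun N n h => by
    obtain ⟨j, rfl⟩ := Nat.exists_eq_add_of_le h
    exact h2 N j
  have hlim0 : Tendsto (fun N : ℕ => (2 : ℝ≥0∞)⁻¹ ^ N * (2 * c) + 2⁻¹ ^ N * (2 * c)) atTop (𝓝 0) := by
    have h3 : Tendsto (fun N : ℕ => (2 : ℝ≥0∞)⁻¹ ^ N) atTop (𝓝 0) :=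
      ENNReal.tendsto_pow_atTop_nhds_zero_of_lt_one (by simp)
    have h4 := ENNReal.Tendsto.mul_const h3 (b := 2 * c)
      (Or.inr (ENNReal.mul_ne_top (by norm_num) hctop))
    simpa using h4.add h4
  have hCau : ∀ i, Tendsto (fun q : ℕ × ℕ => multiplierNorm (wt a b) (u q.1 i - u q.2 i))
      (atTop ×ˢ atTop) (𝓝 0) := fun i => by
    rw [ENNReal.tendsto_nhds_zero]
    intro ε hε
    obtain ⟨N, hN⟩ := ((ENNReal.tendsto_nhds_zero.1 hlim0) ε hε).exists
    filter_upwards [(eventually_ge_atTop N).prod_mk (eventually_ge_atTop N)] with q hq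
    refine le_trans ?_ hN
    refine (le_sumNorm (u q.1 - u q.2) i).trans ?_
    rw [show u q.1 - u q.2 = (u q.1 - u N) - (u q.2 - u N) by abel]
    exact (sumNorm_sub_le hm _ _).trans (add_le_add (h2' _ _ hq.1) (h2' _ _ hq.2))
  choose v hv hvlim using fun i => P.exists_limit ha hb (l := atTop) (f := fun n => u n i)
    (.of_forall fun n => ne_top_of_sumNorm (hufin n) i) (hCau i)
  have hvfin : S v ≠ ⊤ := sumNorm_ne_top hv
  have hSlim : Tendsto (fun n => S (u n - v)) atTop (𝓝 0) := by
    have := tendsto_finsetSum Finset.univ fun i _ => hvlim i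
    simpa [hS, sumNorm] using this
  refine ⟨v, hvfin, ?_⟩
  have hz : S (T v - v) = 0 := by
    have h5 : ∀ n, S (T v - v) ≤ S (u n - v) + S (u (n + 1) - v) := fun n => by
      rw [show T v - v = (u (n + 1) - v) - (u (n + 1) - T v) by abel]
      refine (sumNorm_sub_le hm _ _).trans ?_
      rw [add_comm]
      refine add_le_add_left ?_ _
      rw [hsucc]
      refine (hT _ _ (hufin _) hvfin).trans ?_
      exact mul_le_of_le_one_left' (by simp)
    have h6 := hSlim.add (hSlim.comp (tendsto_add_atTop_nat 1))
    rw [add_zero] at h6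
    exact le_antisymm (ge_of_tendsto' h6 h5) zero_le
  funext i
  have h7 : multiplierNorm (wt a b) (T v i - v i) = 0 :=
    le_antisymm ((le_sumNorm (T v - v) i).trans hz.le) zero_le
  exact sub_eq_zero.1 (eq_zero_of_multiplierNorm_eq_zero P.two_le hm
    (fun η hη => (wt_pos a b hη).ne') h7)

/-! ### The inverse metric -/

/-- The components of a real matrix field as complex functions. -/
noncomputable abbrev cMetric {d : ℕ} (h : MetricField d) : Fin d × Fin d → Rd d → ℂ :=
  fun p x => (h x p.1 p.2 : ℂ)

/-- The components of `g^{-1} - I`. -/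
noncomputable abbrev invDev {d : ℕ} (h : MetricField d) : Fin d × Fin d → Rd d → ℂ :=
  cMetric (fun x => ginv h x - 1)

/-- The products of two matrix fields. -/
noncomputable def mprod {d : ℕ} (u v : Fin d × Fin d → Rd d → ℂ) : Fin d × Fin d → Rd d → ℂ :=
  fun p => ∑ l, u (p.1, l) * v (l, p.2)

theorem sumNorm_mprod_le {d : ℕ} {W V₁ V₂ : Rd d → ℝ} (hW : Measurable W) {C : ℝ≥0∞}
    {u v : Fin d × Fin d → Rd d → ℂ}
    (h : ∀ p q, multiplierNorm W (u p * v q) ≤ C * (multiplierNorm V₁ (u p) * multiplierNorm V₂ (v q))) :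
    sumNorm W (mprod u v) ≤ C * (sumNorm V₁ u * sumNorm V₂ v) := by
  have h1 : ∀ p : Fin d × Fin d, multiplierNorm W (mprod u v p) ≤
      ∑ l, C * (multiplierNorm V₁ (u (p.1, l)) * multiplierNorm V₂ (v (l, p.2))) := fun p =>
    (multiplierNorm_sum_le hW _ _).trans (Finset.sum_le_sum fun l _ => h _ _)
  refine (Finset.sum_le_sum fun p _ => h1 p).trans ?_
  simp_rw [← Finset.mul_sum]
  refine mul_le_mul_right ?_ _
  unfold sumNorm
  rw [Fintype.sum_prod_type, Fintype.sum_prod_type, Fintype.sum_prod_type]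
  calc ∑ i, ∑ j, ∑ l, multiplierNorm V₁ (u (i, l)) * multiplierNorm V₂ (v (l, j))
      = ∑ i, ∑ l, multiplierNorm V₁ (u (i, l)) * ∑ j, multiplierNorm V₂ (v (l, j)) := by
        refine Finset.sum_congr rfl fun i _ => ?_
        rw [Finset.sum_comm]
        exact Finset.sum_congr rfl fun l _ => (Finset.mul_sum _ _ _).symm
    _ ≤ ∑ i, ∑ l, multiplierNorm V₁ (u (i, l)) * ∑ l, ∑ j, multiplierNorm V₂ (v (l, j)) := by
        refine Finset.sum_le_sum fun i _ => Finset.sum_le_sum fun l _ => mul_le_mul_right ?_ _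
        exact Finset.single_le_sum (f := fun l => ∑ j, multiplierNorm V₂ (v (l, j)))
          (fun _ _ => zero_le) (Finset.mem_univ l)
    _ = _ := by simp_rw [Finset.sum_mul]

theorem mprod_sub {d : ℕ} (u v w : Fin d × Fin d → Rd d → ℂ) :
    mprod u (v - w) = mprod u v - mprod u w := by
  funext p x
  simp [mprod, mul_sub]

theorem fl_of_sumNorm {d : ℕ} {ι : Type} [Fintype ι] {m : Rd d → ℝ} {u : ι → Rd d → ℂ}
    (h : sumNorm m u ≠ ⊤) (i : ι) : FL (u i) := fl_of_multiplierNorm_ne_top (ne_top_of_sumNorm h i)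

/-- The Neumann series appears as the fixed point of `k ↦ -h - h k`, a contraction by the algebra
property; the fixed point equation says `(1 + h)(1 + k) = 1`. A right inverse at each point forces
the determinant to be nonzero, and uniqueness of inverses identifies `k` with `g⁻¹ - 1`. -/
theorem Params.invDev_bound {d : ℕ} {s δ : ℝ} (P : Params d s δ) {h : MetricField d}
    (hh : sumNorm (wt (lowExp d δ) (s + 1)) (cMetric h) ≠ ⊤)
    (hsm : prodConst d s δ * sumNorm (wt (lowExp d δ) (s + 1)) (cMetric h) ≤ 2⁻¹) :
    (∀ x, IsUnit (1 + h x).det) ∧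
      sumNorm (wt (lowExp d δ) (s + 1)) (invDev h) ≤
        2 * sumNorm (wt (lowExp d δ) (s + 1)) (cMetric h) := by
  have hm : Measurable (wt (lowExp d δ) (s + 1) : Rd d → ℝ) := measurable_sobolevSymbol _ _
  have hmul : ∀ k : Fin d × Fin d → Rd d → ℂ, sumNorm (wt (lowExp d δ) (s + 1)) k ≠ ⊤ →
      sumNorm (wt (lowExp d δ) (s + 1)) (mprod (cMetric h) k) ≤
        2⁻¹ * sumNorm (wt (lowExp d δ) (s + 1)) k := fun k hk => by
    refine (sumNorm_mprod_le hm fun p q => P.norm_metric_mul_metric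
      (by have := P.lt_s; linarith) le_rfl (fl_of_sumNorm hh p) (fl_of_sumNorm hk q)).trans ?_
    rw [← mul_assoc]
    exact mul_le_mul_left hsm _
  obtain ⟨k, hk, hfix⟩ := P.exists_fixedPoint (a := lowExp d δ) (b := s + 1) le_rfl
    (by linarith) (fun k => -cMetric h - mprod (cMetric h) k)
    (fun k hk => ne_top_of_le_ne_top (ENNReal.add_ne_top.2
      ⟨by rw [sumNorm_neg]; exact hh,
        ne_top_of_le_ne_top (ENNReal.mul_ne_top (by norm_num) hk) (hmul k hk)⟩)
      (sumNorm_sub_le hm _ _))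
    (fun k k' hk hk' => by
      have e : -cMetric h - mprod (cMetric h) k - (-cMetric h - mprod (cMetric h) k') =
          -mprod (cMetric h) (k - k') := by rw [mprod_sub]; abel
      simp only [e, sumNorm_neg]
      exact hmul _ (ne_top_of_le_ne_top (ENNReal.add_ne_top.2 ⟨hk, hk'⟩) (sumNorm_sub_le hm _ _)))
  have hinv : ∀ x, (1 + h x).map (Complex.ofRealHom) *
      (1 + (Matrix.of fun i j => k (i, j) x)) = 1 := fun x => by
    ext i j
    have h1 := congrFun (congrFun hfix (i, j)) x
    simp only [Pi.sub_apply, Pi.neg_apply, mprod, Finset.sum_apply, Pi.mul_apply] at h1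
    have h2 : (1 + h x).map (Complex.ofRealHom) = 1 + (h x).map (Complex.ofRealHom) := by
      ext i j
      simp only [Matrix.map_apply, Matrix.add_apply, map_add]
      congr 1
      by_cases hij : i = j <;> simp [Matrix.one_apply, hij]
    have h3 : (1 + (h x).map (Complex.ofRealHom)) * (1 + (Matrix.of fun i j => k (i, j) x)) =
        1 + (Matrix.of fun i j => k (i, j) x) + ((h x).map (Complex.ofRealHom) +
          (h x).map (Complex.ofRealHom) * (Matrix.of fun i j => k (i, j) x)) := by noncomm_ring
    rw [h2, h3]
    simp only [Matrix.add_apply, Matrix.mul_apply, Matrix.map_apply, Matrix.of_apply]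
    rw [← h1]
    simp only [cMetric, Complex.ofRealHom_eq_coe]
    ring
  have hdet : ∀ x, IsUnit (1 + h x).det := fun x => by
    have h1 := congrArg Matrix.det (hinv x)
    rw [Matrix.det_mul, Matrix.det_one] at h1
    have h2 : ((1 + h x).map (Complex.ofRealHom)).det = ((1 + h x).det : ℂ) :=
      (RingHom.map_det Complex.ofRealHom (1 + h x)).symm
    rw [h2] at h1
    rw [isUnit_iff_ne_zero]
    intro h0
    rw [h0] at h1
    simp at h1
  have hkeq : invDev h = k := by
    funext ⟨i, j⟩ x
    have h1 : (1 + h x) * ginv h x = 1 := Matrix.mul_nonsing_inv _ (hdet x)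
    have h2 : (1 + h x).map (Complex.ofRealHom) * (ginv h x).map (Complex.ofRealHom) = 1 := by
      rw [← Matrix.map_mul, h1]; simp
    have h3 := left_inv_eq_right_inv (mul_eq_one_comm.1 h2) (hinv x)
    have h4 := congrFun (congrFun h3 i) j
    simp only [Matrix.map_apply, Matrix.add_apply, Matrix.of_apply, Complex.ofRealHom_eq_coe] at h4
    simp only [invDev, cMetric, Matrix.sub_apply, Complex.ofReal_sub]
    rw [h4]
    by_cases hij : i = j <;> simp [Matrix.one_apply, hij]
  refine ⟨hdet, ?_⟩
  rw [hkeq]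
  apply le_two_mul_of_le_add_half hk
  conv_lhs => rw [← hfix]
  refine (sumNorm_sub_le hm _ _).trans ?_
  rw [sumNorm_neg]
  exact add_le_add_right (hmul k hk) _

/-! ### The div-curl system in harmonic coordinates -/

/-- The components of a second fundamental form. -/
abbrev cForm {d : ℕ} (lam : SecondForm d) : Fin d × Fin d → Rd d → ℂ := fun p x => lam x p.1 p.2

/-- The components of a connection as complex functions. -/
noncomputable abbrev cConn {d : ℕ} (A : Connection d) : Fin d → Rd d → ℂ := fun i x => (A x i : ℂ)

/-- The components of the inverse metric as complex functions. -/
noncomputable abbrev cInv {d : ℕ} (h : MetricField d) : Fin d × Fin d → Rd d → ℂ := cMetric (ginv h)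

theorem formNorm_eq {d : ℕ} (r : ℝ) (lam : SecondForm d) :
    formNorm r lam = tensorNorm (wt 0 r) (cForm lam) := by rw [formNorm, wt, sub_zero]

/-- The contraction `k^{αβ} ∂_α A_β`. -/
noncomputable def contractGrad {d : ℕ} (k : Fin d × Fin d → Rd d → ℂ) (A : Fin d → Rd d → ℂ) :
    Rd d → ℂ := ∑ p, k p * pdC p.1 (A p.2)

theorem pd_one_add {d : ℕ} (h : MetricField d) (α i j : Fin d) (x : Rd d) :
    pd α (fun y => (1 + h y) i j) x = pd α (fun y => h y i j) x := by
  unfold pd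
  simp only [Matrix.add_apply]
  rw [fderiv_const_add]

theorem christoffel_symm {d : ℕ} {h : MetricField d} (hs : ∀ x, (h x).IsSymm) (γ α β : Fin d)
    (x : Rd d) : christoffel h γ α β x = christoffel h γ β α x := by
  unfold christoffel
  refine Finset.sum_congr rfl fun σ _ => ?_
  have : (fun y => (1 + h y) β α) = fun y => (1 + h y) α β := by
    funext y
    simp only [Matrix.add_apply, (hs y).apply α β]
    congr 1
    by_cases hab : α = β
    · subst hab; rfl
    · rw [Matrix.one_apply_ne hab, Matrix.one_apply_ne (Ne.symm hab)]
  rw [this]; ring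

/-- The Christoffel terms cancel by symmetry in the lower indices, so the curl does not see the
metric. -/
theorem covCurl_eq {d : ℕ} {h : MetricField d} (hs : ∀ x, (h x).IsSymm) (A : Connection d)
    (α β : Fin d) (x : Rd d) :
    covCurl h A α β x = pd α (fun y => A y β) x - pd β (fun y => A y α) x := by
  unfold covCurl covDeriv
  simp_rw [christoffel_symm hs _ β α]
  ring

/-- The harmonic gauge removes the contracted Christoffel symbols, so no derivative of the metric is
left. -/
theorem covDiv_eq {d : ℕ} {h : MetricField d} (hh : IsHarmonicGauge h) (A : Connection d)
    (x : Rd d) : covDiv h A x = ∑ α, ∑ β, ginv h x α β * pd α (fun y => A y β) x := by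
  have h1 : covDiv h A x = ∑ α, ∑ β, ginv h x α β * pd α (fun y => A y β) x -
      ∑ γ, (∑ α, ∑ β, ginv h x α β * christoffel h γ α β x) * A x γ := by
    unfold covDiv covDeriv
    simp_rw [mul_sub, Finset.sum_sub_distrib, Finset.mul_sum, Finset.sum_mul]
    congr 1
    rw [Finset.sum_comm' (t' := Finset.univ) (s' := fun _ => Finset.univ) (by simp)]
    refine (Finset.sum_congr rfl fun β _ => Finset.sum_comm).trans ?_
    rw [Finset.sum_comm]
    refine Finset.sum_congr rfl fun γ _ => ?_
    rw [Finset.sum_comm]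
    exact Finset.sum_congr rfl fun α _ => Finset.sum_congr rfl fun β _ => by ring
  simp [h1, hh _ x]

theorem pdC_cConn {d : ℕ} {A : Connection d} (hA : ∀ i, FL1 (cConn A i)) (α β : Fin d) (x : Rd d) :
    pdC α (cConn A β) x = (pd α (fun y => A y β) x : ℂ) := by
  refine pdC_ofReal ?_ α
  have := Complex.reCLM.differentiable.comp (hA β).differentiable
  exact this x

theorem pdC_cMetric {d : ℕ} {h : MetricField d} (hh : ∀ p, FL1 (cMetric h p)) (α : Fin d)
    (p : Fin d × Fin d) (x : Rd d) :
    pdC α (cMetric h p) x = (pd α (fun y => h y p.1 p.2) x : ℂ) := by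
  refine pdC_ofReal ?_ α
  have := Complex.reCLM.differentiable.comp (hh p).differentiable
  exact this x

theorem cInv_eq {d : ℕ} (h : MetricField d) (p : Fin d × Fin d) (x : Rd d) :
    cInv h p x = (if p.1 = p.2 then 1 else 0) + invDev h p x := by
  simp only [cInv, invDev, cMetric, Matrix.sub_apply, Matrix.one_apply]
  split_ifs <;> simp

theorem sum_cInv_mul {d : ℕ} (h : MetricField d) (D : Fin d → Fin d → ℂ) (x : Rd d) :
    ∑ α, ∑ β, cInv h (α, β) x * D α β = ∑ α, D α α + ∑ p, invDev h p x * D p.1 p.2 := by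
  rw [Fintype.sum_prod_type, ← Finset.sum_add_distrib]
  refine Finset.sum_congr rfl fun α _ => ?_
  simp only [cInv_eq, add_mul, Finset.sum_add_distrib, ite_mul, one_mul, zero_mul]
  simp

theorem ofReal_covDiv {d : ℕ} {h : MetricField d} (hh : IsHarmonicGauge h) {A : Connection d}
    (hA : ∀ i, FL1 (cConn A i)) (x : Rd d) :
    (covDiv h A x : ℂ) = (∑ α, pdC α (cConn A α)) x + contractGrad (invDev h) (cConn A) x := by
  rw [covDiv_eq hh]
  push_cast
  have := sum_cInv_mul h (fun α β => pdC α (cConn A β) x) x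
  simp only [contractGrad, Finset.sum_apply, Pi.mul_apply]
  rw [← this]
  simp_rw [pdC_cConn hA]

theorem contractGrad_sub {d : ℕ} (k : Fin d × Fin d → Rd d → ℂ) {A B : Fin d → Rd d → ℂ}
    (hA : ∀ i, FL1 (A i)) (hB : ∀ i, FL1 (B i)) :
    contractGrad k (A - B) = contractGrad k A - contractGrad k B := by
  unfold contractGrad
  rw [← Finset.sum_sub_distrib]
  refine Finset.sum_congr rfl fun p _ => ?_
  rw [Pi.sub_apply, pdC_sub (hA _).differentiable (hB _).differentiable, mul_sub]

section Adm
variable {d : ℕ} {s δ : ℝ} {Z Y : Rd d → ℝ}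

theorem AdmWeight.pd_le (hW : AdmWeight d s δ Z Y) (hd : 2 ≤ d) {u : Rd d → ℂ} (hu : FL1 u)
    (α : Fin d) : multiplierNorm Z (pdC α u) ≤ multiplierNorm Y u :=
  multiplierNorm_pd_le hd hu (fun η hη => (hW.mul_norm η hη).le) α

theorem AdmWeight.le_conn (hW : AdmWeight d s δ Z Y) (hd : 2 ≤ d) (u : Rd d → ℂ) :
    multiplierNorm Y u ≤ multiplierNorm (wt (deltaD d δ) (s + 1)) u := by
  simpa using multiplierNorm_mono hd one_pos (fun η hη => by simpa using hW.le_top η hη) u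

theorem AdmWeight.norm_mul_le (hW : AdmWeight d s δ Z Y) (P : Params d s δ) {u v : Rd d → ℂ}
    (hu : FL u) (hv : FL v) :
    multiplierNorm Z (u * v) ≤ prodConst d s δ *
      (multiplierNorm (wt (lowExp d δ) (s + 1)) u * multiplierNorm Z v) :=
  P.norm_mul_le_of_symbol (measurable_sobolevSymbol _ _) hW.measZ hW.bilinear hu hv

/-- The perturbation term is of the same order as the principal part: the derivative is the step
from `Y` to `Z`, and only the size of `k` is small. -/
theorem AdmWeight.contractGrad_le (hW : AdmWeight d s δ Z Y) (P : Params d s δ)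
    {k : Fin d × Fin d → Rd d → ℂ} {A : Fin d → Rd d → ℂ} (hk : ∀ p, FL (k p))
    (hA : ∀ i, FL1 (A i)) :
    multiplierNorm Z (contractGrad k A) ≤ prodConst d s δ *
      sumNorm (wt (lowExp d δ) (s + 1)) k * sumNorm Y A := by
  refine (multiplierNorm_sum_le hW.measZ _ _).trans ?_
  rw [sumNorm, Finset.mul_sum, Finset.sum_mul]
  refine Finset.sum_le_sum fun p _ => ?_
  refine (hW.norm_mul_le P (hk p) ((hA p.2).pd p.1)).trans ?_
  rw [mul_assoc]
  refine mul_le_mul_right (mul_le_mul_right ?_ _) _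
  exact (hW.pd_le P.two_le (hA _) _).trans (le_sumNorm A p.2)

/-- A priori estimate for the div-curl system with small variable coefficients. -/
theorem AdmWeight.apriori (hW : AdmWeight d s δ Z Y) (P : Params d s δ)
    {k : Fin d × Fin d → Rd d → ℂ} {A : Fin d → Rd d → ℂ} (hk : ∀ p, FL (k p))
    (hA : ∀ i, FL1 (A i)) (hfin : sumNorm Y A ≠ ⊤)
    (hsm : d * (prodConst d s δ * sumNorm (wt (lowExp d δ) (s + 1)) k) ≤ 2⁻¹)
    {G : Rd d → ℂ} (hdiv : ∑ α, pdC α (A α) = G - contractGrad k A) :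
    sumNorm Y A ≤ 2 * (∑ α, ∑ β, multiplierNorm Z (pdC α (A β) - pdC β (A α)) +
      d * multiplierNorm Z G) := by
  apply le_two_mul_of_le_add_half hfin
  have h1 : sumNorm Y A ≤ ∑ β, (∑ α, multiplierNorm Z (pdC α (A β) - pdC β (A α)) +
      (multiplierNorm Z G + multiplierNorm Z (contractGrad k A))) :=
    Finset.sum_le_sum fun β _ => (norm_le_div_curl P.two_le hW.measZ hW.mul_norm hA β).trans
      (add_le_add_right (by rw [hdiv]; exact multiplierNorm_sub_le hW.measZ _ _) _)
  refine h1.trans ?_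
  rw [Finset.sum_add_distrib, Finset.sum_comm, Finset.sum_const, Finset.card_univ,
    Fintype.card_fin, nsmul_eq_mul, mul_add, ← add_assoc]
  refine add_le_add_right ?_ _
  refine (mul_le_mul_right (hW.contractGrad_le P hk hA) _).trans ?_
  rw [← mul_assoc]
  exact mul_le_mul_left hsm _

end Adm

/-! ### Metrics close to the identity -/

/-- Smallness of `h` in the form needed for the perturbation arguments. -/
def SmallMetric {d : ℕ} (s δ : ℝ) (h : MetricField d) : Prop :=
  -- In `4 d`, one factor two is lost between `h` and `g⁻¹ - 1`, the other produces the bound `1/2`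
  -- for absorption, and `d` counts the components summed in `AdmWeight.apriori`.
  4 * (d : ℝ≥0∞) * (prodConst d s δ * sumNorm (wt (lowExp d δ) (s + 1)) (cMetric h)) ≤ 1 ∧
    sumNorm (wt (lowExp d δ) (s + 1)) (cMetric h) ≤ 1

section Small
variable {d : ℕ} {s δ : ℝ} {h : MetricField d}

theorem SmallMetric.ne_top (hh : SmallMetric s δ h) :
    sumNorm (wt (lowExp d δ) (s + 1)) (cMetric h) ≠ ⊤ := ne_top_of_le_ne_top (by simp) hh.2

theorem SmallMetric.fl1 (hh : SmallMetric s δ h) (P : Params d s δ) (p : Fin d × Fin d) :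
    FL1 (cMetric h p) :=
  P.fl1_of_ne_top (by linarith) le_rfl (ne_top_of_sumNorm hh.ne_top p)

theorem SmallMetric.bound (hh : SmallMetric s δ h) (P : Params d s δ) :
    (∀ x, IsUnit (1 + h x).det) ∧
      sumNorm (wt (lowExp d δ) (s + 1)) (invDev h) ≤
        2 * sumNorm (wt (lowExp d δ) (s + 1)) (cMetric h) := by
  refine P.invDev_bound hh.ne_top ?_
  refine (ENNReal.mul_le_mul_iff_right (a := 2) (by norm_num) (by norm_num)).1 ?_
  rw [ENNReal.mul_inv_cancel (by norm_num) (by norm_num)]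
  refine le_trans (mul_le_mul_left ?_ _) hh.1
  calc (2 : ℝ≥0∞) = 2 * 1 := by norm_num
    _ ≤ 4 * (d : ℝ≥0∞) := by
        gcongr
        · norm_num
        · exact_mod_cast (by have := P.two_le; omega : 1 ≤ d)

theorem SmallMetric.dev_ne_top (hh : SmallMetric s δ h) (P : Params d s δ) :
    sumNorm (wt (lowExp d δ) (s + 1)) (invDev h) ≠ ⊤ :=
  ne_top_of_le_ne_top (ENNReal.mul_ne_top (by norm_num) hh.ne_top) (hh.bound P).2

theorem SmallMetric.dev_fl (hh : SmallMetric s δ h) (P : Params d s δ) (p : Fin d × Fin d) :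
    FL (invDev h p) := fl_of_sumNorm (hh.dev_ne_top P) p

theorem SmallMetric.dev_small (hh : SmallMetric s δ h) (P : Params d s δ) :
    d * (prodConst d s δ * sumNorm (wt (lowExp d δ) (s + 1)) (invDev h)) ≤ 2⁻¹ := by
  refine (ENNReal.mul_le_mul_iff_right (a := 2) (by norm_num) (by norm_num)).1 ?_
  rw [ENNReal.mul_inv_cancel (by norm_num) (by norm_num)]
  refine le_trans ?_ hh.1
  refine (mul_le_mul_right (mul_le_mul_right (mul_le_mul_right (hh.bound P).2 _) _) _).trans
    (le_of_eq ?_)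
  ring

theorem SmallMetric.dev_le_one (hh : SmallMetric s δ h) (P : Params d s δ) :
    prodConst d s δ * sumNorm (wt (lowExp d δ) (s + 1)) (invDev h) ≤ 1 := by
  have h1 : (1 : ℝ≥0∞) ≤ d := by exact_mod_cast (by have := P.two_le; omega : 1 ≤ d)
  calc _ ≤ (d : ℝ≥0∞) * (prodConst d s δ * sumNorm (wt (lowExp d δ) (s + 1)) (invDev h)) :=
        le_mul_of_one_le_left' h1
    _ ≤ 2⁻¹ := hh.dev_small P
    _ ≤ 1 := by simp

theorem cInv_mul_eq (h : MetricField d) (p : Fin d × Fin d) (v : Rd d → ℂ) :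
    cInv h p * v = (fun x => (if p.1 = p.2 then (1 : ℂ) else 0) * v x) + invDev h p * v := by
  funext x
  rw [Pi.mul_apply, cInv_eq, add_mul]; rfl

theorem SmallMetric.fl_inv_mul (hh : SmallMetric s δ h) (P : Params d s δ) (p : Fin d × Fin d)
    {v : Rd d → ℂ} (hv : FL v) : FL (cInv h p * v) := by
  rw [cInv_mul_eq]
  exact (hv.const_mul _).add ((hh.dev_fl P p).mul hv)

/-- The inverse metric is the identity plus a deviation whose multiplication operator has norm at
most one; hence the factor two. -/
theorem SmallMetric.inv_mul_le (hh : SmallMetric s δ h) (P : Params d s δ) {W : Rd d → ℝ}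
    (hW : Measurable W) (p : Fin d × Fin d) {v : Rd d → ℂ}
    (hb : ∀ u, FL u → multiplierNorm W (u * v) ≤ prodConst d s δ *
      (multiplierNorm (wt (lowExp d δ) (s + 1)) u * multiplierNorm W v)) :
    multiplierNorm W (cInv h p * v) ≤ 2 * multiplierNorm W v := by
  rw [cInv_mul_eq, two_mul]
  refine (multiplierNorm_add_le hW _ _).trans (add_le_add ?_ ?_)
  · refine (multiplierNorm_const_mul_le _ _ _).trans (mul_le_of_le_one_left' ?_)
    split_ifs <;> simp
  · refine (hb _ (hh.dev_fl P p)).trans ?_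
    rw [← mul_assoc]
    refine mul_le_of_le_one_left' (le_trans ?_ (hh.dev_le_one P))
    exact mul_le_mul_right (le_sumNorm _ p) _

end Small

/-! ### The curvature source -/

/-- The form `k^{γμ} u_{αμ} conj v_{βγ}`. -/
noncomputable def curvForm {d : ℕ} (k u v : Fin d × Fin d → Rd d → ℂ) (α β : Fin d) : Rd d → ℂ :=
  ∑ γ, ∑ μ, k (γ, μ) * (u (α, μ) * fun x => (starRingEnd ℂ) (v (β, γ) x))

theorem ofReal_normalCurv {d : ℕ} (h : MetricField d) (lam : SecondForm d) (α β : Fin d) :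
    (fun x => (normalCurv h lam α β x : ℂ)) =
      fun x => ((curvForm (cInv h) (cForm lam) (cForm lam) α β x).im : ℂ) := by
  funext x
  simp only [normalCurv, curvForm, Finset.sum_apply, Pi.mul_apply, mul_assoc]

/-- The four indices regroup into the pairs `(α, μ)` and `(β, γ)`, each combination occurring once,
so the sum factors with no loss. -/
theorem sum_curvForm_le {d : ℕ} {Z : Rd d → ℝ} (hZ : Measurable Z)
    {k u v : Fin d × Fin d → Rd d → ℂ} {B : Fin d × Fin d → Fin d × Fin d → ℝ≥0∞}
    (h : ∀ r p q, multiplierNorm Z (k r * (u p * fun x => (starRingEnd ℂ) (v q x))) ≤ B p q) :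
    ∑ α, ∑ β, multiplierNorm Z (curvForm k u v α β) ≤ ∑ p, ∑ q, B p q := by
  have h1 : ∀ α β, multiplierNorm Z (curvForm k u v α β) ≤ ∑ γ, ∑ μ, B (α, μ) (β, γ) :=
    fun α β => (multiplierNorm_sum_le hZ _ _).trans (Finset.sum_le_sum fun γ _ =>
      (multiplierNorm_sum_le hZ _ _).trans (Finset.sum_le_sum fun μ _ => h _ _ _))
  refine (Finset.sum_le_sum fun α _ => Finset.sum_le_sum fun β _ => h1 α β).trans (le_of_eq ?_)
  rw [Fintype.sum_prod_type]
  simp_rw [Fintype.sum_prod_type]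
  refine Finset.sum_congr rfl fun α _ => ?_
  exact (Finset.sum_congr rfl fun β _ => Finset.sum_comm).trans Finset.sum_comm

theorem sum_sum_mul {ι κ : Type*} [Fintype ι] [Fintype κ] (c : ℝ≥0∞) (a : ι → ℝ≥0∞) (b : κ → ℝ≥0∞) :
    ∑ p, ∑ q, c * (a p * b q) = c * ((∑ p, a p) * ∑ q, b q) := by
  simp_rw [← Finset.mul_sum, ← Finset.sum_mul]

/-! ### Existence, uniqueness and bounds -/

theorem pd_re {d : ℕ} {u : Rd d → ℂ} (hu : Differentiable ℝ u) (α : Fin d) (x : Rd d) :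
    pd α (fun y => (u y).re) x = (pdC α u x).re := by
  have h : HasFDerivAt (fun y => (u y).re) (Complex.reCLM.comp (fderiv ℝ u x)) x :=
    Complex.reCLM.hasFDerivAt.comp x (hu x).hasFDerivAt
  unfold pd pdC
  rw [h.fderiv]; rfl

section Solve
variable {d : ℕ} {s δ : ℝ} {Z Y : Rd d → ℝ} {h : MetricField d} {lam : SecondForm d}

theorem Params.conn_fl1 (P : Params d s δ) {A : Fin d → Rd d → ℂ}
    (hA : sumNorm (wt (deltaD d δ) (s + 1)) A ≠ ⊤) (i : Fin d) : FL1 (A i) :=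
  P.fl1_of_ne_top (by have := P.one_sub_deltaD_le; have := P.deltaD_lt; linarith) le_rfl
    (ne_top_of_sumNorm hA i)

theorem SmallMetric.sum_curv_le (hh : SmallMetric s δ h) (P : Params d s δ)
    (hW : AdmWeight d s δ Z Y) {u v : Fin d × Fin d → Rd d → ℂ} (hu : ∀ p, FL (u p))
    (hv : ∀ p, FL (v p)) {B : Fin d × Fin d → Fin d × Fin d → ℝ≥0∞}
    (hB : ∀ p q, multiplierNorm Z (u p * fun x => (starRingEnd ℂ) (v q x)) ≤ B p q) :
    ∑ α, ∑ β, multiplierNorm Z (curvForm (cInv h) u v α β) ≤ 2 * ∑ p, ∑ q, B p q := by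
  simp_rw [Finset.mul_sum]
  exact sum_curvForm_le hW.measZ fun r p q => (hh.inv_mul_le P hW.measZ r
    fun w hw => hW.norm_mul_le P hw ((hu p).mul (hv q).conj)).trans (mul_le_mul_right (hB p q) _)

/-- The source of the curl equation. -/
noncomputable abbrev cCurv (h : MetricField d) (lam : SecondForm d) (α β : Fin d) : Rd d → ℂ :=
  fun x => (normalCurv h lam α β x : ℂ)

theorem AdmWeight.sum_cCurv_le (hW : AdmWeight d s δ Z Y) :
    ∑ α, ∑ β, multiplierNorm Z (cCurv h lam α β) ≤
      ∑ α, ∑ β, multiplierNorm Z (curvForm (cInv h) (cForm lam) (cForm lam) α β) :=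
  Finset.sum_le_sum fun α _ => Finset.sum_le_sum fun β _ => by
    rw [show cCurv h lam α β = _ from ofReal_normalCurv h lam α β]
    exact multiplierNorm_im hW.measZ hW.evenZ _

theorem SmallMetric.sum_cCurv_le (hh : SmallMetric s δ h) (P : Params d s δ)
    (hl : sumNorm (wt 0 s) (cForm lam) ≠ ⊤) :
    ∑ α, ∑ β, multiplierNorm (wt (deltaD d δ - 1) s) (cCurv h lam α β) ≤
      2 * (prodConst d s δ * (sumNorm (wt 0 s) (cForm lam) * sumNorm (wt 0 s) (cForm lam))) := by
  have hW := P.admWeight (σ := s) (by have := P.lt_s; linarith) le_rfl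
  have hm : Measurable (wt 0 s : Rd d → ℝ) := measurable_sobolevSymbol _ _
  refine hW.sum_cCurv_le.trans ((hh.sum_curv_le P hW (fl_of_sumNorm hl) (fl_of_sumNorm hl)
    (B := fun p q => prodConst d s δ * (multiplierNorm (wt 0 s) (cForm lam p) *
      multiplierNorm (wt 0 s) (cForm lam q))) fun p q => ?_).trans (le_of_eq ?_))
  · refine (P.norm_form_mul_form (by have := P.lt_s; linarith) le_rfl (fl_of_sumNorm hl p)
      (fl_of_sumNorm hl q).conj).trans (mul_le_mul_right (mul_le_mul_right ?_ _) _)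
    exact multiplierNorm_conj hm (sobolevSymbol_neg _ _) _
  · rw [sum_sum_mul]; rfl

/-- The factor `8` is two for the inverse metric, two from the product estimate, and two because the
terms with the weight on either copy of `λ` have equal sums. -/
theorem SmallMetric.sum_cCurv_env_le (hh : SmallMetric s δ h) (P : Params d s δ) {c : ℝ}
    (hc : 0 < c) (hl : sumNorm (wt 0 s) (cForm lam) ≠ ⊤) :
    ∑ α, ∑ β, multiplierNorm (fun η => envWt δ c η * wt (deltaD d δ - 1) s η) (cCurv h lam α β) ≤
      8 * (prodConst d s δ * (sumNorm (wt 0 s) (cForm lam) *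
        sumNorm (fun η => envWt δ c η * wt 0 s η) (cForm lam))) := by
  have hW := P.admWeight_env hc
  have hm : Measurable (wt 0 s : Rd d → ℝ) := measurable_sobolevSymbol _ _
  have hm' : Measurable (fun η : Rd d => envWt δ c η * wt 0 s η) := (measurable_envWt _ _).mul hm
  have he : ∀ η : Rd d, envWt δ c (-η) * wt 0 s (-η) = envWt δ c η * wt 0 s η := fun η => by
    simp only [envWt_neg, wt, sobolevSymbol_neg]
  refine hW.sum_cCurv_le.trans ((hh.sum_curv_le P hW (fl_of_sumNorm hl) (fl_of_sumNorm hl)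
    (B := fun p q => 2 * prodConst d s δ * (multiplierNorm (wt 0 s) (cForm lam p) *
      multiplierNorm (fun η => envWt δ c η * wt 0 s η) (cForm lam q)) + 2 * prodConst d s δ *
      (multiplierNorm (fun η => envWt δ c η * wt 0 s η) (cForm lam p) *
      multiplierNorm (wt 0 s) (cForm lam q))) fun p q => ?_).trans (le_of_eq ?_))
  · refine (P.norm_form_mul_form_env hc (fl_of_sumNorm hl p) (fl_of_sumNorm hl q).conj).trans ?_
    rw [mul_add]
    exact add_le_add (mul_le_mul_right (mul_le_mul_right (multiplierNorm_conj hm' he _) _) _)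
      (mul_le_mul_right (mul_le_mul_right (multiplierNorm_conj hm (sobolevSymbol_neg _ _) _) _) _)
  · simp_rw [Finset.sum_add_distrib, sum_sum_mul]
    unfold sumNorm
    ring

/-- The complex form of the div-curl system. -/
theorem SolvesDivCurl.complex {A : Connection d} (hA : SolvesDivCurl h lam A)
    (hs : ∀ x, (h x).IsSymm) (hh : IsHarmonicGauge h) (h1 : ∀ i, FL1 (cConn A i)) :
    ∑ α, pdC α (cConn A α) = 0 - contractGrad (invDev h) (cConn A) ∧
      ∀ α β, pdC α (cConn A β) - pdC β (cConn A α) = cCurv h lam α β := by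
  constructor
  · funext x
    have := ofReal_covDiv hh h1 x
    rw [hA.coulomb x, Complex.ofReal_zero] at this
    rw [Pi.sub_apply, Pi.zero_apply, zero_sub]
    exact eq_neg_of_add_eq_zero_left this.symm
  · intro α β
    funext x
    rw [Pi.sub_apply, pdC_cConn h1, pdC_cConn h1, cCurv, ← hA.curl, covCurl_eq hs]
    push_cast; rfl

theorem SmallMetric.solution_le (hh : SmallMetric s δ h) (P : Params d s δ)
    (hW : AdmWeight d s δ Z Y) {A : Connection d} (hA : SolvesDivCurl h lam A)
    (hs : ∀ x, (h x).IsSymm) (hg : IsHarmonicGauge h)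
    (hfin : sumNorm (wt (deltaD d δ) (s + 1)) (cConn A) ≠ ⊤) :
    sumNorm Y (cConn A) ≤ 2 * ∑ α, ∑ β, multiplierNorm Z (cCurv h lam α β) := by
  have h1 := P.conn_fl1 hfin
  obtain ⟨e1, e2⟩ := hA.complex hs hg h1
  have := hW.apriori P (hh.dev_fl P) h1 (ne_top_of_le_ne_top hfin (Finset.sum_le_sum fun i _ =>
    hW.le_conn P.two_le _)) (hh.dev_small P) e1
  simpa [e2, multiplierNorm_zero] using this

/-- The difference of two solutions is curl free and satisfies the homogeneous divergence equation,
so the a priori estimate has right side zero. -/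
theorem SmallMetric.solution_unique (hh : SmallMetric s δ h) (P : Params d s δ)
    {A A' : Connection d} (hA : SolvesDivCurl h lam A) (hA' : SolvesDivCurl h lam A')
    (hs : ∀ x, (h x).IsSymm) (hg : IsHarmonicGauge h)
    (hfin : sumNorm (wt (deltaD d δ) (s + 1)) (cConn A) ≠ ⊤)
    (hfin' : sumNorm (wt (deltaD d δ) (s + 1)) (cConn A') ≠ ⊤) : A = A' := by
  have hW := P.admWeight (σ := s) (by have := P.lt_s; linarith) le_rfl
  have h1 := P.conn_fl1 hfin
  have h1' := P.conn_fl1 hfin'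
  obtain ⟨e1, e2⟩ := hA.complex hs hg h1
  obtain ⟨e1', e2'⟩ := hA'.complex hs hg h1'
  have hD : sumNorm (wt (deltaD d δ) (s + 1)) (cConn A - cConn A') ≠ ⊤ :=
    ne_top_of_le_ne_top (ENNReal.add_ne_top.2 ⟨hfin, hfin'⟩) (sumNorm_sub_le hW.measY _ _)
  have hpd : ∀ α β, pdC α ((cConn A - cConn A') β) = pdC α (cConn A β) - pdC α (cConn A' β) :=
    fun α β => pdC_sub (h1 β).differentiable (h1' β).differentiable α
  have key := hW.apriori P (hh.dev_fl P) (P.conn_fl1 hD) hD (hh.dev_small P) (G := 0) (by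
    simp_rw [hpd, Finset.sum_sub_distrib, contractGrad_sub _ h1 h1', e1, e1']
    abel)
  have hz : ∀ α β, pdC α ((cConn A - cConn A') β) - pdC β ((cConn A - cConn A') α) = 0 := by
    intro α β
    rw [hpd, hpd, sub_sub_sub_comm, e2, e2', sub_self]
  simp only [hz, multiplierNorm_zero, Finset.sum_const_zero, mul_zero, add_zero] at key
  funext x i
  have h0 := eq_zero_of_multiplierNorm_eq_zero P.two_le hW.measY (fun η hη => (wt_pos _ _ hη).ne')
    (le_antisymm ((le_sumNorm _ i).trans key) zero_le)
  have := congrFun h0 x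
  rw [Pi.sub_apply, Pi.sub_apply, Pi.zero_apply, sub_eq_zero] at this
  exact_mod_cast this

/-- Contraction on the map sending `A` to a flat solution with curl `F` and divergence `-(g⁻¹ - I)
∂A`. The differences of images are curl free, so only the small divergence term enters their
estimate. -/
theorem SmallMetric.exists_solution (hh : SmallMetric s δ h) (P : Params d s δ)
    (hs : ∀ x, (h x).IsSymm) (hg : IsHarmonicGauge h) (hr : IsWeaklyClosed (normalCurv h lam))
    (hl : sumNorm (wt 0 s) (cForm lam) ≠ ⊤) :
    ∃ A : Connection d, SolvesDivCurl h lam A ∧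
      sumNorm (wt (deltaD d δ) (s + 1)) (cConn A) ≠ ⊤ := by
  have hW := P.admWeight (σ := s) (by have := P.lt_s; linarith) le_rfl
  -- By symmetry of the inverse metric, exchanging `α` and `β` conjugates the contraction and thus
  -- reverses the sign of its imaginary part.
  have hanti : ∀ α β x, normalCurv h lam α β x = -normalCurv h lam β α x := by
    intro α β x
    unfold normalCurv
    rw [← Complex.conj_im, map_sum, Finset.sum_comm]
    simp_rw [map_sum, map_mul, Complex.conj_ofReal, Complex.conj_conj]
    congr 1
    refine Finset.sum_congr rfl fun γ _ => Finset.sum_congr rfl fun μ _ => ?_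
    have hsy : (ginv h x).IsSymm := by
      have : (1 + h x).IsSymm := Matrix.isSymm_one.add (hs x)
      rw [Matrix.IsSymm, ginv, Matrix.transpose_nonsing_inv, this]
    rw [hsy.apply μ γ]
    ring
  have hF : ∀ α β, multiplierNorm (wt (deltaD d δ - 1) s) (cCurv h lam α β) ≠ ⊤ := by
    have h1 : ∑ α, ∑ β, multiplierNorm (wt (deltaD d δ - 1) s) (cCurv h lam α β) ≠ ⊤ :=
      ne_top_of_le_ne_top (by
        have := P.prodConst_ne_top
        finiteness) (hh.sum_cCurv_le P hl)
    intro α β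
    exact ENNReal.sum_ne_top.1 (ENNReal.sum_ne_top.1 h1 α (Finset.mem_univ _)) β (Finset.mem_univ _)
  have hG : ∀ A : Fin d → Rd d → ℂ, sumNorm (wt (deltaD d δ) (s + 1)) A ≠ ⊤ →
      multiplierNorm (wt (deltaD d δ - 1) s) (-contractGrad (invDev h) A) ≠ ⊤ := fun A hA => by
    rw [multiplierNorm_neg]
    refine ne_top_of_le_ne_top ?_ (hW.contractGrad_le P (hh.dev_fl P) (P.conn_fl1 hA))
    have := P.prodConst_ne_top
    have := hh.dev_ne_top P
    finiteness
  choose! T hT1 hT2 hT3 using fun (A : Fin d → Rd d → ℂ)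
    (hA : sumNorm (wt (deltaD d δ) (s + 1)) A ≠ ⊤) => P.exists_flat_solution hr hanti hF (hG A hA)
  have hTfin : ∀ u, sumNorm (wt (deltaD d δ) (s + 1)) u ≠ ⊤ →
      sumNorm (wt (deltaD d δ) (s + 1)) (T u) ≠ ⊤ := fun u hu => sumNorm_ne_top (hT1 u hu)
  obtain ⟨A, hA, hfix⟩ := P.exists_fixedPoint (a := deltaD d δ) (b := s + 1)
    (by have := P.one_sub_deltaD_le; have := P.deltaD_lt; linarith) (by linarith) T hTfin
    (fun u v hu hv => by
      have fu := P.conn_fl1 (hTfin u hu)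
      have fv := P.conn_fl1 (hTfin v hv)
      have huv : sumNorm (wt (deltaD d δ) (s + 1)) (u - v) ≠ ⊤ :=
        ne_top_of_le_ne_top (ENNReal.add_ne_top.2 ⟨hu, hv⟩) (sumNorm_sub_le hW.measY _ _)
      have hTuv : sumNorm (wt (deltaD d δ) (s + 1)) (T u - T v) ≠ ⊤ :=
        ne_top_of_le_ne_top (ENNReal.add_ne_top.2 ⟨hTfin u hu, hTfin v hv⟩)
          (sumNorm_sub_le hW.measY _ _)
      have hpd : ∀ α β, pdC α ((T u - T v) β) = pdC α (T u β) - pdC α (T v β) :=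
        fun α β => pdC_sub (fu β).differentiable (fv β).differentiable α
      have hdiv : ∑ α, pdC α ((T u - T v) α) = -contractGrad (invDev h) (u - v) := by
        simp_rw [hpd, Finset.sum_sub_distrib, hT2 u hu, hT2 v hv,
          contractGrad_sub _ (P.conn_fl1 hu) (P.conn_fl1 hv)]
        abel
      have hz : ∀ α β, pdC α ((T u - T v) β) - pdC β ((T u - T v) α) = 0 := fun α β => by
        rw [hpd, hpd, sub_sub_sub_comm, hT3 u hu, hT3 v hv, sub_self]
      have h1 : ∀ β, multiplierNorm (wt (deltaD d δ) (s + 1)) ((T u - T v) β) ≤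
          prodConst d s δ * sumNorm (wt (lowExp d δ) (s + 1)) (invDev h) *
            sumNorm (wt (deltaD d δ) (s + 1)) (u - v) := fun β => by
        refine (norm_le_div_curl P.two_le hW.measZ hW.mul_norm (P.conn_fl1 hTuv) β).trans ?_
        simp only [hz, multiplierNorm_zero, Finset.sum_const_zero, zero_add, hdiv,
          multiplierNorm_neg]
        exact hW.contractGrad_le P (hh.dev_fl P) (P.conn_fl1 huv)
      refine (Finset.sum_le_sum fun β _ => h1 β).trans ?_
      rw [Finset.sum_const, Finset.card_univ, Fintype.card_fin, nsmul_eq_mul, ← mul_assoc]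
      exact mul_le_mul_left (hh.dev_small P) _)
  have fA := P.conn_fl1 hA
  have hdiv := hT2 A hA
  have hcurl := hT3 A hA
  rw [hfix] at hdiv hcurl
  refine ⟨fun x i => (A i x).re, ⟨fun x => ?_, fun α β x => ?_⟩,
    sumNorm_ne_top fun i => ne_top_of_le_ne_top (ne_top_of_sumNorm hA i)
      (multiplierNorm_re hW.measY hW.evenY (A i))⟩
  · rw [covDiv_eq hg]
    have h1 := sum_cInv_mul h (fun α β => pdC α (A β) x) x
    have h2 : ∑ α, pdC α (A α) x + ∑ p, invDev h p x * pdC p.1 (A p.2) x = 0 := by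
      have := congrFun hdiv x
      simp only [Finset.sum_apply, Pi.neg_apply, contractGrad, Pi.mul_apply] at this
      rw [this]; ring
    rw [h2] at h1
    have h3 := congrArg Complex.re h1
    simp only [Complex.re_sum, Complex.re_ofReal_mul, Complex.zero_re] at h3
    rw [← h3]
    simp_rw [pd_re (fA _).differentiable]
  · rw [covCurl_eq hs, pd_re (fA _).differentiable, pd_re (fA _).differentiable, ← Complex.sub_re]
    have := congrFun (hcurl α β) x
    rw [Pi.sub_apply] at this
    rw [this, Complex.ofReal_re]

end Solve

/-! ### Littlewood-Paley pieces and envelope weights -/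

section LP
variable {d : ℕ} {φ : Rd d → ℝ}

theorem IsCutoff.measurable_lpSymbol (hφ : IsCutoff φ) (k : ℕ) : Measurable (lpSymbol φ k) := by
  have hc := hφ.smooth.continuous
  cases k with
  | zero => exact hc.measurable
  | succ k =>
    exact ((hc.comp (continuous_const_smul _)).sub (hc.comp (continuous_const_smul _))).measurable

theorem IsCutoff.abs_lpSymbol_le (hφ : IsCutoff φ) (k : ℕ) (η : Rd d) : |lpSymbol φ k η| ≤ 1 := by
  cases k with
  | zero =>
    have := hφ.range η
    exact abs_le.2 ⟨by simp only [lpSymbol]; linarith [this.1], this.2⟩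
  | succ k =>
    have h1 := hφ.range (((2 : ℝ) ^ (k + 1))⁻¹ • η)
    have h2 := hφ.range (((2 : ℝ) ^ k)⁻¹ • η)
    simp only [lpSymbol]
    exact abs_le.2 ⟨by linarith [h1.1, h2.2], by linarith [h1.2, h2.1]⟩

theorem IsCutoff.eq_one_of_le (hφ : IsCutoff φ) {k : ℕ} {η : Rd d} (h : ‖η‖ ≤ 2 ^ k) :
    φ (((2 : ℝ) ^ k)⁻¹ • η) = 1 := by
  apply hφ.eq_one
  rw [norm_smul, Real.norm_of_nonneg (by positivity), inv_mul_le_one₀ (by positivity)]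
  exact h

theorem IsCutoff.eq_zero_of_le (hφ : IsCutoff φ) {k : ℕ} {η : Rd d} (h : 2 * 2 ^ k ≤ ‖η‖) :
    φ (((2 : ℝ) ^ k)⁻¹ • η) = 0 := by
  apply hφ.eq_zero
  rw [norm_smul, Real.norm_of_nonneg (by positivity), ← div_eq_inv_mul, le_div_iff₀ (by positivity)]
  exact h

/-- On the support of the `k`th symbol the frequency is comparable to `2^k`. -/
theorem IsCutoff.support_lpSymbol (hφ : IsCutoff φ) {k : ℕ} {η : Rd d} (h : lpSymbol φ k η ≠ 0) :
    (2 ^ k) ^ 2 ≤ 16 * (1 + ‖η‖ ^ 2) ∧ 1 + ‖η‖ ^ 2 ≤ 16 * ((2 : ℝ) ^ k) ^ 2 := by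
  have hn := norm_nonneg η
  cases k with
  | zero =>
    have h1 : ‖η‖ < 2 := by
      by_contra hc
      exact h (hφ.eq_zero η (not_lt.1 hc))
    constructor <;> norm_num <;> nlinarith
  | succ k =>
    have h1 : 2 ^ k < ‖η‖ := by
      by_contra hc
      apply h
      have hc := not_lt.1 hc
      rw [lpSymbol, hφ.eq_one_of_le hc, hφ.eq_one_of_le (hc.trans (by gcongr <;> simp)), sub_self]
    have h2 : ‖η‖ < 2 * 2 ^ (k + 1) := by
      by_contra hc
      apply h
      have hc := not_lt.1 hc
      rw [lpSymbol, hφ.eq_zero_of_le hc, hφ.eq_zero_of_le (le_trans (by gcongr <;> simp) hc),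
        sub_self]
    have h3 : (1 : ℝ) ≤ 2 ^ k := one_le_pow₀ (by norm_num)
    rw [pow_succ' (2 : ℝ) k] at h2 ⊢
    constructor <;> nlinarith

/-- Some symbol of comparable frequency is at least one half. -/
theorem IsCutoff.exists_half_le (hφ : IsCutoff φ) (η : Rd d) :
    ∃ j, 1 / 2 ≤ |lpSymbol φ j η| := by
  by_cases h1 : ‖η‖ ≤ 1
  · exact ⟨0, by rw [lpSymbol, hφ.eq_one η h1]; norm_num⟩
  have hsum : ∀ n, ∑ j ∈ Finset.range (n + 1), lpSymbol φ j η = φ (((2 : ℝ) ^ n)⁻¹ • η) := by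
    intro n
    induction n with
    | zero => simp [lpSymbol]
    | succ n ih => rw [Finset.sum_range_succ, ih, lpSymbol]; ring
  obtain ⟨n, hn1, hn2⟩ : ∃ n : ℕ, (2 : ℝ) ^ n ≤ ‖η‖ ∧ ‖η‖ < 2 ^ (n + 1) :=
    exists_nat_pow_near (not_le.1 h1).le (by norm_num)
  have hone := hsum (n + 1)
  rw [hφ.eq_one_of_le hn2.le] at hone
  -- On a dyadic shell the telescoped sum leaves two consecutive symbols with sum one, so one of
  -- them is at least a half.
  have hpair : lpSymbol φ n η + lpSymbol φ (n + 1) η = 1 := by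
    cases n with
    | zero => simpa [Finset.sum_range_succ] using hone
    | succ n =>
      have h0 := hsum n
      rw [hφ.eq_zero_of_le (by rw [← pow_succ']; exact hn1)] at h0
      rw [Finset.sum_range_succ, Finset.sum_range_succ, h0] at hone
      linarith
  by_cases hc : 1 / 2 ≤ lpSymbol φ n η
  · exact ⟨n, hc.trans (le_abs_self _)⟩
  · exact ⟨n + 1, le_trans (by linarith) (le_abs_self _)⟩

theorem envWt_eq {δ c : ℝ} (hc : 0 < c) (η : Rd d) :
    envWt δ c η = min ((c ^ 2 * (1 + ‖η‖ ^ 2)) ^ δ) ((c ^ 2 * (1 + ‖η‖ ^ 2)) ^ (-δ)) := by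
  have h : ∀ τ : ℝ, c ^ (2 * τ) * wt 0 (2 * τ) η = (c ^ 2 * (1 + ‖η‖ ^ 2)) ^ τ := fun τ => by
    rw [wt, sobolevSymbol, Real.rpow_zero, one_mul, sub_zero, mul_div_cancel_left₀ _ two_ne_zero,
      Real.mul_rpow (by positivity) (by positivity), Real.rpow_mul hc.le]
    norm_num
  rw [envWt, h, ← mul_neg, h]

theorem sixteen_rpow_le {δ : ℝ} (h : δ < 1 / 4) : (16 : ℝ) ^ δ ≤ 2 := by
  calc (16 : ℝ) ^ δ ≤ 16 ^ (1 / 4 : ℝ) := Real.rpow_le_rpow_of_exponent_le (by norm_num) h.le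
    _ = 2 := by
      rw [show (16 : ℝ) = 2 ^ (4 : ℝ) by norm_num, ← Real.rpow_mul (by norm_num)]; norm_num

/-- On the support `(2^{-k}⟨η⟩)²` lies between `1/16` and `16`, and `16^δ ≤ 2` because `δ < 1/4`.
Thus the envelope weight dominates the Littlewood-Paley symbol up to a factor two. -/
theorem IsCutoff.half_le_envWt (hφ : IsCutoff φ) {δ : ℝ} (h0 : 0 < δ) (h4 : δ < 1 / 4) {k : ℕ}
    {η : Rd d} (h : lpSymbol φ k η ≠ 0) : 1 / 2 ≤ envWt δ ((2 : ℝ) ^ k)⁻¹ η := by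
  obtain ⟨h1, h2⟩ := hφ.support_lpSymbol h
  rw [envWt_eq (by positivity)]
  have h3 : (16 : ℝ)⁻¹ ≤ ((2 : ℝ) ^ k)⁻¹ ^ 2 * (1 + ‖η‖ ^ 2) := by
    rw [inv_pow, ← div_eq_inv_mul, le_div_iff₀ (by positivity)]; linarith
  have h4' : ((2 : ℝ) ^ k)⁻¹ ^ 2 * (1 + ‖η‖ ^ 2) ≤ 16 := by
    rw [inv_pow, ← div_eq_inv_mul, div_le_iff₀ (by positivity)]; linarith
  have h5 : (1 / 2 : ℝ) ≤ (16 : ℝ)⁻¹ ^ δ := by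
    rw [Real.inv_rpow (by norm_num), one_div]
    exact inv_anti₀ (by positivity) (sixteen_rpow_le h4)
  refine le_min (h5.trans (Real.rpow_le_rpow (by norm_num) h3 h0.le)) ?_
  rw [Real.rpow_neg (by positivity), one_div]
  exact inv_anti₀ (by positivity) ((Real.rpow_le_rpow (by positivity) h4' h0.le).trans
    (sixteen_rpow_le h4))

/-- Converse comparison: `j` is a scale whose symbol is at least a half at `η`, so `⟨η⟩` is
comparable to `2^j` and the envelope weight is about `2^{-2δ|j-k|}`. The constant is `16^δ ≤ 2`
times two for the lower bound on the symbol. -/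
theorem IsCutoff.envWt_le (hφ : IsCutoff φ) {δ : ℝ} (h0 : 0 < δ) (h4 : δ < 1 / 4) (k : ℕ)
    (η : Rd d) : ∃ j : ℕ, envWt δ ((2 : ℝ) ^ k)⁻¹ η ≤
      4 * 2 ^ (-(2 * δ * |(j : ℝ) - k|)) * |lpSymbol φ j η| := by
  obtain ⟨j, hj⟩ := hφ.exists_half_le η
  refine ⟨j, ?_⟩
  have hne : lpSymbol φ j η ≠ 0 := fun h => by rw [h] at hj; norm_num at hj
  obtain ⟨h1, h2⟩ := hφ.support_lpSymbol hne
  set τ : ℝ := (((2 : ℝ) ^ j)⁻¹) ^ 2 * (1 + ‖η‖ ^ 2) with hτ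
  have h3 : (16 : ℝ)⁻¹ ≤ τ := by
    rw [hτ, inv_pow, ← div_eq_inv_mul, le_div_iff₀ (by positivity)]; linarith
  have h4' : τ ≤ 16 := by
    rw [hτ, inv_pow, ← div_eq_inv_mul, div_le_iff₀ (by positivity)]; linarith
  have hτ0 : 0 < τ := lt_of_lt_of_le (by norm_num) h3
  have ht : ((2 : ℝ) ^ k)⁻¹ ^ 2 * (1 + ‖η‖ ^ 2) = 2 ^ (2 * ((j : ℝ) - k)) * τ := by
    have e : (2 : ℝ) ^ (2 * ((j : ℝ) - k)) = (2 ^ j) ^ 2 * ((2 ^ k)⁻¹) ^ 2 := by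
      rw [mul_comm, Real.rpow_mul (by norm_num), Real.rpow_sub (by norm_num), Real.rpow_natCast,
        Real.rpow_natCast]
      norm_num
      field_simp
    rw [e, hτ]
    have : (2 : ℝ) ^ j ≠ 0 := by positivity
    field_simp
  have hpow : ∀ r : ℝ, (2 ^ (2 * ((j : ℝ) - k)) * τ) ^ r = 2 ^ (2 * ((j : ℝ) - k) * r) * τ ^ r :=
    fun r => by rw [Real.mul_rpow (by positivity) hτ0.le, ← Real.rpow_mul (by norm_num)]
  have key : envWt δ ((2 : ℝ) ^ k)⁻¹ η ≤ 2 ^ (-(2 * δ * |(j : ℝ) - k|)) * 2 := by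
    rw [envWt_eq (by positivity), ht, hpow, hpow]
    rcases le_total (j : ℝ) k with hjk | hjk
    · refine (min_le_left _ _).trans ?_
      rw [abs_of_nonpos (by linarith)]
      refine mul_le_mul (le_of_eq (by ring_nf)) ?_ (by positivity) (by positivity)
      exact (Real.rpow_le_rpow hτ0.le h4' h0.le).trans (sixteen_rpow_le h4)
    · refine (min_le_right _ _).trans ?_
      rw [abs_of_nonneg (by linarith)]
      refine mul_le_mul (le_of_eq (by ring_nf)) ?_ (by positivity) (by positivity)
      rw [Real.rpow_neg hτ0.le, ← Real.inv_rpow hτ0.le]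
      refine (Real.rpow_le_rpow (by positivity) ?_ h0.le).trans (sixteen_rpow_le h4)
      rw [← inv_inv (16 : ℝ)]
      exact inv_anti₀ (by norm_num) h3
  refine key.trans ?_
  have : (0 : ℝ) < 2 ^ (-(2 * δ * |(j : ℝ) - k|)) := by positivity
  nlinarith

theorem tsum_rpow_ne_top {r : ℝ} (hr : 0 < r) :
    ∑' n : ℤ, ENNReal.ofReal (2 ^ (-(r * |(n : ℝ)|))) ≠ ⊤ := by
  have hs : Summable fun n : ℕ => (2 : ℝ) ^ (-(r * n)) := by
    have h1 : (2 : ℝ) ^ (-r) < 1 := Real.rpow_lt_one_of_one_lt_of_neg (by norm_num) (by linarith)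
    refine (summable_geometric_of_lt_one (by positivity) h1).congr fun n => ?_
    rw [← Real.rpow_natCast, ← Real.rpow_mul (by norm_num)]
    ring_nf
  have h2 : Summable fun n : ℤ => (2 : ℝ) ^ (-(r * |(n : ℝ)|)) := by
    refine Summable.of_nat_of_neg ?_ ?_ <;> simpa using hs
  exact h2.tsum_ofReal_ne_top

theorem multiplierNorm_lp_le (hd : 2 ≤ d) (hφ : IsCutoff φ) {δ : ℝ} (h0 : 0 < δ) (h4 : δ < 1 / 4)
    (k : ℕ) (a b : ℝ) (u : Rd d → ℂ) :
    multiplierNorm (fun η => lpSymbol φ k η * wt a b η) u ≤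
      2 * multiplierNorm (fun η => envWt δ ((2 : ℝ) ^ k)⁻¹ η * wt a b η) u := by
  have := multiplierNorm_mono hd (m := fun η => lpSymbol φ k η * wt a b η)
    (m' := fun η => envWt δ ((2 : ℝ) ^ k)⁻¹ η * wt a b η) (C := 2) two_pos (fun η _ => by
      have hpos := envWt_nonneg δ (c := ((2 : ℝ) ^ k)⁻¹) (by positivity) η
      rw [abs_mul, abs_mul, ← mul_assoc]
      refine mul_le_mul_of_nonneg_right ?_ (abs_nonneg _)
      rw [abs_of_nonneg hpos]
      by_cases h : lpSymbol φ k η = 0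
      · rw [h, abs_zero]; positivity
      · have := hφ.half_le_envWt h0 h4 h
        linarith [hφ.abs_lpSymbol_le k η]) u
  simpa using this

theorem l2_pow_two (f : Rd d → ℝ≥0∞) : l2 f ^ 2 = ∫⁻ ξ, f ξ ^ 2 := by
  have h := l2_sq f
  simp only [ENNReal.rpow_ofNat] at h
  exact h

/-- The envelope weight is controlled by the frequency envelope. -/
theorem multiplierNorm_env_le (hφ : IsCutoff φ) {δ s : ℝ} (h0 : 0 < δ) (h4 : δ < 1 / 4)
    {u : Rd d → ℂ} (hu : FL u) {p : ℕ → ℝ}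
    (hb : ∀ j, multiplierNorm (fun η => lpSymbol φ j η * sobolevSymbol 0 s η) u ≤ ENNReal.ofReal (p j))
    (hp : ∀ j, 0 ≤ p j) (hs : ∀ j k : ℕ, p j ≤ (2 : ℝ) ^ (δ * |(j : ℝ) - (k : ℝ)|) * p k) (k : ℕ) :
    multiplierNorm (fun η => envWt δ ((2 : ℝ) ^ k)⁻¹ η * wt 0 s η) u ^ 2 ≤
      16 * (∑' n : ℤ, ENNReal.ofReal (2 ^ (-(2 * δ * |(n : ℝ)|)))) * ENNReal.ofReal (p k) ^ 2 := by
  obtain ⟨w, hw, rfl⟩ := hu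
  have hwt : (wt 0 s : Rd d → ℝ) = sobolevSymbol 0 s := by rw [wt, sub_zero]
  simp_rw [hwt]
  simp_rw [multiplierNorm_fourierInv _ hw, eLpNorm_two_eq_l2] at hb ⊢
  rw [l2_pow_two]
  have hmeas : ∀ j, AEMeasurable (fun ξ : Rd d =>
      ‖((lpSymbol φ j ((2 * Real.pi) • ξ) * sobolevSymbol 0 s ((2 * Real.pi) • ξ) : ℝ) : ℂ) *
        w ξ‖ₑ ^ 2) volume := fun j =>
    (aestronglyMeasurable_multiplier ((hφ.measurable_lpSymbol j).mul
      (measurable_sobolevSymbol 0 s)) hw).enorm.pow_const 2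
  have hpt : ∀ ξ : Rd d, ‖((envWt δ ((2 : ℝ) ^ k)⁻¹ ((2 * Real.pi) • ξ) *
      sobolevSymbol 0 s ((2 * Real.pi) • ξ) : ℝ) : ℂ) * w ξ‖ₑ ^ 2 ≤
      ∑' j : ℕ, ENNReal.ofReal (16 * 2 ^ (-(4 * δ * |(j : ℝ) - k|))) *
        ‖((lpSymbol φ j ((2 * Real.pi) • ξ) * sobolevSymbol 0 s ((2 * Real.pi) • ξ) : ℝ) : ℂ) *
          w ξ‖ₑ ^ 2 := by
    intro ξ
    obtain ⟨j, hj⟩ := hφ.envWt_le h0 h4 k ((2 * Real.pi) • ξ)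
    refine le_trans ?_ (ENNReal.le_tsum j)
    have hpos := envWt_nonneg δ (c := ((2 : ℝ) ^ k)⁻¹) (by positivity) ((2 * Real.pi) • ξ)
    rw [← ofReal_norm, ← ofReal_norm, ← ENNReal.ofReal_pow (norm_nonneg _),
      ← ENNReal.ofReal_pow (norm_nonneg _), ← ENNReal.ofReal_mul (by positivity)]
    apply ENNReal.ofReal_le_ofReal
    simp only [norm_mul, Complex.norm_real, Real.norm_eq_abs, Complex.ofReal_mul]
    rw [abs_of_nonneg hpos]
    have e : (16 : ℝ) * 2 ^ (-(4 * δ * |(j : ℝ) - k|)) = (4 * 2 ^ (-(2 * δ * |(j : ℝ) - k|))) ^ 2 := by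
      rw [mul_pow, ← Real.rpow_natCast (2 ^ _) 2, ← Real.rpow_mul (by norm_num)]
      congr 1
      · norm_num
      · congr 1; push_cast; ring
    rw [e, ← mul_pow, ← mul_assoc, ← mul_assoc]
    gcongr
  refine (lintegral_mono hpt).trans ?_
  rw [lintegral_tsum fun j => (hmeas j).const_mul _]
  have hj : ∀ j : ℕ, ∫⁻ ξ : Rd d, ENNReal.ofReal (16 * 2 ^ (-(4 * δ * |(j : ℝ) - k|))) *
        ‖((lpSymbol φ j ((2 * Real.pi) • ξ) * sobolevSymbol 0 s ((2 * Real.pi) • ξ) : ℝ) : ℂ) *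
          w ξ‖ₑ ^ 2 ≤ 16 * ENNReal.ofReal (2 ^ (-(2 * δ * |(j : ℝ) - k|))) *
          ENNReal.ofReal (p k) ^ 2 := by
    intro j
    rw [lintegral_const_mul'' _ (hmeas j)]
    have h1 := pow_le_pow_left' (hb j) 2
    rw [l2_pow_two] at h1
    refine (mul_le_mul_right h1 _).trans ?_
    rw [← ENNReal.ofReal_pow (hp j), ← ENNReal.ofReal_pow (hp k), ← ENNReal.ofReal_mul (by positivity),
      show (16 : ℝ≥0∞) = ENNReal.ofReal 16 by norm_num, ← ENNReal.ofReal_mul (by norm_num),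
      ← ENNReal.ofReal_mul (by positivity)]
    apply ENNReal.ofReal_le_ofReal
    have h2 := pow_le_pow_left₀ (hp j) (hs j k) 2
    -- The squared weight decays with exponent `4δ`, the squared envelope grows at most with `2δ`;
    -- the surplus `2δ` makes the sum over `j` converge.
    calc 16 * (2 : ℝ) ^ (-(4 * δ * |(j : ℝ) - k|)) * p j ^ 2
        ≤ 16 * (2 : ℝ) ^ (-(4 * δ * |(j : ℝ) - k|)) *
          ((2 : ℝ) ^ (δ * |(j : ℝ) - (k : ℝ)|) * p k) ^ 2 := by gcongr
      _ = 16 * ((2 : ℝ) ^ (-(4 * δ * |(j : ℝ) - k|)) *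
          (2 : ℝ) ^ (δ * |(j : ℝ) - (k : ℝ)| * 2)) * p k ^ 2 := by
            rw [mul_pow, ← Real.rpow_natCast (2 ^ _) 2, ← Real.rpow_mul (by norm_num)]
            push_cast; ring
      _ = _ := by rw [← Real.rpow_add (by norm_num)]; ring_nf
  refine (ENNReal.tsum_le_tsum hj).trans ?_
  simp_rw [ENNReal.tsum_mul_right, ENNReal.tsum_mul_left]
  refine mul_le_mul_left (mul_le_mul_right ?_ _) _
  have := ENNReal.tsum_comp_le_tsum_of_injective (f := fun j : ℕ => (j : ℤ) - k)
    (fun a b hab => by simpa using hab)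
    (fun n : ℤ => ENNReal.ofReal (2 ^ (-(2 * δ * |(n : ℝ)|))))
  simpa using this

end LP

/-! ### Small data -/

/-- Passage from an extended constant to a real one; adding one keeps it positive even when `K = 0`.
-/
theorem ENNReal.le_ofReal_of_le_mul {x K y : ℝ≥0∞} {r : ℝ} (hK : K ≠ ⊤)
    (h : x ≤ K * (ENNReal.ofReal r * y)) : x ≤ ENNReal.ofReal ((K.toReal + 1) * r) * y := by
  refine h.trans ?_
  rw [← mul_assoc, ENNReal.ofReal_mul (by positivity)]
  refine mul_le_mul_left (mul_le_mul_left ?_ _) _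
  rw [ENNReal.le_ofReal_iff_toReal_le hK (by positivity)]
  linarith

section Data
variable {d : ℕ} {s δ : ℝ} {h : MetricField d} {lam : SecondForm d}

theorem sumNorm_cMetric_le (r : ℝ) (h : MetricField d) :
    sumNorm (wt (lowExp d δ) r) (cMetric h) ≤ (d * d : ℕ) * metricNorm δ r h := by
  have := sumNorm_le_tensorNorm (m := wt (lowExp d δ) r) (cMetric h)
  rwa [Fintype.card_prod, Fintype.card_fin] at this

theorem sumNorm_cForm_le (r : ℝ) (lam : SecondForm d) :
    sumNorm (wt 0 r) (cForm lam) ≤ (d * d : ℕ) * formNorm r lam := by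
  have := sumNorm_le_tensorNorm (m := wt 0 r) (cForm lam)
  rwa [Fintype.card_prod, Fintype.card_fin, ← formNorm_eq] at this

theorem sumNorm_cConn_le (r : ℝ) (A : Connection d) :
    sumNorm (wt (deltaD d δ) r) (cConn A) ≤ d * connNorm δ r A := by
  have := sumNorm_le_tensorNorm (m := wt (deltaD d δ) r) (cConn A)
  rwa [Fintype.card_fin] at this

theorem Params.exists_small (P : Params d s δ) : ∃ ε : ℝ, 0 < ε ∧ ε ≤ 1 ∧
    ∀ h : MetricField d, metricNorm δ (s + 1) h ≤ ENNReal.ofReal ε → SmallMetric s δ h := by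
  -- `K` adds the constants of the two requirements of `SmallMetric`, so the choice `ε = 1/(K+1)`
  -- meets both and is at most one.
  set K : ℝ≥0∞ := 4 * (d : ℝ≥0∞) * (prodConst d s δ * (d * d : ℕ)) + (d * d : ℕ) with hK
  have hKt : K ≠ ⊤ := by
    have := P.prodConst_ne_top
    have h1 : ((d * d : ℕ) : ℝ≥0∞) ≠ ⊤ := ENNReal.natCast_ne_top _
    have h2 : (d : ℝ≥0∞) ≠ ⊤ := ENNReal.natCast_ne_top _
    exact ENNReal.add_ne_top.2 ⟨ENNReal.mul_ne_top (ENNReal.mul_ne_top (by norm_num) h2)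
      (ENNReal.mul_ne_top this h1), h1⟩
  have hKr : 0 ≤ K.toReal := ENNReal.toReal_nonneg
  refine ⟨(K.toReal + 1)⁻¹, by positivity, inv_le_one_of_one_le₀ (by linarith), fun h hh => ?_⟩
  have h1 : K * ENNReal.ofReal (K.toReal + 1)⁻¹ ≤ 1 := by
    rw [← ENNReal.ofReal_toReal hKt, ← ENNReal.ofReal_mul hKr, ENNReal.toReal_ofReal hKr,
      ENNReal.ofReal_le_one, ← div_eq_mul_inv, div_le_one (by positivity)]
    linarith
  have h2 : sumNorm (wt (lowExp d δ) (s + 1)) (cMetric h) ≤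
      (d * d : ℕ) * ENNReal.ofReal (K.toReal + 1)⁻¹ :=
    (sumNorm_cMetric_le _ _).trans (mul_le_mul_right hh _)
  refine ⟨le_trans ?_ h1, h2.trans (le_trans ?_ h1)⟩
  · refine (mul_le_mul_right (mul_le_mul_right h2 _) _).trans ?_
    rw [← mul_assoc (prodConst d s δ), ← mul_assoc]
    exact mul_le_mul_left (by rw [hK]; exact le_self_add) _
  · exact mul_le_mul_left (by rw [hK]; exact le_add_self) _

theorem IsSmallData.mono {ε ε' : ℝ} (hd : IsSmallData s δ ε h lam) (hε : ε ≤ ε') :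
    IsSmallData s δ ε' h lam :=
  ⟨hd.symm, hd.harmonic, hd.ricci, hd.lam_small.trans (ENNReal.ofReal_le_ofReal hε),
    hd.h_small.trans (ENNReal.ofReal_le_ofReal hε)⟩

theorem sumNorm_cForm_ne_top {r : ℝ} (hl : formNorm r lam ≠ ⊤) : sumNorm (wt 0 r) (cForm lam) ≠ ⊤ :=
  ne_top_of_le_ne_top (ENNReal.mul_ne_top (ENNReal.natCast_ne_top _) hl) (sumNorm_cForm_le r lam)

theorem sumNorm_cConn_ne_top {r : ℝ} {A : Connection d} (hl : connNorm δ r A ≠ ⊤) :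
    sumNorm (wt (deltaD d δ) r) (cConn A) ≠ ⊤ :=
  ne_top_of_le_ne_top (ENNReal.mul_ne_top (ENNReal.natCast_ne_top _) hl) (sumNorm_cConn_le r A)

theorem sumNorm_cMetric_ne_top {r : ℝ} (hl : metricNorm δ r h ≠ ⊤) :
    sumNorm (wt (lowExp d δ) r) (cMetric h) ≠ ⊤ :=
  ne_top_of_le_ne_top (ENNReal.mul_ne_top (ENNReal.natCast_ne_top _) hl) (sumNorm_cMetric_le r h)

theorem connNorm_ne_top {r : ℝ} {A : Connection d}
    (hl : sumNorm (wt (deltaD d δ) r) (cConn A) ≠ ⊤) : connNorm δ r A ≠ ⊤ :=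
  ne_top_of_le_ne_top hl (tensorNorm_le_sumNorm _)

/-- The constant in the quadratic bound for the solution. -/
noncomputable def solConst (d : ℕ) (s δ : ℝ) : ℝ≥0∞ :=
  4 * prodConst d s δ * ((d * d : ℕ) * (d * d : ℕ))

theorem Params.solConst_ne_top (P : Params d s δ) : solConst d s δ ≠ ⊤ :=
  ENNReal.mul_ne_top (ENNReal.mul_ne_top (by norm_num) P.prodConst_ne_top)
    (ENNReal.mul_ne_top (ENNReal.natCast_ne_top _) (ENNReal.natCast_ne_top _))

/-- Quadratic bound for the solution of the div-curl system. -/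
theorem SmallMetric.solution_bound (hh : SmallMetric s δ h) (P : Params d s δ) {ε : ℝ}
    (hd : IsSmallData s δ ε h lam) {A : Connection d} (hA : IsSolution s δ h lam A) :
    sumNorm (wt (deltaD d δ) (s + 1)) (cConn A) ≤
      solConst d s δ * (ENNReal.ofReal ε * formNorm s lam) := by
  have hl : formNorm s lam ≠ ⊤ := ne_top_of_le_ne_top ENNReal.ofReal_ne_top hd.lam_small
  have hl' := sumNorm_cForm_ne_top hl
  have hW := P.admWeight (σ := s) (by have := P.lt_s; linarith) le_rfl
  refine (hh.solution_le P hW hA.1 hd.symm hd.harmonic (sumNorm_cConn_ne_top hA.2.ne)).trans ?_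
  refine (mul_le_mul_right (hh.sum_cCurv_le P hl') _).trans ?_
  have h1 := sumNorm_cForm_le s lam
  calc _ ≤ 2 * (2 * (prodConst d s δ * (((d * d : ℕ) * ENNReal.ofReal ε) *
        ((d * d : ℕ) * formNorm s lam)))) := by
          gcongr
          exact h1.trans (mul_le_mul_right hd.lam_small _)
    _ = _ := by rw [solConst]; ring

/-- The elliptic estimate is used with the envelope weight centred at `2^k` in place of `S_k`, since
a sharp localization does not commute with products. One copy of `λ` contributes `ε`, the other the
envelope. -/
theorem SmallMetric.solution_env_bound (hh : SmallMetric s δ h) (P : Params d s δ) {φ : Rd d → ℝ}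
    (hφ : IsCutoff φ) {ε K : ℝ} (hd : IsSmallData s δ ε h lam) {A : Connection d}
    (hA : IsSolution s δ h lam A) {p : ℕ → ℝ} (hp : IsEnvelope φ s δ K lam p) (k : ℕ) :
    connNormLP φ k δ (s + 1) A ≤ 8 * solConst d s δ *
      (16 * (∑' n : ℤ, ENNReal.ofReal (2 ^ (-(2 * δ * |(n : ℝ)|)))) + 1) *
        (ENNReal.ofReal ε * ENNReal.ofReal (p k)) := by
  have hl : formNorm s lam ≠ ⊤ := ne_top_of_le_ne_top ENNReal.ofReal_ne_top hd.lam_small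
  have hl' := sumNorm_cForm_ne_top hl
  set c : ℝ := ((2 : ℝ) ^ k)⁻¹ with hc
  have hc0 : 0 < c := by positivity
  set M : ℝ≥0∞ := 16 * (∑' n : ℤ, ENNReal.ofReal (2 ^ (-(2 * δ * |(n : ℝ)|)))) with hM
  have h1 : connNormLP φ k δ (s + 1) A ≤
      2 * sumNorm (fun η => envWt δ c η * wt (deltaD d δ) (s + 1) η) (cConn A) := by
    refine (tensorNorm_le_sumNorm _).trans ?_
    rw [sumNorm, sumNorm, Finset.mul_sum]
    exact Finset.sum_le_sum fun i _ =>
      multiplierNorm_lp_le P.two_le hφ P.pos P.lt_quarter k _ _ _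
  have h2 := hh.solution_le P (P.admWeight_env hc0) hA.1 hd.symm hd.harmonic
    (sumNorm_cConn_ne_top hA.2.ne)
  have h3 := hh.sum_cCurv_env_le P hc0 hl'
  have h4 : sumNorm (fun η => envWt δ c η * wt 0 s η) (cForm lam) ≤
      (d * d : ℕ) * ((M + 1) * ENNReal.ofReal (p k)) := by
    have h5 : ∀ q, multiplierNorm (fun η => envWt δ c η * wt 0 s η) (cForm lam q) ≤
        (M + 1) * ENNReal.ofReal (p k) := fun q => by
      -- Replacing `√M` by `M + 1` avoids a square root of the extended constant.
      refine (ENNReal.pow_right_strictMono two_ne_zero).le_iff_le.1 ?_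
      refine (multiplierNorm_env_le hφ P.pos P.lt_quarter (fl_of_sumNorm hl' q)
        (fun j => (le_tensorNorm _ q).trans (hp.bound j)) hp.nonneg hp.slow k).trans ?_
      rw [mul_pow]
      refine mul_le_mul_left ?_ _
      calc M ≤ (M + 1) * 1 := by rw [mul_one]; exact le_self_add
        _ ≤ (M + 1) ^ 2 := by rw [sq]; exact mul_le_mul_right le_add_self _
    refine (Finset.sum_le_sum fun q _ => h5 q).trans (le_of_eq ?_)
    simp [mul_assoc]
  have h6 := (sumNorm_cForm_le s lam).trans (mul_le_mul_right hd.lam_small _)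
  calc _ ≤ 2 * (2 * (8 * (prodConst d s δ * (((d * d : ℕ) * ENNReal.ofReal ε) *
        ((d * d : ℕ) * ((M + 1) * ENNReal.ofReal (p k))))))) := by
          refine h1.trans (mul_le_mul_right (h2.trans (mul_le_mul_right (h3.trans ?_) _)) _)
          gcongr
    _ = _ := by rw [solConst]; ring

end Data

/-! ### First variations -/

section Variation
variable {d : ℕ}

/-- The first variation of the inverse metric. -/
noncomputable def linInv (h dh : MetricField d) : MetricField d :=
  fun x => -(ginv h x * dh x * ginv h x)

/-- The Christoffel symbols with lowered index, as a linear function of `h`. -/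
noncomputable def lowChr (h : MetricField d) (σ α β : Fin d) (x : Rd d) : ℝ :=
  (1 / 2 : ℝ) * (pd α (fun y => h y β σ) x + pd β (fun y => h y α σ) x - pd σ (fun y => h y α β) x)

/-- The first variation of the Christoffel symbols. -/
noncomputable def linChr (h dh : MetricField d) (γ α β : Fin d) (x : Rd d) : ℝ :=
  ∑ σ, (linInv h dh x γ σ * lowChr h σ α β x + ginv h x γ σ * lowChr dh σ α β x)

/-- The first variation of the divergence. -/
noncomputable def linDiv (h : MetricField d) (A : Connection d) (dh : MetricField d)
    (dA : Connection d) (x : Rd d) : ℝ :=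
  ∑ α, ∑ β, (linInv h dh x α β * covDeriv h A α β x + ginv h x α β *
    (pd α (fun y => dA y β) x -
      ∑ γ, (linChr h dh γ α β x * A x γ + christoffel h γ α β x * dA x γ)))

/-- The first variation of the curvature source, before taking the imaginary part. -/
noncomputable def linCurv (h : MetricField d) (lam : SecondForm d) (dh : MetricField d)
    (dlam : SecondForm d) (α β : Fin d) : Rd d → ℂ :=
  curvForm (cMetric (linInv h dh)) (cForm lam) (cForm lam) α β +
    (curvForm (cInv h) (cForm dlam) (cForm lam) α β +
      curvForm (cInv h) (cForm lam) (cForm dlam) α β)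

theorem christoffel_eq (h : MetricField d) (γ α β : Fin d) (x : Rd d) :
    christoffel h γ α β x = ∑ σ, ginv h x γ σ * lowChr h σ α β x := by
  unfold christoffel lowChr
  simp_rw [pd_one_add]

/-- `dh` and its gradient are the derivatives at `0` of a curve of metrics and its gradient. -/
structure IsMetricVariation (hc : ℝ → MetricField d) (dh : MetricField d) (x : Rd d) : Prop where
  val : ∀ i j, HasDerivAt (fun t => hc t x i j) (dh x i j) 0
  grad : ∀ γ i j, HasDerivAt (fun t => pd γ (fun y => hc t y i j) x) (pd γ (fun y => dh y i j) x) 0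

/-- `dA` and its gradient are the derivatives at `0` of a curve of connections and its gradient. -/
structure IsConnVariation (Ac : ℝ → Connection d) (dA : Connection d) (x : Rd d) : Prop where
  val : ∀ i, HasDerivAt (fun t => Ac t x i) (dA x i) 0
  grad : ∀ γ i, HasDerivAt (fun t => pd γ (fun y => Ac t y i) x) (pd γ (fun y => dA y i) x) 0

theorem differentiableAt_matrix_det {n : ℕ} {M : ℝ → Matrix (Fin n) (Fin n) ℝ} {t : ℝ}
    (hM : ∀ i j, DifferentiableAt ℝ (fun t => M t i j) t) :
    DifferentiableAt ℝ (fun t => (M t).det) t := by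
  simp_rw [Matrix.det_apply']
  refine DifferentiableAt.fun_sum fun σ _ => ?_
  exact (DifferentiableAt.fun_finsetProd fun i _ => hM _ _).const_mul _

/-- Cramer's rule writes each entry as a quotient of determinants, which are polynomials in the
entries. -/
theorem differentiableAt_matrix_inv {n : ℕ} {M : ℝ → Matrix (Fin n) (Fin n) ℝ} {t : ℝ}
    (hM : ∀ i j, DifferentiableAt ℝ (fun t => M t i j) t) (hu : IsUnit (M t).det) (i j : Fin n) :
    DifferentiableAt ℝ (fun t => (M t)⁻¹ i j) t := by
  have h1 : ∀ t, (M t)⁻¹ i j = ((M t).det)⁻¹ * ((M t).updateRow j (Pi.single i 1)).det := fun t => by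
    rw [Matrix.inv_def, Matrix.smul_apply, Matrix.adjugate_apply, Ring.inverse_eq_inv', smul_eq_mul]
  simp_rw [h1]
  refine ((differentiableAt_matrix_det hM).inv hu.ne_zero).mul (differentiableAt_matrix_det fun k l => ?_)
  by_cases hk : k = j
  · subst hk; simp
  · simpa [Matrix.updateRow_ne hk] using hM k l

/-- Once the entries are known to be differentiable, differentiating `(1 + h) g⁻¹ = 1` determines
the derivative. -/
theorem hasDerivAt_ginv {hc : ℝ → MetricField d} {dh : MetricField d} {x : Rd d}
    (hv : ∀ i j, HasDerivAt (fun t => hc t x i j) (dh x i j) 0) (hu : IsUnit (1 + hc 0 x).det)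
    (i j : Fin d) : HasDerivAt (fun t => ginv (hc t) x i j) (linInv (hc 0) dh x i j) 0 := by
  have hM : ∀ i j, HasDerivAt (fun t => (1 + hc t x) i j) (dh x i j) 0 := fun i j => by
    simpa [Matrix.add_apply] using (hv i j).const_add ((1 : Matrix (Fin d) (Fin d) ℝ) i j)
  have hG : ∀ i j, DifferentiableAt ℝ (fun t => ginv (hc t) x i j) 0 :=
    differentiableAt_matrix_inv (fun i j => (hM i j).differentiableAt) hu
  set G' : Matrix (Fin d) (Fin d) ℝ :=
    Matrix.of fun i j => deriv (fun t => ginv (hc t) x i j) 0 with hG'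
  have hev : ∀ᶠ t in 𝓝 (0 : ℝ), IsUnit (1 + hc t x).det := by
    have h1 := (differentiableAt_matrix_det fun i j => (hM i j).differentiableAt).continuousAt.eventually_ne
      hu.ne_zero
    exact h1.mono fun t ht => isUnit_iff_ne_zero.2 ht
  have key : dh x * ginv (hc 0) x + (1 + hc 0 x) * G' = 0 := by
    ext k l
    have h1 : HasDerivAt (fun t => ∑ m, (1 + hc t x) k m * ginv (hc t) x m l)
        (∑ m, (dh x k m * ginv (hc 0) x m l + (1 + hc 0 x) k m * G' m l)) 0 :=
      HasDerivAt.fun_sum fun m _ => (hM k m).mul (hG m l).hasDerivAt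
    have h2 : (fun t => ∑ m, (1 + hc t x) k m * ginv (hc t) x m l) =ᶠ[𝓝 0]
        fun _ => (1 : Matrix (Fin d) (Fin d) ℝ) k l := by
      filter_upwards [hev] with t ht
      rw [← Matrix.mul_apply, ginv, Matrix.mul_nonsing_inv _ ht]
    have h3 := h1.unique ((hasDerivAt_const (0 : ℝ) _).congr_of_eventuallyEq h2)
    rw [Matrix.add_apply, Matrix.mul_apply, Matrix.mul_apply, ← Finset.sum_add_distrib, h3]
    rfl
  have hlin : G' = linInv (hc 0) dh x := by
    have h1 : ginv (hc 0) x * (1 + hc 0 x) = 1 := Matrix.nonsing_inv_mul _ hu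
    calc G' = ginv (hc 0) x * (1 + hc 0 x) * G' := by rw [h1, Matrix.one_mul]
      _ = ginv (hc 0) x * ((1 + hc 0 x) * G') := Matrix.mul_assoc _ _ _
      _ = _ := by
        rw [eq_neg_of_add_eq_zero_right key, linInv, Matrix.mul_neg, Matrix.mul_assoc]
  have := (hG i j).hasDerivAt
  rw [← hlin]
  exact this

theorem IsMetricVariation.hasDerivAt_lowChr {hc : ℝ → MetricField d} {dh : MetricField d} {x : Rd d}
    (hv : IsMetricVariation hc dh x) (σ α β : Fin d) :
    HasDerivAt (fun t => lowChr (hc t) σ α β x) (lowChr dh σ α β x) 0 :=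
  (((hv.grad α β σ).add (hv.grad β α σ)).sub (hv.grad σ α β)).const_mul _

theorem IsMetricVariation.hasDerivAt_christoffel {hc : ℝ → MetricField d} {dh : MetricField d}
    {x : Rd d} (hv : IsMetricVariation hc dh x) (hu : IsUnit (1 + hc 0 x).det) (γ α β : Fin d) :
    HasDerivAt (fun t => christoffel (hc t) γ α β x) (linChr (hc 0) dh γ α β x) 0 := by
  simp_rw [christoffel_eq]
  exact HasDerivAt.fun_sum fun σ _ => (hasDerivAt_ginv hv.val hu γ σ).mul (hv.hasDerivAt_lowChr σ α β)

theorem IsMetricVariation.hasDerivAt_covDiv {hc : ℝ → MetricField d} {dh : MetricField d}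
    {Ac : ℝ → Connection d} {dA : Connection d} {x : Rd d} (hv : IsMetricVariation hc dh x)
    (hu : IsUnit (1 + hc 0 x).det) (hA : IsConnVariation Ac dA x) :
    HasDerivAt (fun t => covDiv (hc t) (Ac t) x) (linDiv (hc 0) (Ac 0) dh dA x) 0 := by
  refine HasDerivAt.fun_sum fun α _ => HasDerivAt.fun_sum fun β _ =>
    (hasDerivAt_ginv hv.val hu α β).mul ((hA.grad α β).sub (HasDerivAt.fun_sum fun γ _ => ?_))
  exact (hv.hasDerivAt_christoffel hu γ α β).mul (hA.val γ)

theorem IsConnVariation.hasDerivAt_covCurl {hc : ℝ → MetricField d} {Ac : ℝ → Connection d}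
    {dA : Connection d} {x : Rd d} (hA : IsConnVariation Ac dA x)
    (hs : ∀ᶠ t in 𝓝 (0 : ℝ), ∀ x, (hc t x).IsSymm) (α β : Fin d) :
    HasDerivAt (fun t => covCurl (hc t) (Ac t) α β x)
      (pd α (fun y => dA y β) x - pd β (fun y => dA y α) x) 0 := by
  refine ((hA.grad α β).sub (hA.grad β α)).congr_of_eventuallyEq ?_
  filter_upwards [hs] with t ht
  exact covCurl_eq ht _ _ _ _

theorem hasDerivAt_normalCurv {hc : ℝ → MetricField d} {dh : MetricField d}
    {lc : ℝ → SecondForm d} {dlam : SecondForm d} {x : Rd d}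
    (hv : ∀ i j, HasDerivAt (fun t => hc t x i j) (dh x i j) 0) (hu : IsUnit (1 + hc 0 x).det)
    (hl : ∀ i j, HasDerivAt (fun t => lc t x i j) (dlam x i j) 0) (α β : Fin d) :
    HasDerivAt (fun t => normalCurv (hc t) (lc t) α β x)
      (linCurv (hc 0) (lc 0) dh dlam α β x).im 0 := by
  have h1 : HasDerivAt (fun t => ∑ γ, ∑ μ, (ginv (hc t) x γ μ : ℂ) * lc t x α μ *
      (starRingEnd ℂ) (lc t x β γ)) (linCurv (hc 0) (lc 0) dh dlam α β x) 0 := by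
    have h2 : linCurv (hc 0) (lc 0) dh dlam α β x = ∑ γ, ∑ μ,
        (((linInv (hc 0) dh x γ μ : ℂ) * lc 0 x α μ + (ginv (hc 0) x γ μ : ℂ) * dlam x α μ) *
          (starRingEnd ℂ) (lc 0 x β γ) + (ginv (hc 0) x γ μ : ℂ) * lc 0 x α μ *
          (starRingEnd ℂ) (dlam x β γ)) := by
      simp only [linCurv, curvForm, Pi.add_apply, Finset.sum_apply, Pi.mul_apply,
        ← Finset.sum_add_distrib]
      exact Finset.sum_congr rfl fun γ _ => Finset.sum_congr rfl fun μ _ => by ring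
    rw [h2]
    refine HasDerivAt.fun_sum fun γ _ => HasDerivAt.fun_sum fun μ _ => HasDerivAt.mul
      (HasDerivAt.mul (hasDerivAt_ginv hv hu γ μ).ofReal_comp (hl α μ)) ?_
    exact (hl β γ).star
  exact Complex.imCLM.hasFDerivAt.comp_hasDerivAt 0 h1

theorem pd_add_smul {f g : Rd d → ℝ} (hf : Differentiable ℝ f) (hg : Differentiable ℝ g) (t : ℝ)
    (γ : Fin d) (x : Rd d) : pd γ (fun y => f y + t * g y) x = pd γ f x + t * pd γ g x := by
  unfold pd
  rw [fderiv_fun_add (hf x) ((hg x).const_mul t), fderiv_const_mul (hg x)]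
  simp

theorem hasDerivAt_add_mul (a b : ℝ) : HasDerivAt (fun t : ℝ => a + t * b) b 0 := by
  simpa using ((hasDerivAt_id (0 : ℝ)).mul_const b).const_add a

theorem isMetricVariation_line {h dh : MetricField d} (hh : ∀ p, FL1 (cMetric h p))
    (hdh : ∀ p, FL1 (cMetric dh p)) (x : Rd d) :
    IsMetricVariation (fun t => h + t • dh) dh x := by
  have hre : ∀ {h : MetricField d}, (∀ p, FL1 (cMetric h p)) → ∀ i j,
      Differentiable ℝ fun y => h y i j := fun hh i j =>
    Complex.reCLM.differentiable.comp (hh (i, j)).differentiable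
  refine ⟨fun i j => hasDerivAt_add_mul _ _, fun γ i j => ?_⟩
  have : ∀ t : ℝ, pd γ (fun y => (h + t • dh) y i j) x =
      pd γ (fun y => h y i j) x + t * pd γ (fun y => dh y i j) x := fun t =>
    pd_add_smul (hre hh i j) (hre hdh i j) t γ x
  simp_rw [this]
  exact hasDerivAt_add_mul _ _

theorem isConnVariation_line {A dA : Connection d} (hA : ∀ i, FL1 (cConn A i))
    (hdA : ∀ i, FL1 (cConn dA i)) (x : Rd d) :
    IsConnVariation (fun t => A + t • dA) dA x := by
  have hre : ∀ {A : Connection d}, (∀ i, FL1 (cConn A i)) → ∀ i,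
      Differentiable ℝ fun y => A y i := fun hh i =>
    Complex.reCLM.differentiable.comp (hh i).differentiable
  refine ⟨fun i => hasDerivAt_add_mul _ _, fun γ i => ?_⟩
  have : ∀ t : ℝ, pd γ (fun y => (A + t • dA) y i) x =
      pd γ (fun y => A y i) x + t * pd γ (fun y => dA y i) x := fun t =>
    pd_add_smul (hre hA i) (hre hdA i) t γ x
  simp_rw [this]
  exact hasDerivAt_add_mul _ _

theorem hasDerivAt_line_form (lam dlam : SecondForm d) (x : Rd d) (i j : Fin d) :
    HasDerivAt (fun t : ℝ => (lam + t • dlam) x i j) (dlam x i j) 0 := by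
  have : HasDerivAt (fun t : ℝ => lam x i j + t • dlam x i j) (dlam x i j) 0 := by
    simpa using ((hasDerivAt_id (0 : ℝ)).smul_const (dlam x i j)).const_add (lam x i j)
  exact this

/-- The linearized system in terms of the first variations. -/
theorem solvesLinearized_iff {h : MetricField d} {lam : SecondForm d} {A : Connection d}
    {dh : MetricField d} {dlam : SecondForm d} {dA : Connection d}
    (hu : ∀ x, IsUnit (1 + h x).det) (hs : ∀ x, (h x).IsSymm) (hds : ∀ x, (dh x).IsSymm)
    (hh : ∀ p, FL1 (cMetric h p)) (hdh : ∀ p, FL1 (cMetric dh p)) (hA : ∀ i, FL1 (cConn A i))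
    (hdA : ∀ i, FL1 (cConn dA i)) :
    SolvesLinearized h lam A dh dlam dA ↔ (∀ x, linDiv h A dh dA x = 0) ∧
      ∀ α β x, pd α (fun y => dA y β) x - pd β (fun y => dA y α) x =
        (linCurv h lam dh dlam α β x).im := by
  have h1 : ∀ x, HasDerivAt (fun t : ℝ => covDiv (h + t • dh) (A + t • dA) x)
      (linDiv h A dh dA x) 0 := fun x => by
    have := (isMetricVariation_line hh hdh x).hasDerivAt_covDiv (by simpa using hu x)
      (isConnVariation_line hA hdA x)
    simpa only [zero_smul, add_zero] using this
  have h2 : ∀ α β x, HasDerivAt (fun t : ℝ => covCurl (h + t • dh) (A + t • dA) α β x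
      - normalCurv (h + t • dh) (lam + t • dlam) α β x)
      (pd α (fun y => dA y β) x - pd β (fun y => dA y α) x -
        (linCurv h lam dh dlam α β x).im) 0 := fun α β x => by
    -- Symmetry of `dh` keeps the Christoffel symbols symmetric along the line, so they drop out of
    -- the curl.
    have a1 := (isConnVariation_line hA hdA x).hasDerivAt_covCurl (hc := fun t => h + t • dh)
      (.of_forall fun t x => (hs x).add ((hds x).smul t)) α β
    have a2 := hasDerivAt_normalCurv (isMetricVariation_line hh hdh x).val (by simpa using hu x)
      (hasDerivAt_line_form lam dlam x) α β
    simp only [zero_smul, add_zero] at a2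
    exact a1.sub a2
  constructor
  · intro hL
    exact ⟨fun x => (h1 x).unique (hL.coulomb x),
      fun α β x => sub_eq_zero.1 ((h2 α β x).unique (hL.curl α β x))⟩
  · rintro ⟨e1, e2⟩
    exact ⟨fun x => by simpa only [e1] using h1 x,
      fun α β x => by simpa only [e2, sub_self] using h2 α β x⟩

end Variation

/-! ### Estimates for the linearized system -/

section Linearized
variable {d : ℕ} {s δ : ℝ} {h dh : MetricField d} {lam dlam : SecondForm d} {A dA : Connection d}

/-- The lowered Christoffel symbols as complex functions. -/
noncomputable abbrev cLow (h : MetricField d) (σ : Fin d) (p : Fin d × Fin d) : Rd d → ℂ :=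
  fun x => (lowChr h σ p.1 p.2 x : ℂ)

theorem cLow_eq (hh : ∀ p, FL1 (cMetric h p)) (σ : Fin d) (p : Fin d × Fin d) :
    cLow h σ p = fun x => (1 / 2 : ℂ) * (pdC p.1 (cMetric h (p.2, σ)) +
      pdC p.2 (cMetric h (p.1, σ)) - pdC σ (cMetric h p)) x := by
  funext x
  show (lowChr h σ p.1 p.2 x : ℂ) = _
  simp only [lowChr, Pi.add_apply, Pi.sub_apply, pdC_cMetric hh]
  push_cast
  rfl

theorem fl_cLow (hh : ∀ p, FL1 (cMetric h p)) (σ : Fin d) (p : Fin d × Fin d) :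
    FL (cLow h σ p) := by
  rw [cLow_eq hh]
  exact ((((hh _).pd _).add ((hh _).pd _)).sub ((hh _).pd _)).const_mul _

theorem norm_cLow_le (hd : 2 ≤ d) (hh : ∀ p, FL1 (cMetric h p)) (σ' : ℝ) (σ : Fin d)
    (p : Fin d × Fin d) : multiplierNorm (wt (lowExp d δ - 1) σ') (cLow h σ p) ≤
      2 * sumNorm (wt (lowExp d δ) (σ' + 1)) (cMetric h) := by
  have hm : Measurable (wt (lowExp d δ - 1) σ' : Rd d → ℝ) := measurable_sobolevSymbol _ _
  have h1 : ∀ α q, multiplierNorm (wt (lowExp d δ - 1) σ') (pdC α (cMetric h q)) ≤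
      sumNorm (wt (lowExp d δ) (σ' + 1)) (cMetric h) := fun α q =>
    (multiplierNorm_pd_le hd (hh q) (fun η hη => by
      rw [abs_of_nonneg (wt_nonneg _ _ _), abs_of_nonneg (wt_nonneg _ _ _), wt_mul_norm _ _ hη])
      α).trans (le_sumNorm _ q)
  rw [cLow_eq hh]
  refine (multiplierNorm_const_mul_le _ _ _).trans ?_
  refine (mul_le_mul_right ((multiplierNorm_sub_le hm _ _).trans (add_le_add
    ((multiplierNorm_add_le hm _ _).trans (add_le_add (h1 _ _) (h1 _ _))) (h1 _ _))) _).trans ?_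
  have e : ‖(1 / 2 : ℂ)‖ₑ = 2⁻¹ := by
    rw [← ofReal_norm, norm_div, norm_one, Complex.norm_ofNat, one_div,
      ENNReal.ofReal_inv_of_pos (by norm_num), ENNReal.ofReal_ofNat]
  rw [e]
  set S := sumNorm (wt (lowExp d δ) (σ' + 1)) (cMetric h)
  calc 2⁻¹ * (S + S + S) ≤ 2⁻¹ * (4 * S) := by
        refine mul_le_mul_right ?_ _
        calc S + S + S = 3 * S := by ring
          _ ≤ 4 * S := by gcongr; norm_num
    _ = 2⁻¹ * 2 * (2 * S) := by ring
    _ = 2 * S := by rw [ENNReal.inv_mul_cancel (by norm_num) (by norm_num), one_mul]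

/-- The first variation of the inverse metric as complex functions. -/
noncomputable abbrev cLinInv (h dh : MetricField d) : Fin d × Fin d → Rd d → ℂ :=
  cMetric (linInv h dh)

/-- The variation of the inverse metric between two metrics. -/
noncomputable def crossInv (h h₀ dh : MetricField d) : MetricField d :=
  fun x => -(ginv h x * dh x * ginv h₀ x)

theorem cCross_eq (h h₀ dh : MetricField d) (p : Fin d × Fin d) :
    cMetric (crossInv h h₀ dh) p =
      -∑ m, ∑ l, cInv h (p.1, l) * (cInv h₀ (m, p.2) * cMetric dh (l, m)) := by
  funext x
  show (crossInv h h₀ dh x p.1 p.2 : ℂ) = _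
  simp only [crossInv, Matrix.neg_apply, Matrix.mul_apply, Pi.neg_apply, Finset.sum_apply,
    Pi.mul_apply, Finset.sum_mul]
  push_cast
  congr 1
  exact Finset.sum_congr rfl fun m _ => Finset.sum_congr rfl fun l _ => by ring

/-- Each inverse metric acts boundedly with constant two. The case `h = h₀` bounds the first
variation of the inverse metric, the general case its difference quotients. -/
theorem SmallMetric.cross_le {h₀ : MetricField d} (hh : SmallMetric s δ h)
    (hh₀ : SmallMetric s δ h₀) (P : Params d s δ) {σ : ℝ}
    (h1 : (d : ℝ) / 2 - 2 ≤ σ) (h2 : σ ≤ s) (hdh : ∀ p, FL (cMetric dh p)) (p : Fin d × Fin d) :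
    multiplierNorm (wt (lowExp d δ) (σ + 1)) (cMetric (crossInv h h₀ dh) p) ≤
      4 * sumNorm (wt (lowExp d δ) (σ + 1)) (cMetric dh) := by
  have hm : Measurable (wt (lowExp d δ) (σ + 1) : Rd d → ℝ) := measurable_sobolevSymbol _ _
  have h3 : ∀ {h' : MetricField d}, SmallMetric s δ h' → ∀ q {v : Rd d → ℂ}, FL v →
      multiplierNorm (wt (lowExp d δ) (σ + 1)) (cInv h' q * v) ≤
      2 * multiplierNorm (wt (lowExp d δ) (σ + 1)) v := fun hh' q v hv =>
    hh'.inv_mul_le P hm q fun u hu => P.norm_metric_mul_metric h1 h2 hu hv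
  rw [cCross_eq, multiplierNorm_neg]
  refine (multiplierNorm_sum_le hm _ _).trans ((Finset.sum_le_sum fun m _ =>
    (multiplierNorm_sum_le hm _ _).trans (Finset.sum_le_sum fun l _ =>
      (h3 hh _ (hh₀.fl_inv_mul P _ (hdh _))).trans (mul_le_mul_right (h3 hh₀ _ (hdh _)) _))).trans
        (le_of_eq ?_))
  rw [sumNorm, Fintype.sum_prod_type, Finset.sum_comm, Finset.mul_sum]
  refine Finset.sum_congr rfl fun l _ => ?_
  rw [Finset.mul_sum]
  exact Finset.sum_congr rfl fun m _ => by rw [← mul_assoc]; norm_num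

theorem SmallMetric.fl_linInv (hh : SmallMetric s δ h) (P : Params d s δ)
    (hdh : ∀ p, FL (cMetric dh p)) (p : Fin d × Fin d) : FL (cLinInv h dh p) := by
  rw [show cLinInv h dh p = _ from cCross_eq h h dh p]
  exact (FL.sum _ fun m _ => FL.sum _ fun l _ =>
    hh.fl_inv_mul P _ (hh.fl_inv_mul P _ (hdh _))).neg

theorem SmallMetric.linInv_le (hh : SmallMetric s δ h) (P : Params d s δ) {σ : ℝ}
    (h1 : (d : ℝ) / 2 - 2 ≤ σ) (h2 : σ ≤ s) (hdh : ∀ p, FL (cMetric dh p)) (p : Fin d × Fin d) :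
    multiplierNorm (wt (lowExp d δ) (σ + 1)) (cLinInv h dh p) ≤
      4 * sumNorm (wt (lowExp d δ) (σ + 1)) (cMetric dh) :=
  hh.cross_le hh P h1 h2 hdh p

/-- The covariant derivative as complex functions. -/
noncomputable def cCov (h : MetricField d) (A : Connection d) (p : Fin d × Fin d) : Rd d → ℂ :=
  pdC p.1 (cConn A p.2) - ∑ γ, ∑ σ, cInv h (γ, σ) * (cLow h σ p * cConn A γ)

/-- The source in the linearized divergence equation. -/
noncomputable def linSource (h dh : MetricField d) (A : Connection d) : Rd d → ℂ :=
  ∑ p, (∑ γ, ∑ σ, cInv h p * (cLinInv h dh (γ, σ) * (cLow h σ p * cConn A γ) +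
    cInv h (γ, σ) * (cLow dh σ p * cConn A γ)) - cLinInv h dh p * cCov h A p)

theorem ofReal_covDeriv (hA : ∀ i, FL1 (cConn A i)) (α β : Fin d) (x : Rd d) :
    (covDeriv h A α β x : ℂ) = cCov h A (α, β) x := by
  simp only [covDeriv, cCov, Pi.sub_apply, pdC_cConn hA, christoffel_eq, Finset.sum_apply,
    Pi.mul_apply]
  push_cast
  congr 1
  refine Finset.sum_congr rfl fun γ _ => ?_
  rw [Finset.sum_mul]
  exact Finset.sum_congr rfl fun σ _ => by ring

/-- Separates the principal part in `dA` from the sources. Only the base metric is in harmonic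
gauge, not the variation `dh`, so the varied Christoffel symbols remain, multiplied by `A` without
derivatives. -/
theorem linDiv_eq (h : MetricField d) (A : Connection d) (dh : MetricField d)
    (dA : Connection d) (x : Rd d) :
    linDiv h A dh dA x = covDiv h dA x + ∑ α, ∑ β, (linInv h dh x α β * covDeriv h A α β x -
      ginv h x α β * ∑ γ, linChr h dh γ α β x * A x γ) := by
  rw [linDiv, covDiv, ← Finset.sum_add_distrib]
  refine Finset.sum_congr rfl fun α _ => ?_
  rw [← Finset.sum_add_distrib]
  refine Finset.sum_congr rfl fun β _ => ?_
  rw [covDeriv, covDeriv, Finset.sum_add_distrib]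
  ring

theorem ofReal_linDiv (hg : IsHarmonicGauge h) (hA : ∀ i, FL1 (cConn A i))
    (hdA : ∀ i, FL1 (cConn dA i)) (x : Rd d) :
    (linDiv h A dh dA x : ℂ) = (∑ α, pdC α (cConn dA α)) x + contractGrad (invDev h) (cConn dA) x -
      linSource h dh A x := by
  rw [linDiv_eq, Complex.ofReal_add, ofReal_covDiv hg hdA, sub_eq_add_neg _ (linSource h dh A x)]
  congr 1
  rw [linSource, Finset.sum_apply, Fintype.sum_prod_type, ← Finset.sum_neg_distrib]
  push_cast
  refine Finset.sum_congr rfl fun α _ => ?_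
  rw [← Finset.sum_neg_distrib]
  refine Finset.sum_congr rfl fun β _ => ?_
  rw [ofReal_covDeriv hA]
  simp only [Pi.sub_apply, Pi.mul_apply, Pi.add_apply, Finset.sum_apply, linChr, neg_sub,
    Finset.mul_sum]
  push_cast
  congr 1
  refine Finset.sum_congr rfl fun γ _ => ?_
  rw [Finset.sum_mul, Finset.mul_sum]
  exact Finset.sum_congr rfl fun σ _ => by ring

/-- The constant in the bound for the linearized divergence source. -/
noncomputable def sourceConst (d : ℕ) (s δ : ℝ) : ℝ≥0∞ :=
  (d * d : ℕ) * ((d * d : ℕ) * (16 * prodConst d s δ * prodConst d s δ + 8 * prodConst d s δ) +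
    4 * prodConst d s δ * (1 + (d * d : ℕ) * (4 * prodConst d s δ)))

theorem Params.sourceConst_ne_top (P : Params d s δ) : sourceConst d s δ ≠ ⊤ := by
  have h1 := P.prodConst_ne_top
  have h2 : ((d * d : ℕ) : ℝ≥0∞) ≠ ⊤ := ENNReal.natCast_ne_top _
  unfold sourceConst
  finiteness

theorem sum_sum_const (n : ℕ) (c : ℝ≥0∞) :
    ∑ _i : Fin n, ∑ _j : Fin n, c = (n * n : ℕ) * c := by
  simp [← mul_assoc]

/-- Every term has one factor `dh`, its gradient, or the variation of `g⁻¹`, and this factor alone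
is measured at order `σ`. The remaining factors, in particular the products of `∂h` with `A`, are
estimated at top regularity, and each term is linear in `A`. -/
theorem SmallMetric.linSource_le (hh : SmallMetric s δ h) (P : Params d s δ) {σ : ℝ}
    (h1 : (d : ℝ) / 2 - 2 ≤ σ) (h2 : σ ≤ s) (hdh : ∀ p, FL1 (cMetric dh p))
    (hA : ∀ i, FL1 (cConn A i)) :
    multiplierNorm (wt (deltaD d δ - 1) σ) (linSource h dh A) ≤ sourceConst d s δ *
      (sumNorm (wt (lowExp d δ) (σ + 1)) (cMetric dh) *
        sumNorm (wt (deltaD d δ) (s + 1)) (cConn A)) := by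
  have hs2 : (d : ℝ) / 2 - 2 ≤ s := by have := P.lt_s; linarith
  have hW := P.admWeight h1 h2
  have hWs := P.admWeight (σ := s) hs2 le_rfl
  have hdh0 : ∀ p, FL (cMetric dh p) := fun p => (hdh p).fl
  set D := sumNorm (wt (lowExp d δ) (σ + 1)) (cMetric dh) with hD
  set a := sumNorm (wt (deltaD d δ) (s + 1)) (cConn A) with ha
  set C := prodConst d s δ with hC
  have hLs : ∀ τ : Fin d, ∀ p γ, multiplierNorm (wt (deltaD d δ - 1) s) (cLow h τ p * cConn A γ) ≤
      C * (2 * a) := fun τ p γ => by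
    refine (P.norm_dmetric_mul_conn hs2 le_rfl (fl_cLow (hh.fl1 P) τ p) (hA γ).fl).trans
      (mul_le_mul_right (mul_le_mul' ?_ (le_sumNorm _ γ)) _)
    refine (norm_cLow_le P.two_le (hh.fl1 P) s τ p).trans ?_
    calc _ ≤ 2 * (1 : ℝ≥0∞) := mul_le_mul_right hh.2 _
      _ = 2 := mul_one _
  have hLd : ∀ τ : Fin d, ∀ p γ, multiplierNorm (wt (deltaD d δ - 1) σ) (cLow dh τ p * cConn A γ) ≤
      C * (2 * D * a) := fun τ p γ =>
    (P.norm_dmetric_mul_conn h1 h2 (fl_cLow hdh τ p) (hA γ).fl).trans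
      (mul_le_mul_right (mul_le_mul' (norm_cLow_le P.two_le hdh σ τ p) (le_sumNorm _ γ)) _)
  have hfl : ∀ {h' : MetricField d}, (∀ p, FL1 (cMetric h' p)) → ∀ τ p γ,
      FL (cLow h' τ p * cConn A γ) := fun hh' τ p γ => (fl_cLow hh' τ p).mul (hA γ).fl
  have hinv : ∀ {Z Y : Rd d → ℝ}, AdmWeight d s δ Z Y → ∀ q {v : Rd d → ℂ}, FL v →
      multiplierNorm Z (cInv h q * v) ≤ 2 * multiplierNorm Z v := fun hW q v hv =>
    hh.inv_mul_le P hW.measZ q fun u hu => hW.norm_mul_le P hu hv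
  have hcov : ∀ p, multiplierNorm (wt (deltaD d δ - 1) s) (cCov h A p) ≤
      (1 + (d * d : ℕ) * (4 * C)) * a := fun p => by
    refine (multiplierNorm_sub_le hWs.measZ _ _).trans ?_
    rw [add_mul, one_mul]
    refine add_le_add ((hWs.pd_le P.two_le (hA _) _).trans (le_sumNorm _ p.2)) ?_
    refine (multiplierNorm_sum_le hWs.measZ _ _).trans ((Finset.sum_le_sum fun γ _ =>
      (multiplierNorm_sum_le hWs.measZ _ _).trans (Finset.sum_le_sum fun τ _ =>
        (hinv hWs _ (hfl (hh.fl1 P) τ p γ)).trans (mul_le_mul_right (hLs τ p γ) _))).trans ?_)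
    rw [sum_sum_const]
    exact le_of_eq (by ring)
  have hcovfl : ∀ p, FL (cCov h A p) := fun p => ((hA _).pd _).sub
    (FL.sum _ fun γ _ => FL.sum _ fun τ _ => hh.fl_inv_mul P _ (hfl (hh.fl1 P) τ p γ))
  have hlin := hh.fl_linInv P hdh0
  have hlin_le : ∀ q {v : Rd d → ℂ}, FL v → multiplierNorm (wt (deltaD d δ - 1) σ)
      (cLinInv h dh q * v) ≤ C * (4 * D * multiplierNorm (wt (deltaD d δ - 1) s) v) :=
    fun q v hv => (P.norm_metric_mul_source h1 h2 (hlin q) hv).trans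
      (mul_le_mul_right (mul_le_mul_left (hh.linInv_le P h1 h2 hdh0 q) _) _)
  have hterm : ∀ p, multiplierNorm (wt (deltaD d δ - 1) σ)
      (∑ γ, ∑ τ, cInv h p * (cLinInv h dh (γ, τ) * (cLow h τ p * cConn A γ) +
        cInv h (γ, τ) * (cLow dh τ p * cConn A γ)) - cLinInv h dh p * cCov h A p) ≤
      ((d * d : ℕ) * (16 * C * C + 8 * C) + 4 * C * (1 + (d * d : ℕ) * (4 * C))) * (D * a) := by
    intro p
    refine (multiplierNorm_sub_le hW.measZ _ _).trans ?_
    rw [add_mul]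
    refine add_le_add ?_ ?_
    · refine (multiplierNorm_sum_le hW.measZ _ _).trans ((Finset.sum_le_sum fun γ _ =>
        (multiplierNorm_sum_le hW.measZ _ _).trans (Finset.sum_le_sum fun τ _ =>
          (hinv hW _ (((hlin _).mul (hfl (hh.fl1 P) τ p γ)).add
            (hh.fl_inv_mul P _ (hfl hdh τ p γ)))).trans (mul_le_mul_right
              ((multiplierNorm_add_le hW.measZ _ _).trans (add_le_add
                ((hlin_le _ (hfl (hh.fl1 P) τ p γ)).trans
                  (mul_le_mul_right (mul_le_mul_right (hLs τ p γ) _) _))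
                ((hinv hW _ (hfl hdh τ p γ)).trans (mul_le_mul_right (hLd τ p γ) _)))) _))).trans ?_)
      rw [sum_sum_const]
      exact le_of_eq (by ring)
    · refine (hlin_le p (hcovfl p)).trans
        ((mul_le_mul_right (mul_le_mul_right (hcov p) _) _).trans (le_of_eq (by ring)))
  refine (multiplierNorm_sum_le hW.measZ _ _).trans
    ((Finset.sum_le_sum fun p _ => hterm p).trans (le_of_eq ?_))
  rw [Finset.sum_const, Finset.card_univ, Fintype.card_prod, Fintype.card_fin, nsmul_eq_mul,
    ← mul_assoc, sourceConst]

theorem SmallMetric.sum_linCurv_le (hh : SmallMetric s δ h) (P : Params d s δ) {σ : ℝ}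
    (h1 : (d : ℝ) / 2 - 2 ≤ σ) (h2 : σ ≤ s) (hdh : ∀ p, FL (cMetric dh p))
    (hl : sumNorm (wt 0 s) (cForm lam) ≠ ⊤) (hdl : sumNorm (wt 0 s) (cForm dlam) ≠ ⊤) :
    ∑ α, ∑ β, multiplierNorm (wt (deltaD d δ - 1) σ) (linCurv h lam dh dlam α β) ≤
      4 * prodConst d s δ * sumNorm (wt 0 s) (cForm lam) *
        (prodConst d s δ * sumNorm (wt 0 s) (cForm lam) *
          sumNorm (wt (lowExp d δ) (σ + 1)) (cMetric dh) + sumNorm (wt 0 σ) (cForm dlam)) := by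
  have hs2 : (d : ℝ) / 2 - 2 ≤ s := by have := P.lt_s; linarith
  have hW := P.admWeight h1 h2
  have hfl := fl_of_sumNorm hl
  have hdfl := fl_of_sumNorm hdl
  have hcj : ∀ (r : ℝ) (u : Rd d → ℂ), multiplierNorm (wt 0 r) (fun x => (starRingEnd ℂ) (u x)) ≤
      multiplierNorm (wt 0 r) u := fun r u =>
    multiplierNorm_conj (measurable_sobolevSymbol _ _) (sobolevSymbol_neg _ _) u
  set C := prodConst d s δ with hC
  set D := sumNorm (wt (lowExp d δ) (σ + 1)) (cMetric dh) with hD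
  have b1 : ∑ α, ∑ β, multiplierNorm (wt (deltaD d δ - 1) σ)
      (curvForm (cLinInv h dh) (cForm lam) (cForm lam) α β) ≤
      ∑ p, ∑ q, 4 * C * C * D * (multiplierNorm (wt 0 s) (cForm lam p) *
        multiplierNorm (wt 0 s) (cForm lam q)) := by
    refine sum_curvForm_le hW.measZ fun r p q => ?_
    refine (P.norm_metric_mul_source h1 h2 (hh.fl_linInv P hdh r) ((hfl p).mul (hfl q).conj)).trans
      ((mul_le_mul_right (mul_le_mul' (hh.linInv_le P h1 h2 hdh r)
        ((P.norm_form_mul_form hs2 le_rfl (hfl p) (hfl q).conj).trans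
          (mul_le_mul_right (mul_le_mul_right (hcj s _) _) _))) _).trans (le_of_eq (by ring)))
  have b2 := hh.sum_curv_le P hW hdfl hfl (B := fun p q => C * (multiplierNorm (wt 0 σ)
      (cForm dlam p) * multiplierNorm (wt 0 s) (cForm lam q))) (fun p q => by
    -- The product estimate takes the factor of lower regularity second.
    rw [mul_comm (cForm dlam p), mul_comm (multiplierNorm (wt 0 σ) (cForm dlam p))]
    exact (P.norm_form_mul_form h1 h2 (hfl q).conj (hdfl p)).trans
      (mul_le_mul_right (mul_le_mul_left (hcj s _) _) _))
  have b3 := hh.sum_curv_le P hW hfl hdfl (B := fun p q => C * (multiplierNorm (wt 0 s)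
      (cForm lam p) * multiplierNorm (wt 0 σ) (cForm dlam q))) (fun p q =>
    (P.norm_form_mul_form h1 h2 (hfl p) (hdfl q).conj).trans
      (mul_le_mul_right (mul_le_mul_right (hcj σ _) _) _))
  rw [sum_sum_mul] at b1 b2 b3
  calc _ ≤ ∑ α, ∑ β, (multiplierNorm (wt (deltaD d δ - 1) σ)
          (curvForm (cLinInv h dh) (cForm lam) (cForm lam) α β) +
        (multiplierNorm (wt (deltaD d δ - 1) σ) (curvForm (cInv h) (cForm dlam) (cForm lam) α β) +
        multiplierNorm (wt (deltaD d δ - 1) σ) (curvForm (cInv h) (cForm lam) (cForm dlam) α β))) :=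
        Finset.sum_le_sum fun α _ => Finset.sum_le_sum fun β _ =>
          (multiplierNorm_add_le hW.measZ _ _).trans
            (add_le_add_right (multiplierNorm_add_le hW.measZ _ _) _)
    _ ≤ _ := by
        simp_rw [Finset.sum_add_distrib]
        refine (add_le_add b1 (add_le_add b2 b3)).trans (le_of_eq ?_)
        unfold sumNorm
        ring

/-- The linearized system in complex form. -/
theorem SolvesLinearized.complex (hL : SolvesLinearized h lam A dh dlam dA)
    (hu : ∀ x, IsUnit (1 + h x).det) (hs : ∀ x, (h x).IsSymm) (hds : ∀ x, (dh x).IsSymm)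
    (hg : IsHarmonicGauge h) (hh : ∀ p, FL1 (cMetric h p)) (hdh : ∀ p, FL1 (cMetric dh p))
    (hA : ∀ i, FL1 (cConn A i)) (hdA : ∀ i, FL1 (cConn dA i)) :
    ∑ α, pdC α (cConn dA α) = linSource h dh A - contractGrad (invDev h) (cConn dA) ∧
      ∀ α β, pdC α (cConn dA β) - pdC β (cConn dA α) =
        fun x => ((linCurv h lam dh dlam α β x).im : ℂ) := by
  obtain ⟨e1, e2⟩ := (solvesLinearized_iff hu hs hds hh hdh hA hdA).1 hL
  constructor
  · funext x
    have := ofReal_linDiv (dh := dh) hg hA hdA x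
    rw [e1, Complex.ofReal_zero] at this
    rw [Pi.sub_apply]
    linear_combination -this
  · intro α β
    funext x
    rw [Pi.sub_apply, pdC_cConn hdA, pdC_cConn hdA, ← e2]
    push_cast; rfl

/-- The constant in the bound for the linearized system. -/
noncomputable def linConst (d : ℕ) (s δ : ℝ) : ℝ≥0∞ :=
  2 * (d * d : ℕ) * (4 * prodConst d s δ * (d * d : ℕ) * (prodConst d s δ * (d * d : ℕ) + 1) +
    d * (sourceConst d s δ * solConst d s δ))

theorem Params.linConst_ne_top (P : Params d s δ) : linConst d s δ ≠ ⊤ := by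
  have h1 := P.prodConst_ne_top
  have h2 : ((d * d : ℕ) : ℝ≥0∞) ≠ ⊤ := ENNReal.natCast_ne_top _
  have h3 := P.sourceConst_ne_top
  have h4 := P.solConst_ne_top
  unfold linConst
  finiteness

/-- The factor `ε` has two origins: the varied curvature always retains an undifferentiated `λ`, and
the divergence source is linear in `A`, which is itself of size `ε` by the quadratic bound. The norm
of `dA` at order `s + 1` serves only regularity and the finiteness needed for absorption. -/
theorem SmallMetric.linearized_bound (hh : SmallMetric s δ h) (P : Params d s δ) {σ ε : ℝ}
    (h1 : (d : ℝ) / 2 - 2 ≤ σ) (h2 : σ ≤ s) (hε : ε ≤ 1) (hd : IsSmallData s δ ε h lam)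
    (hA : IsSolution s δ h lam A) (hds : ∀ x, (dh x).IsSymm)
    (hdh : metricNorm δ (s + 1) dh ≠ ⊤) (hdl : formNorm s dlam ≠ ⊤)
    (hdA : connNorm δ (s + 1) dA ≠ ⊤) (hL : SolvesLinearized h lam A dh dlam dA) :
    connNorm δ (σ + 1) dA ≤ linConst d s δ *
      (ENNReal.ofReal ε * (metricNorm δ (σ + 1) dh + formNorm σ dlam)) := by
  have hl : formNorm s lam ≠ ⊤ := ne_top_of_le_ne_top ENNReal.ofReal_ne_top hd.lam_small
  have hl1 : formNorm s lam ≤ 1 := hd.lam_small.trans (by simpa using hε)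
  have hW := P.admWeight h1 h2
  have hfA := P.conn_fl1 (sumNorm_cConn_ne_top hA.2.ne)
  have hfdA := P.conn_fl1 (sumNorm_cConn_ne_top hdA)
  have hfdh : ∀ p, FL1 (cMetric dh p) := fun p =>
    P.fl1_of_ne_top (by linarith) le_rfl (ne_top_of_sumNorm (sumNorm_cMetric_ne_top hdh) p)
  obtain ⟨e1, e2⟩ := hL.complex (hh.bound P).1 hd.symm hds hd.harmonic (hh.fl1 P) hfdh hfA hfdA
  have key := hW.apriori P (hh.dev_fl P) hfdA (ne_top_of_le_ne_top (sumNorm_cConn_ne_top hdA)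
    (Finset.sum_le_sum fun i _ => hW.le_conn P.two_le _)) (hh.dev_small P) e1
  simp only [e2] at key
  have k1 : ∑ α, ∑ β, multiplierNorm (wt (deltaD d δ - 1) σ)
      (fun x => ((linCurv h lam dh dlam α β x).im : ℂ)) ≤ _ :=
    (Finset.sum_le_sum fun α _ => Finset.sum_le_sum fun β _ =>
      multiplierNorm_im hW.measZ hW.evenZ _).trans (hh.sum_linCurv_le P h1 h2
        (fun p => (hfdh p).fl) (sumNorm_cForm_ne_top hl) (sumNorm_cForm_ne_top hdl))
  have k2 := hh.linSource_le P h1 h2 hfdh hfA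
  have k3 := hh.solution_bound P hd hA
  have n1 := (sumNorm_cForm_le s lam).trans (mul_le_mul_right hd.lam_small _)
  have n1' : sumNorm (wt 0 s) (cForm lam) ≤ (d * d : ℕ) * 1 :=
    (sumNorm_cForm_le s lam).trans (mul_le_mul_right hl1 _)
  have n2 := sumNorm_cForm_le σ dlam
  have n3 := sumNorm_cMetric_le (δ := δ) (σ + 1) dh
  set M := metricNorm δ (σ + 1) dh
  set L := formNorm σ dlam
  set e := ENNReal.ofReal ε
  set C := prodConst d s δ
  set N : ℝ≥0∞ := ((d * d : ℕ) : ℝ≥0∞)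
  have k4 : sumNorm (wt (deltaD d δ) (s + 1)) (cConn A) ≤ solConst d s δ * (e * 1) :=
    k3.trans (by gcongr)
  calc _ ≤ sumNorm (wt (deltaD d δ) (σ + 1)) (cConn dA) := tensorNorm_le_sumNorm _
    _ ≤ 2 * (4 * C * (N * e) * (C * (N * 1) * (N * M) + N * L) +
        d * (sourceConst d s δ * (N * M * (solConst d s δ * (e * 1))))) := by
        refine key.trans (mul_le_mul_right (add_le_add (k1.trans ?_)
          (mul_le_mul_right (k2.trans ?_) _)) _) <;> gcongr
    _ ≤ 2 * (4 * C * (N * e) * ((C * N + 1) * (N * (M + L))) +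
        d * (sourceConst d s δ * (N * (M + L) * (solConst d s δ * e)))) := by
        rw [mul_one, mul_one]
        gcongr
        · calc C * N * (N * M) + N * L ≤ C * N * (N * (M + L)) + N * (M + L) := by
                gcongr
                · exact le_self_add
                · exact le_add_self
            _ = _ := by ring
        · exact le_self_add
    _ = _ := by rw [linConst]; ring

end Linearized

/-! ### Convergence of families in multiplier norms -/

/-- Convergence of a family of functions in the norm of a multiplier. -/
def NConv {d : ℕ} {ι : Type*} (W : Rd d → ℝ) (l : Filter ι) (f : ι → Rd d → ℂ) (u : Rd d → ℂ) :
    Prop := Tendsto (fun t => multiplierNorm W (f t - u)) l (𝓝 0)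

section NConv
variable {d : ℕ} {ι : Type*} {W V V₁ V₂ : Rd d → ℝ} {l : Filter ι} {f g : ι → Rd d → ℂ}
  {u v : Rd d → ℂ}

theorem NConv.of_le {F : ι → ℝ≥0∞} (hF : Tendsto F l (𝓝 0))
    (h : ∀ᶠ t in l, multiplierNorm W (f t - u) ≤ F t) : NConv W l f u :=
  tendsto_of_tendsto_of_tendsto_of_le_of_le' tendsto_const_nhds hF (.of_forall fun _ => zero_le) h

theorem NConv.const (u : Rd d → ℂ) : NConv W l (fun _ => u) u := by
  simpa [NConv, multiplierNorm_zero] using tendsto_const_nhds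

theorem NConv.add (hW : Measurable W) (hf : NConv W l f u) (hg : NConv W l g v) :
    NConv W l (fun t => f t + g t) (u + v) := by
  have h : Tendsto (fun t => multiplierNorm W (f t - u) + multiplierNorm W (g t - v)) l (𝓝 0) := by
    simpa using Tendsto.add hf hg
  refine NConv.of_le h (.of_forall fun t => ?_)
  rw [add_sub_add_comm]
  exact multiplierNorm_add_le hW _ _

theorem NConv.neg (hf : NConv W l f u) : NConv W l (fun t => -f t) (-u) := by
  refine NConv.of_le hf (.of_forall fun t => ?_)
  rw [← neg_sub', multiplierNorm_neg]

theorem NConv.sum (hW : Measurable W) {κ : Type*} (s : Finset κ) {f : κ → ι → Rd d → ℂ}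
    {u : κ → Rd d → ℂ} (hf : ∀ i ∈ s, NConv W l (f i) (u i)) :
    NConv W l (fun t => ∑ i ∈ s, f i t) (∑ i ∈ s, u i) := by
  classical
  induction s using Finset.induction_on with
  | empty => simpa using NConv.const (l := l) (W := W) (0 : Rd d → ℂ)
  | insert a s ha ih =>
    simp only [Finset.sum_insert ha]
    exact (hf a (by simp)).add hW (ih fun i hi => hf i (by simp [hi]))

theorem NConv.const_mul (c : ℂ) (hf : NConv W l f u) :
    NConv W l (fun t x => c * f t x) (fun x => c * u x) := by
  have h : Tendsto (fun t => ‖c‖ₑ * multiplierNorm W (f t - u)) l (𝓝 0) := by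
    simpa using ENNReal.Tendsto.const_mul hf (Or.inr enorm_ne_top)
  refine NConv.of_le h (.of_forall fun t => ?_)
  have : (fun x => c * f t x) - (fun x => c * u x) = fun x => c * (f t - u) x := by
    funext x; simp [mul_sub]
  rw [this]
  exact multiplierNorm_const_mul_le _ _ _

theorem NConv.conj (hW : Measurable W) (he : ∀ η, W (-η) = W η) (hf : NConv W l f u) :
    NConv W l (fun t x => (starRingEnd ℂ) (f t x)) (fun x => (starRingEnd ℂ) (u x)) := by
  refine NConv.of_le hf (.of_forall fun t => ?_)
  have : (fun x => (starRingEnd ℂ) (f t x)) - (fun x => (starRingEnd ℂ) (u x)) =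
      fun x => (starRingEnd ℂ) ((f t - u) x) := by
    funext x; simp
  rw [this]
  exact multiplierNorm_conj hW he _

theorem NConv.eventually_ne_top (hf : NConv W l f u) :
    ∀ᶠ t in l, multiplierNorm W (f t - u) ≠ ⊤ :=
  (hf.eventually_lt_const ENNReal.zero_lt_top).mono fun _ h => h.ne

theorem NConv.eventually_le (hW : Measurable W) (hf : NConv W l f u) :
    ∀ᶠ t in l, multiplierNorm W (f t) ≤ multiplierNorm W u + 1 := by
  filter_upwards [hf.eventually_le_const (show (0 : ℝ≥0∞) < 1 by norm_num)] with t ht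
  calc multiplierNorm W (f t) = multiplierNorm W (u + (f t - u)) := by rw [add_sub_cancel]
    _ ≤ _ := (multiplierNorm_add_le hW _ _).trans (add_le_add_right ht _)

/-- Expansion of `f g - u v` around the limit, so that only the finiteness of the limits is required
and no uniform bound on the family. -/
theorem NConv.mul (hW : Measurable W) {C : ℝ≥0∞} (hC : C ≠ ⊤)
    (hb : ∀ {u v : Rd d → ℂ}, FL u → FL v →
      multiplierNorm W (u * v) ≤ C * (multiplierNorm V₁ u * multiplierNorm V₂ v))
    (hu : multiplierNorm V₁ u ≠ ⊤) (hv : multiplierNorm V₂ v ≠ ⊤) (hf : NConv V₁ l f u)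
    (hg : NConv V₂ l g v) : NConv W l (fun t => f t * g t) (u * v) := by
  have h1 : Tendsto (fun t => C * (multiplierNorm V₁ (f t - u) * multiplierNorm V₂ (g t - v)) +
      (C * (multiplierNorm V₁ (f t - u) * multiplierNorm V₂ v) +
        C * (multiplierNorm V₁ u * multiplierNorm V₂ (g t - v)))) l (𝓝 0) := by
    have a1 := ENNReal.Tendsto.const_mul (ENNReal.Tendsto.mul hf (Or.inr (by simp)) hg
      (Or.inr (by simp))) (Or.inr hC)
    have a2 := ENNReal.Tendsto.const_mul (ENNReal.Tendsto.mul_const hf (Or.inr hv)) (Or.inr hC)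
    have a3 := ENNReal.Tendsto.const_mul (ENNReal.Tendsto.const_mul hg (Or.inr hu)) (Or.inr hC)
    simpa using a1.add (a2.add a3)
  refine NConv.of_le h1 ?_
  filter_upwards [hf.eventually_ne_top, hg.eventually_ne_top] with t ht ht'
  have e : f t * g t - u * v = (f t - u) * (g t - v) + ((f t - u) * v + u * (g t - v)) := by ring
  have f1 := fl_of_multiplierNorm_ne_top ht
  have f2 := fl_of_multiplierNorm_ne_top ht'
  rw [e]
  exact (multiplierNorm_add_le hW _ _).trans (add_le_add (hb f1 f2)
    ((multiplierNorm_add_le hW _ _).trans (add_le_add (hb f1 (fl_of_multiplierNorm_ne_top hv))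
      (hb (fl_of_multiplierNorm_ne_top hu) f2))))

theorem NConv.pd (hd : 2 ≤ d) (hV : ∀ η : Rd d, η ≠ 0 → |W η| * ‖η‖ ≤ |V η|)
    (h1 : ∀ {w : Rd d → ℂ}, multiplierNorm V w ≠ ⊤ → FL1 w) (hu : multiplierNorm V u ≠ ⊤)
    (hf : NConv V l f u) (α : Fin d) : NConv W l (fun t => pdC α (f t)) (pdC α u) := by
  refine NConv.of_le hf ?_
  filter_upwards [hf.eventually_ne_top] with t ht
  have f1 := h1 ht
  have f2 := h1 hu
  have e : pdC α (f t) - pdC α u = pdC α (f t - u) := by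
    have := pdC_add f1.differentiable f2.differentiable α
    rw [sub_add_cancel] at this
    rw [this, add_sub_cancel_right]
  rw [e]
  exact multiplierNorm_pd_le hd f1 hV α

/-- Convergence from bounded difference quotients. -/
theorem NConv.of_quotient {f q : ℝ → Rd d → ℂ} {K : ℝ≥0∞} (hK : K ≠ ⊤)
    (hq : ∀ᶠ t in 𝓝[≠] (0 : ℝ), f t - f 0 = fun x => (t : ℂ) * q t x)
    (hb : ∀ᶠ t in 𝓝[≠] (0 : ℝ), multiplierNorm W (q t) ≤ K) : NConv W (𝓝[≠] 0) f (f 0) := by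
  have h0 : Tendsto (fun t : ℝ => ‖(t : ℂ)‖ₑ) (𝓝[≠] 0) (𝓝 0) := by
    have : Continuous fun t : ℝ => ‖(t : ℂ)‖ₑ := by fun_prop
    have := (this.tendsto 0).mono_left (nhdsWithin_le_nhds (s := {0}ᶜ))
    simpa using this
  have h1 : Tendsto (fun t : ℝ => ‖(t : ℂ)‖ₑ * K) (𝓝[≠] 0) (𝓝 0) := by
    simpa using ENNReal.Tendsto.mul_const h0 (Or.inr hK)
  refine NConv.of_le h1 ?_
  filter_upwards [hq, hb] with t ht hbt
  rw [ht]
  exact (multiplierNorm_const_mul_le _ _ _).trans (mul_le_mul_right hbt _)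

theorem NConv.curvForm (hW : Measurable W) {k u v : ι → Fin d × Fin d → Rd d → ℂ}
    {k' u' v' : Fin d × Fin d → Rd d → ℂ}
    (h : ∀ r p q, NConv W l (fun t => k t r * (u t p * fun x => (starRingEnd ℂ) (v t q x)))
      (k' r * (u' p * fun x => (starRingEnd ℂ) (v' q x)))) (α β : Fin d) :
    NConv W l (fun t => _root_.curvForm (k t) (u t) (v t) α β) (_root_.curvForm k' u' v' α β) :=
  NConv.sum hW _ fun _ _ => NConv.sum hW _ fun _ _ => h _ _ _

end NConv

/-! ### Difference quotients of the div-curl system -/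

section Quotient
variable {d : ℕ} {s δ : ℝ}

/-- Resolvent identity `G - G₀ = -G (h - h₀) G₀`, exact and with no remainder. -/
theorem ginv_sub {h h₀ : MetricField d} {x : Rd d} (hu : IsUnit (1 + h x).det)
    (hu₀ : IsUnit (1 + h₀ x).det) : ginv h x - ginv h₀ x = crossInv h h₀ (h - h₀) x := by
  have h1 : ginv h x * (1 + h x) = 1 := Matrix.nonsing_inv_mul _ hu
  have h2 : (1 + h₀ x) * ginv h₀ x = 1 := Matrix.mul_nonsing_inv _ hu₀
  have e : crossInv h h₀ (h - h₀) x =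
      ginv h x * ((1 + h₀ x) * ginv h₀ x) - ginv h x * (1 + h x) * ginv h₀ x := by
    simp only [crossInv, Pi.sub_apply]
    noncomm_ring
  rw [e, h1, h2, Matrix.mul_one, Matrix.one_mul]

/-- The difference quotient of the curvature source. -/
noncomputable def curvQuot (h h₀ : MetricField d) (lam lam₀ : SecondForm d) (hq : MetricField d)
    (lq : SecondForm d) (α β : Fin d) : Rd d → ℂ :=
  curvForm (cMetric (crossInv h h₀ hq)) (cForm lam) (cForm lam) α β +
    (curvForm (cInv h₀) (cForm lq) (cForm lam) α β +
      curvForm (cInv h₀) (cForm lam₀) (cForm lq) α β)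

/-- Telescoping of a trilinear expression, changing one factor at a time; the quotient therefore has
no higher order remainder. -/
theorem curvForm_quot {k k₀ kq u u₀ uq : Fin d × Fin d → Rd d → ℂ} {t : ℝ} {x : Rd d}
    (hk : ∀ p, k p x = k₀ p x + t * kq p x) (hu : ∀ p, u p x = u₀ p x + t * uq p x) (α β : Fin d) :
    curvForm k u u α β x = curvForm k₀ u₀ u₀ α β x + t * (curvForm kq u u α β x +
      (curvForm k₀ uq u α β x + curvForm k₀ u₀ uq α β x)) := by
  simp only [curvForm, Finset.sum_apply, Pi.mul_apply, Finset.mul_sum, ← Finset.sum_add_distrib]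
  refine Finset.sum_congr rfl fun γ _ => Finset.sum_congr rfl fun μ _ => ?_
  simp only [hk, hu, map_add, map_mul, Complex.conj_ofReal]
  ring

variable {h h₀ : MetricField d} {lam lam₀ : SecondForm d} {A A₀ : Connection d} {t : ℝ}

theorem invDev_quot (ht : t ≠ 0) (hu : ∀ x, IsUnit (1 + h x).det)
    (hu₀ : ∀ x, IsUnit (1 + h₀ x).det) (p : Fin d × Fin d) (x : Rd d) :
    invDev h p x = invDev h₀ p x + t * cMetric (crossInv h h₀ (t⁻¹ • (h - h₀))) p x := by
  have h1 := ginv_sub (hu x) (hu₀ x)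
  have h2 : crossInv h h₀ (h - h₀) x = t • crossInv h h₀ (t⁻¹ • (h - h₀)) x := by
    simp only [crossInv, Pi.smul_apply, Matrix.mul_smul, Matrix.smul_mul, smul_neg]
    rw [smul_smul, mul_inv_cancel₀ ht, one_smul]
  have h3 := congrFun (congrFun (h1.trans h2) p.1) p.2
  simp only [Matrix.sub_apply, Matrix.smul_apply, smul_eq_mul] at h3
  show ((ginv h x - 1) p.1 p.2 : ℂ) = ((ginv h₀ x - 1) p.1 p.2 : ℂ) + t * _
  rw [Matrix.sub_apply, Matrix.sub_apply, sub_eq_iff_eq_add.1 h3]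
  push_cast
  ring

theorem conn_quot (A A₀ : Connection d) (t : ℝ) (i : Fin d) : cConn (t⁻¹ • (A - A₀)) i =
    fun x => (t : ℂ)⁻¹ * (cConn A i - cConn A₀ i) x := by
  funext x
  show ((t⁻¹ * (A x i - A₀ x i) : ℝ) : ℂ) = (t : ℂ)⁻¹ * ((A x i : ℂ) - (A₀ x i : ℂ))
  push_cast
  rfl

/-- The system solved by the difference quotients. -/
theorem quotient_system (ht : t ≠ 0) (hu : ∀ x, IsUnit (1 + h x).det)
    (hu₀ : ∀ x, IsUnit (1 + h₀ x).det) (hs : ∀ x, (h x).IsSymm) (hs₀ : ∀ x, (h₀ x).IsSymm)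
    (hg : IsHarmonicGauge h) (hg₀ : IsHarmonicGauge h₀) (hfA : ∀ i, FL1 (cConn A i))
    (hfA₀ : ∀ i, FL1 (cConn A₀ i)) (hA : SolvesDivCurl h lam A) (hA₀ : SolvesDivCurl h₀ lam₀ A₀) :
    ∑ α, pdC α (cConn (t⁻¹ • (A - A₀)) α) =
      -contractGrad (cMetric (crossInv h h₀ (t⁻¹ • (h - h₀)))) (cConn A) -
        contractGrad (invDev h₀) (cConn (t⁻¹ • (A - A₀))) ∧
    ∀ α β, pdC α (cConn (t⁻¹ • (A - A₀)) β) - pdC β (cConn (t⁻¹ • (A - A₀)) α) = fun x =>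
      ((curvQuot h h₀ lam lam₀ (t⁻¹ • (h - h₀)) (t⁻¹ • (lam - lam₀)) α β x).im : ℂ) := by
  have htC : (t : ℂ) ≠ 0 := by exact_mod_cast ht
  obtain ⟨e1, e2⟩ := hA.complex hs hg hfA
  obtain ⟨f1, f2⟩ := hA₀.complex hs₀ hg₀ hfA₀
  have hpd : ∀ α i x, pdC α (cConn (t⁻¹ • (A - A₀)) i) x =
      (t : ℂ)⁻¹ * (pdC α (cConn A i) x - pdC α (cConn A₀ i) x) := fun α i x => by
    rw [conn_quot, pdC_const_mul ((hfA i).differentiable.sub (hfA₀ i).differentiable),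
      pdC_sub (hfA i).differentiable (hfA₀ i).differentiable]
    rfl
  constructor
  · funext x
    have g1 := congrFun e1 x
    have g2 := congrFun f1 x
    simp only [Finset.sum_apply, Pi.sub_apply, Pi.zero_apply, contractGrad, Pi.mul_apply,
      Pi.neg_apply, hpd] at g1 g2 ⊢
    rw [← Finset.mul_sum, Finset.sum_sub_distrib, g1, g2, zero_sub, zero_sub, sub_neg_eq_add,
      neg_add_eq_sub, ← Finset.sum_sub_distrib, Finset.mul_sum, ← Finset.sum_neg_distrib,
      ← Finset.sum_sub_distrib]
    refine Finset.sum_congr rfl fun p _ => ?_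
    -- The splitting `k ∂A - k₀ ∂A₀ = (k - k₀) ∂A + k₀ ∂(A - A₀)` leaves the operator with the
    -- coefficients of `h₀`, the same for all `t`.
    rw [invDev_quot ht hu hu₀ p x]
    field_simp
    ring
  · intro α β
    funext x
    have g1 := congrFun (e2 α β) x
    have g2 := congrFun (f2 α β) x
    have g3 := congrFun (ofReal_normalCurv h lam α β) x
    have g4 := congrFun (ofReal_normalCurv h₀ lam₀ α β) x
    simp only [Pi.sub_apply] at g1 g2
    have key := curvForm_quot (k := cInv h) (k₀ := cInv h₀)
      (kq := cMetric (crossInv h h₀ (t⁻¹ • (h - h₀)))) (u := cForm lam) (u₀ := cForm lam₀)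
      (uq := cForm (t⁻¹ • (lam - lam₀))) (t := t) (x := x)
      (fun p => by rw [cInv_eq, cInv_eq, invDev_quot ht hu hu₀ p x, add_assoc])
      (fun p => by
        show lam x p.1 p.2 = lam₀ x p.1 p.2 + (t : ℂ) * (t⁻¹ • (lam x p.1 p.2 - lam₀ x p.1 p.2))
        rw [Complex.real_smul, Complex.ofReal_inv, mul_inv_cancel_left₀ htC, add_sub_cancel]) α β
    have g5 := congrArg Complex.im key
    rw [Complex.add_im, Complex.im_ofReal_mul] at g5
    rw [Pi.sub_apply, hpd, hpd, ← mul_sub, sub_sub_sub_comm, g1, g2]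
    show (t : ℂ)⁻¹ * ((normalCurv h lam α β x : ℂ) - (normalCurv h₀ lam₀ α β x : ℂ)) = _
    rw [g3, g4, g5]
    push_cast
    rw [add_sub_cancel_left, inv_mul_cancel_left₀ htC]
    rfl

end Quotient

/-! ### Differentiability of the solution along curves of data -/

/-- A curve of small data and solutions, differentiable at `0` with derivative `(dh, dlam)`. -/
structure IsDataCurve {d : ℕ} (s δ : ℝ) (hc : ℝ → MetricField d) (lc : ℝ → SecondForm d)
    (Ac : ℝ → Connection d) (dh : MetricField d) (dlam : SecondForm d) : Prop where
  small : ∀ᶠ t in 𝓝 (0 : ℝ), SmallMetric s δ (hc t)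
  data : ∀ᶠ t in 𝓝 (0 : ℝ), IsSmallData s δ 1 (hc t) (lc t)
  sol : ∀ᶠ t in 𝓝 (0 : ℝ), IsSolution s δ (hc t) (lc t) (Ac t)
  dh_fin : sumNorm (wt (lowExp d δ) (s + 1)) (cMetric dh) ≠ ⊤
  dlam_fin : sumNorm (wt 0 s) (cForm dlam) ≠ ⊤
  h_conv : ∀ p, NConv (wt (lowExp d δ) (s + 1)) (𝓝[≠] 0)
    (fun t : ℝ => cMetric (t⁻¹ • (hc t - hc 0)) p) (cMetric dh p)
  lam_conv : ∀ p, NConv (wt 0 s) (𝓝[≠] 0)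
    (fun t : ℝ => cForm (t⁻¹ • (lc t - lc 0)) p) (cForm dlam p)

section Curve
variable {d : ℕ} {s δ : ℝ} {hc : ℝ → MetricField d} {lc : ℝ → SecondForm d}
  {Ac : ℝ → Connection d} {dh : MetricField d} {dlam : SecondForm d}

theorem NConv.inv_mul_const {ι : Type*} {l : Filter ι} {h : MetricField d} (hh : SmallMetric s δ h)
    (P : Params d s δ) {W : Rd d → ℝ} (hW : Measurable W)
    (hb : ∀ {u v : Rd d → ℂ}, FL u → FL v → multiplierNorm W (u * v) ≤ prodConst d s δ *
      (multiplierNorm (wt (lowExp d δ) (s + 1)) u * multiplierNorm W v))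
    {g : ι → Rd d → ℂ} {v : Rd d → ℂ} (hg : NConv W l g v) (p : Fin d × Fin d) :
    NConv W l (fun t => cInv h p * g t) (cInv h p * v) := by
  have h1 : Tendsto (fun t => 2 * multiplierNorm W (g t - v)) l (𝓝 0) := by
    simpa using ENNReal.Tendsto.const_mul hg (Or.inr (by norm_num : (2 : ℝ≥0∞) ≠ ⊤))
  refine NConv.of_le h1 ?_
  filter_upwards [hg.eventually_ne_top] with t ht
  rw [← mul_sub]
  exact hh.inv_mul_le P hW p fun u hu => hb hu (fl_of_multiplierNorm_ne_top ht)

theorem Params.conn_fl1_of_ne_top (P : Params d s δ) {w : Rd d → ℂ} (hw : multiplierNorm (wt (deltaD d δ) (s + 1)) w ≠ ⊤) :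
    FL1 w :=
  P.fl1_of_ne_top (by have := P.one_sub_deltaD_le; have := P.deltaD_lt; linarith) le_rfl hw

theorem Params.grad_conv (P : Params d s δ) {f : ℝ → Rd d → ℂ} {u : Rd d → ℂ}
    (hu : multiplierNorm (wt (deltaD d δ) (s + 1)) u ≠ ⊤)
    (hf : NConv (wt (deltaD d δ) (s + 1)) (𝓝[≠] 0) f u) (α : Fin d) :
    NConv (wt (deltaD d δ - 1) s) (𝓝[≠] 0) (fun t => pdC α (f t)) (pdC α u) :=
  NConv.pd P.two_le (fun η hη => ((P.admWeight (by have := P.lt_s; linarith) le_rfl).mul_norm η hη).le)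
    P.conn_fl1_of_ne_top hu hf α

namespace IsDataCurve

theorem cross_bound (I : IsDataCurve s δ hc lc Ac dh dlam)
    (P : Params d s δ) : ∃ K : ℝ≥0∞, K ≠ ⊤ ∧ ∀ᶠ t in 𝓝[≠] (0 : ℝ), ∀ p,
    multiplierNorm (wt (lowExp d δ) (s + 1))
      (cMetric (crossInv (hc t) (hc 0) (t⁻¹ • (hc t - hc 0))) p) ≤ K := by
  refine ⟨4 * ∑ p, (multiplierNorm (wt (lowExp d δ) (s + 1)) (cMetric dh p) + 1),
    ENNReal.mul_ne_top (by norm_num) (ENNReal.sum_ne_top.2 fun p _ =>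
      ENNReal.add_ne_top.2 ⟨ne_top_of_sumNorm I.dh_fin p, by norm_num⟩), ?_⟩
  have h1 := eventually_all.2 fun p => (I.h_conv p).eventually_le (measurable_sobolevSymbol _ _)
  filter_upwards [h1, I.small.filter_mono nhdsWithin_le_nhds] with t ht hst p
  have hfl : ∀ p, FL (cMetric (t⁻¹ • (hc t - hc 0)) p) := fun p =>
    fl_of_multiplierNorm_ne_top (ne_top_of_le_ne_top (ENNReal.add_ne_top.2
      ⟨ne_top_of_sumNorm I.dh_fin p, by norm_num⟩) (ht p))
  refine (hst.cross_le I.small.self_of_nhds P (by have := P.lt_s; linarith) le_rfl hfl p).trans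
    (mul_le_mul_right (Finset.sum_le_sum fun p _ => ht p) _)

/-- Bounded difference quotients give continuity at zero. -/
theorem inv_conv (I : IsDataCurve s δ hc lc Ac dh dlam)
    (P : Params d s δ) (p : Fin d × Fin d) : NConv (wt (lowExp d δ) (s + 1)) (𝓝[≠] 0)
    (fun t : ℝ => invDev (hc t) p) (invDev (hc 0) p) := by
  obtain ⟨K, hK, hb⟩ := I.cross_bound P
  refine NConv.of_quotient (f := fun t => invDev (hc t) p) hK ?_ (hb.mono fun t ht => ht p)
  filter_upwards [I.small.filter_mono nhdsWithin_le_nhds, self_mem_nhdsWithin] with t hst ht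
  funext x
  rw [Pi.sub_apply, invDev_quot ht (hst.bound P).1 (I.small.self_of_nhds.bound P).1 p x,
    add_sub_cancel_left]

theorem inv_mul (I : IsDataCurve s δ hc lc Ac dh dlam)
    (P : Params d s δ) {g : ℝ → Rd d → ℂ} {v : Rd d → ℂ}
    (hv : multiplierNorm (wt (lowExp d δ) (s + 1)) v ≠ ⊤)
    (hg : NConv (wt (lowExp d δ) (s + 1)) (𝓝[≠] 0) g v) (p : Fin d × Fin d) :
    NConv (wt (lowExp d δ) (s + 1)) (𝓝[≠] 0) (fun t => cInv (hc t) p * g t) (cInv (hc 0) p * v) := by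
  have hm : Measurable (wt (lowExp d δ) (s + 1) : Rd d → ℝ) := measurable_sobolevSymbol _ _
  simp_rw [cInv_mul_eq]
  exact (hg.const_mul _).add hm (NConv.mul hm P.prodConst_ne_top
    (P.norm_metric_mul_metric (by have := P.lt_s; linarith) le_rfl)
    (ne_top_of_sumNorm (I.small.self_of_nhds.dev_ne_top P) p) hv (I.inv_conv P p) hg)

theorem linInv_ne_top (I : IsDataCurve s δ hc lc Ac dh dlam)
    (P : Params d s δ) (p : Fin d × Fin d) :
    multiplierNorm (wt (lowExp d δ) (s + 1)) (cLinInv (hc 0) dh p) ≠ ⊤ :=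
  ne_top_of_le_ne_top (ENNReal.mul_ne_top (by norm_num) I.dh_fin)
    (I.small.self_of_nhds.linInv_le P (by have := P.lt_s; linarith) le_rfl (fl_of_sumNorm I.dh_fin) p)

/-- The quotient of `g⁻¹` is `-G_t h_t' G_0` with `h_t'` the quotient of `h`; both `G_t` and `h_t'`
converge and the metric space is an algebra. -/
theorem cross_conv (I : IsDataCurve s δ hc lc Ac dh dlam)
    (P : Params d s δ) (p : Fin d × Fin d) : NConv (wt (lowExp d δ) (s + 1)) (𝓝[≠] 0)
    (fun t : ℝ => cMetric (crossInv (hc t) (hc 0) (t⁻¹ • (hc t - hc 0))) p)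
    (cLinInv (hc 0) dh p) := by
  have hm : Measurable (wt (lowExp d δ) (s + 1) : Rd d → ℝ) := measurable_sobolevSymbol _ _
  have hh := I.small.self_of_nhds
  have hs2 : (d : ℝ) / 2 - 2 ≤ s := by have := P.lt_s; linarith
  have hb : ∀ {u v : Rd d → ℂ}, FL u → FL v → _ := fun {u v} hu hv =>
    P.norm_metric_mul_metric (u := u) (v := v) hs2 le_rfl hu hv
  rw [show cLinInv (hc 0) dh p = _ from cCross_eq _ _ dh p]
  simp_rw [cCross_eq]
  refine (NConv.sum hm _ fun m _ => NConv.sum hm _ fun l _ =>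
    I.inv_mul P ?_ (NConv.inv_mul_const hh P hm hb (I.h_conv (l, m)) _) _).neg
  exact ne_top_of_le_ne_top (ENNReal.mul_ne_top (by norm_num) (ne_top_of_sumNorm I.dh_fin (l, m)))
    (hh.inv_mul_le P hm _ fun u hu => hb hu (fl_of_sumNorm I.dh_fin _))

theorem form_fin (I : IsDataCurve s δ hc lc Ac dh dlam) : sumNorm (wt 0 s) (cForm (lc 0)) ≠ ⊤ :=
  sumNorm_cForm_ne_top (ne_top_of_le_ne_top ENNReal.ofReal_ne_top I.data.self_of_nhds.lam_small)

theorem form_conv (I : IsDataCurve s δ hc lc Ac dh dlam) (p : Fin d × Fin d) : NConv (wt 0 s) (𝓝[≠] 0)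
    (fun t : ℝ => cForm (lc t) p) (cForm (lc 0) p) := by
  refine NConv.of_quotient (f := fun t => cForm (lc t) p) (ENNReal.add_ne_top.2
    ⟨ne_top_of_sumNorm I.dlam_fin p, by norm_num⟩) ?_
    ((I.lam_conv p).eventually_le (measurable_sobolevSymbol _ _))
  filter_upwards [self_mem_nhdsWithin] with t ht
  have htC : (t : ℂ) ≠ 0 := by exact_mod_cast ht
  funext x
  show lc t x p.1 p.2 - lc 0 x p.1 p.2 = (t : ℂ) * (t⁻¹ • (lc t x p.1 p.2 - lc 0 x p.1 p.2))
  rw [Complex.real_smul, Complex.ofReal_inv, mul_inv_cancel_left₀ htC]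

theorem curv_conv (I : IsDataCurve s δ hc lc Ac dh dlam)
    (P : Params d s δ) (α β : Fin d) : NConv (wt (deltaD d δ - 1) s) (𝓝[≠] 0)
    (fun t : ℝ => curvQuot (hc t) (hc 0) (lc t) (lc 0) (t⁻¹ • (hc t - hc 0))
      (t⁻¹ • (lc t - lc 0)) α β) (linCurv (hc 0) (lc 0) dh dlam α β) := by
  have hs2 : (d : ℝ) / 2 - 2 ≤ s := by have := P.lt_s; linarith
  have hW := P.admWeight hs2 le_rfl
  have hm0 : Measurable (wt 0 s : Rd d → ℝ) := measurable_sobolevSymbol _ _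
  have hh := I.small.self_of_nhds
  have hprod : ∀ {u v : ℝ → Rd d → ℂ} {u' v' : Rd d → ℂ}, multiplierNorm (wt 0 s) u' ≠ ⊤ →
      multiplierNorm (wt 0 s) v' ≠ ⊤ → NConv (wt 0 s) (𝓝[≠] 0) u u' →
      NConv (wt 0 s) (𝓝[≠] 0) v v' → NConv (wt (deltaD d δ - 1) s) (𝓝[≠] 0)
        (fun t => u t * fun x => (starRingEnd ℂ) (v t x)) (u' * fun x => (starRingEnd ℂ) (v' x)) :=
    fun hu hv cu cv => NConv.mul hW.measZ P.prodConst_ne_top (P.norm_form_mul_form hs2 le_rfl) hu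
      (ne_top_of_le_ne_top hv (multiplierNorm_conj hm0 (sobolevSymbol_neg _ _) _)) cu
      (cv.conj hm0 (sobolevSymbol_neg _ _))
  have hb : ∀ {u v : Rd d → ℂ}, FL u → FL v → _ := fun {u v} hu hv =>
    hW.norm_mul_le (u := u) (v := v) P hu hv
  have hlf := ne_top_of_sumNorm (I.form_fin)
  have hdf := ne_top_of_sumNorm I.dlam_fin
  have hpf : ∀ p q, multiplierNorm (wt (deltaD d δ - 1) s)
      (cForm (lc 0) p * fun x => (starRingEnd ℂ) (cForm (lc 0) q x)) ≠ ⊤ := fun p q =>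
    ne_top_of_le_ne_top (ENNReal.mul_ne_top P.prodConst_ne_top (ENNReal.mul_ne_top (hlf p)
      (ne_top_of_le_ne_top (hlf q) (multiplierNorm_conj hm0 (sobolevSymbol_neg _ _) _))))
      (P.norm_form_mul_form hs2 le_rfl (fl_of_multiplierNorm_ne_top (hlf p))
        (fl_of_multiplierNorm_ne_top (hlf q)).conj)
  refine NConv.add hW.measZ (NConv.curvForm hW.measZ (fun r p q => ?_) α β)
    (NConv.add hW.measZ (NConv.curvForm hW.measZ (fun r p q => ?_) α β)
      (NConv.curvForm hW.measZ (fun r p q => ?_) α β))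
  · exact NConv.mul hW.measZ P.prodConst_ne_top (P.norm_metric_mul_source hs2 le_rfl)
      (I.linInv_ne_top P r) (hpf p q) (I.cross_conv P r)
      (hprod (hlf p) (hlf q) (I.form_conv p) (I.form_conv q))
  · exact NConv.inv_mul_const hh P hW.measZ hb
      (hprod (hdf p) (hlf q) (I.lam_conv p) (I.form_conv q)) r
  · exact NConv.inv_mul_const hh P hW.measZ hb
      (hprod (hlf p) (hdf q) (NConv.const _) (I.lam_conv q)) r

theorem conn_fin (I : IsDataCurve s δ hc lc Ac dh dlam)
    (P : Params d s δ) : ∀ᶠ t in 𝓝 (0 : ℝ),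
    sumNorm (wt (deltaD d δ) (s + 1)) (cConn (Ac t)) ≤ solConst d s δ := by
  filter_upwards [I.small, I.data, I.sol] with t h1 h2 h3
  refine (h1.solution_bound P h2 h3).trans (mul_le_of_le_one_right' ?_)
  have := h2.lam_small
  simpa using this

theorem conn_ne_top (I : IsDataCurve s δ hc lc Ac dh dlam)
    (P : Params d s δ) : ∀ᶠ t in 𝓝 (0 : ℝ),
    sumNorm (wt (deltaD d δ) (s + 1)) (cConn (Ac t)) ≠ ⊤ :=
  (I.conn_fin P).mono fun _ h => ne_top_of_le_ne_top P.solConst_ne_top h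

theorem quot_ne_top (I : IsDataCurve s δ hc lc Ac dh dlam)
    (P : Params d s δ) : ∀ᶠ t in 𝓝 (0 : ℝ),
    sumNorm (wt (deltaD d δ) (s + 1)) (cConn (t⁻¹ • (Ac t - Ac 0))) ≠ ⊤ := by
  filter_upwards [I.conn_ne_top P] with t ht
  have h0 := (I.conn_ne_top P).self_of_nhds
  refine sumNorm_ne_top fun i => ?_
  rw [conn_quot]
  refine ne_top_of_le_ne_top (ENNReal.mul_ne_top enorm_ne_top (ENNReal.add_ne_top.2
    ⟨ne_top_of_sumNorm ht i, ne_top_of_sumNorm h0 i⟩))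
    ((multiplierNorm_const_mul_le _ _ _).trans (mul_le_mul_right
      (multiplierNorm_sub_le (measurable_sobolevSymbol _ _) _ _) _))

theorem system (I : IsDataCurve s δ hc lc Ac dh dlam)
    (P : Params d s δ) : ∀ᶠ t in 𝓝[≠] (0 : ℝ), ∑ α, pdC α (cConn (t⁻¹ • (Ac t - Ac 0)) α) =
      -contractGrad (cMetric (crossInv (hc t) (hc 0) (t⁻¹ • (hc t - hc 0)))) (cConn (Ac t)) -
        contractGrad (invDev (hc 0)) (cConn (t⁻¹ • (Ac t - Ac 0))) ∧
    ∀ α β, pdC α (cConn (t⁻¹ • (Ac t - Ac 0)) β) - pdC β (cConn (t⁻¹ • (Ac t - Ac 0)) α) = fun x =>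
      ((curvQuot (hc t) (hc 0) (lc t) (lc 0) (t⁻¹ • (hc t - hc 0)) (t⁻¹ • (lc t - lc 0))
        α β x).im : ℂ) := by
  filter_upwards [I.small.filter_mono nhdsWithin_le_nhds, I.data.filter_mono nhdsWithin_le_nhds,
    I.sol.filter_mono nhdsWithin_le_nhds, (I.conn_ne_top P).filter_mono nhdsWithin_le_nhds,
    self_mem_nhdsWithin] with t h1 h2 h3 h4 ht
  exact quotient_system ht (h1.bound P).1 (I.small.self_of_nhds.bound P).1 h2.symm
    I.data.self_of_nhds.symm h2.harmonic I.data.self_of_nhds.harmonic (P.conn_fl1 h4)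
    (P.conn_fl1 (I.conn_ne_top P).self_of_nhds) h3.1 I.sol.self_of_nhds.1

/-- The elliptic estimate with coefficients frozen at time zero. Here only a uniform bound on `A_t`
is needed, not its convergence, so there is no circularity: continuity of `A_t` is deduced from this
bound and then gives convergence of the sources. -/
theorem quot_bound (I : IsDataCurve s δ hc lc Ac dh dlam)
    (P : Params d s δ) : ∃ K : ℝ≥0∞, K ≠ ⊤ ∧ ∀ᶠ t in 𝓝[≠] (0 : ℝ),
    sumNorm (wt (deltaD d δ) (s + 1)) (cConn (t⁻¹ • (Ac t - Ac 0))) ≤ K := by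
  obtain ⟨K, hK, hb⟩ := I.cross_bound P
  have hs2 : (d : ℝ) / 2 - 2 ≤ s := by have := P.lt_s; linarith
  have hW := P.admWeight hs2 le_rfl
  have hh := I.small.self_of_nhds
  have hcf : ∀ α β, multiplierNorm (wt (deltaD d δ - 1) s) (linCurv (hc 0) (lc 0) dh dlam α β) ≠ ⊤ := by
    have h1 := hh.sum_linCurv_le P hs2 le_rfl (fl_of_sumNorm I.dh_fin) (I.form_fin) I.dlam_fin
    have h2 := ne_top_of_le_ne_top (by
      have := P.prodConst_ne_top
      have := I.form_fin
      have := I.dh_fin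
      have := I.dlam_fin
      finiteness) h1
    exact fun α β => ENNReal.sum_ne_top.1 (ENNReal.sum_ne_top.1 h2 α (Finset.mem_univ _)) β
      (Finset.mem_univ _)
  refine ⟨2 * (∑ α, ∑ β, (multiplierNorm (wt (deltaD d δ - 1) s)
    (linCurv (hc 0) (lc 0) dh dlam α β) + 1) + d * (prodConst d s δ *
      (∑ _p : Fin d × Fin d, K) * solConst d s δ)), ?_, ?_⟩
  · refine ENNReal.mul_ne_top (by norm_num) (ENNReal.add_ne_top.2 ⟨?_, ?_⟩)
    · exact ENNReal.sum_ne_top.2 fun α _ => ENNReal.sum_ne_top.2 fun β _ =>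
        ENNReal.add_ne_top.2 ⟨hcf α β, by norm_num⟩
    · have h1 : ∑ _p : Fin d × Fin d, K ≠ ⊤ := ENNReal.sum_ne_top.2 fun _ _ => hK
      exact ENNReal.mul_ne_top (ENNReal.natCast_ne_top _) (ENNReal.mul_ne_top
        (ENNReal.mul_ne_top P.prodConst_ne_top h1) P.solConst_ne_top)
  have hcv := eventually_all.2 fun α => eventually_all.2 fun β =>
    (I.curv_conv P α β).eventually_le hW.measZ
  filter_upwards [hb, hcv, I.system P, (I.quot_ne_top P).filter_mono nhdsWithin_le_nhds,
    (I.conn_fin P).filter_mono nhdsWithin_le_nhds] with t h1 h2 ⟨e1, e2⟩ h3 h4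
  have key := hW.apriori P (hh.dev_fl P) (P.conn_fl1 h3) h3 (hh.dev_small P) e1
  refine key.trans (mul_le_mul_right (add_le_add (Finset.sum_le_sum fun α _ =>
    Finset.sum_le_sum fun β _ => ?_) (mul_le_mul_right ?_ _)) _)
  · rw [e2]
    exact (multiplierNorm_im hW.measZ hW.evenZ _).trans (h2 α β)
  · rw [multiplierNorm_neg]
    refine (hW.contractGrad_le P (fun p => fl_of_multiplierNorm_ne_top
      (ne_top_of_le_ne_top hK (h1 p)))
      (P.conn_fl1 (ne_top_of_le_ne_top P.solConst_ne_top h4))).trans ?_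
    exact mul_le_mul' (mul_le_mul_right (Finset.sum_le_sum fun p _ => h1 p) _) h4

theorem conn_conv (I : IsDataCurve s δ hc lc Ac dh dlam)
    (P : Params d s δ) (i : Fin d) : NConv (wt (deltaD d δ) (s + 1)) (𝓝[≠] 0)
    (fun t : ℝ => cConn (Ac t) i) (cConn (Ac 0) i) := by
  obtain ⟨K, hK, hb⟩ := I.quot_bound P
  refine NConv.of_quotient (f := fun t => cConn (Ac t) i) hK ?_
    (hb.mono fun t ht => (le_sumNorm _ i).trans ht)
  filter_upwards [self_mem_nhdsWithin] with t ht
  have htC : (t : ℂ) ≠ 0 := by exact_mod_cast ht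
  funext x
  rw [conn_quot, mul_inv_cancel_left₀ htC]

theorem source_conv (I : IsDataCurve s δ hc lc Ac dh dlam)
    (P : Params d s δ) : NConv (wt (deltaD d δ - 1) s) (𝓝[≠] 0)
    (fun t : ℝ => contractGrad (cMetric (crossInv (hc t) (hc 0) (t⁻¹ • (hc t - hc 0))))
      (cConn (Ac t))) (contractGrad (cLinInv (hc 0) dh) (cConn (Ac 0))) := by
  have hs2 : (d : ℝ) / 2 - 2 ≤ s := by have := P.lt_s; linarith
  have hW := P.admWeight hs2 le_rfl
  have h0 := (I.conn_ne_top P).self_of_nhds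
  refine NConv.sum hW.measZ _ fun p _ => NConv.mul hW.measZ P.prodConst_ne_top
    (P.norm_metric_mul_source hs2 le_rfl) (I.linInv_ne_top P p) ?_ (I.cross_conv P p)
    (P.grad_conv (ne_top_of_sumNorm h0 _) (I.conn_conv P p.2) p.1)
  exact ne_top_of_le_ne_top (ne_top_of_sumNorm h0 p.2)
    (hW.pd_le P.two_le (P.conn_fl1 h0 p.2) p.1)

end IsDataCurve

end Curve

/-! ### The limit of the difference quotients and its equation. -/

section Curve
variable {d : ℕ} {s δ : ℝ} {hc : ℝ → MetricField d} {lc : ℝ → SecondForm d}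
  {Ac : ℝ → Connection d} {dh : MetricField d} {dlam : SecondForm d}

namespace IsDataCurve

/-- Differences of quotients at two times solve the system frozen at time zero, with differences of
convergent sources; so the quotients are Cauchy along the punctured neighbourhood of zero.
Completeness provides a complex limit, and its real part is also a limit since the quotients are
real. -/
theorem exists_deriv (I : IsDataCurve s δ hc lc Ac dh dlam) (P : Params d s δ) :
    ∃ dA : Connection d, sumNorm (wt (deltaD d δ) (s + 1)) (cConn dA) ≠ ⊤ ∧
      ∀ i, NConv (wt (deltaD d δ) (s + 1)) (𝓝[≠] 0)
        (fun t : ℝ => cConn (t⁻¹ • (Ac t - Ac 0)) i) (cConn dA i) := by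
  have hs2 : (d : ℝ) / 2 - 2 ≤ s := by have := P.lt_s; linarith
  have hW := P.admWeight hs2 le_rfl
  have hh := I.small.self_of_nhds
  set F : ℝ → Fin d → Fin d → Rd d → ℂ := fun t => curvQuot (hc t) (hc 0) (lc t) (lc 0)
    (t⁻¹ • (hc t - hc 0)) (t⁻¹ • (lc t - lc 0)) with hF
  set S : ℝ → Rd d → ℂ := fun t =>
    contractGrad (cMetric (crossInv (hc t) (hc 0) (t⁻¹ • (hc t - hc 0)))) (cConn (Ac t)) with hS
  set F₀ := linCurv (hc 0) (lc 0) dh dlam with hF₀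
  set S₀ := contractGrad (cLinInv (hc 0) dh) (cConn (Ac 0)) with hS₀
  set D : ℝ → Fin d → Rd d → ℂ := fun t => cConn (t⁻¹ • (Ac t - Ac 0)) with hD
  set N := multiplierNorm (wt (deltaD d δ - 1) s : Rd d → ℝ) with hN
  set E : ℝ → ℝ≥0∞ := fun t => 2 * (∑ α, ∑ β, N (F t α β - F₀ α β) + d * N (S t - S₀)) with hE
  have hE0 : Tendsto E (𝓝[≠] 0) (𝓝 0) := by
    have h1 : Tendsto (fun t => ∑ α, ∑ β, N (F t α β - F₀ α β)) (𝓝[≠] 0) (𝓝 0) := by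
      simpa using tendsto_finsetSum Finset.univ fun α _ => tendsto_finsetSum Finset.univ fun β _ =>
        I.curv_conv P α β
    have h2 : Tendsto (fun t => (d : ℝ≥0∞) * N (S t - S₀)) (𝓝[≠] 0) (𝓝 0) := by
      simpa using ENNReal.Tendsto.const_mul (I.source_conv P) (Or.inr (ENNReal.natCast_ne_top d))
    simpa using ENNReal.Tendsto.const_mul (h1.add h2) (Or.inr (by norm_num : (2 : ℝ≥0∞) ≠ ⊤))
  have hev := (I.system P).and ((I.quot_ne_top P).filter_mono nhdsWithin_le_nhds)
  have hdiff : ∀ᶠ q in (𝓝[≠] (0 : ℝ)) ×ˢ (𝓝[≠] (0 : ℝ)),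
      sumNorm (wt (deltaD d δ) (s + 1)) (D q.1 - D q.2) ≤ E q.1 + E q.2 := by
    filter_upwards [hev.prod_mk hev] with q hq
    obtain ⟨⟨⟨e1, e2⟩, e3⟩, ⟨f1, f2⟩, f3⟩ := hq
    have g1 := P.conn_fl1 e3
    have g2 := P.conn_fl1 f3
    have hfin : sumNorm (wt (deltaD d δ) (s + 1)) (D q.1 - D q.2) ≠ ⊤ :=
      ne_top_of_le_ne_top (ENNReal.add_ne_top.2 ⟨e3, f3⟩) (sumNorm_sub_le hW.measY _ _)
    have hpd : ∀ α i, pdC α ((D q.1 - D q.2) i) = pdC α (D q.1 i) - pdC α (D q.2 i) := fun α i =>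
      pdC_sub (g1 i).differentiable (g2 i).differentiable α
    have key := hW.apriori P (hh.dev_fl P) (P.conn_fl1 hfin) hfin (hh.dev_small P)
      -- The limit source is inserted so that each term tends to zero on its own.
      (G := (S q.2 - S₀) - (S q.1 - S₀)) (by
        simp_rw [hpd, Finset.sum_sub_distrib, hD, e1, f1]
        rw [contractGrad_sub _ g1 g2]
        abel)
    refine key.trans ?_
    rw [hE, ← mul_add]
    refine mul_le_mul_right ?_ _
    rw [add_add_add_comm, ← mul_add, ← Finset.sum_add_distrib]
    simp_rw [← Finset.sum_add_distrib]
    refine add_le_add (Finset.sum_le_sum fun α _ => Finset.sum_le_sum fun β _ => ?_)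
      (mul_le_mul_right ((multiplierNorm_sub_le hW.measZ _ _).trans (le_of_eq (add_comm _ _))) _)
    have e : pdC α ((D q.1 - D q.2) β) - pdC β ((D q.1 - D q.2) α) =
        fun x => ((((F q.1 α β - F₀ α β) - (F q.2 α β - F₀ α β)) x).im : ℂ) := by
      rw [hpd, hpd, sub_sub_sub_comm, e2, f2]
      funext x
      simp [hF]
    rw [e]
    exact (multiplierNorm_im hW.measZ hW.evenZ _).trans (multiplierNorm_sub_le hW.measZ _ _)
  have hEE : Tendsto (fun q : ℝ × ℝ => E q.1 + E q.2) ((𝓝[≠] 0) ×ˢ (𝓝[≠] 0)) (𝓝 0) := by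
    simpa using (hE0.comp tendsto_fst).add (hE0.comp tendsto_snd)
  choose dC hfin hconv using fun i => P.exists_limit (a := deltaD d δ) (b := s + 1)
    (by have := P.one_sub_deltaD_le; have := P.deltaD_lt; linarith) (by linarith)
    (l := 𝓝[≠] (0 : ℝ)) (f := fun t => D t i)
    (((I.quot_ne_top P).filter_mono nhdsWithin_le_nhds).mono fun t ht => ne_top_of_sumNorm ht i)
    (tendsto_of_tendsto_of_tendsto_of_le_of_le' tendsto_const_nhds hEE
      (.of_forall fun _ => zero_le) (hdiff.mono fun q hq => (le_sumNorm (D q.1 - D q.2) i).trans hq))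
  refine ⟨fun x i => (dC i x).re, sumNorm_ne_top fun i => ne_top_of_le_ne_top (hfin i)
    (multiplierNorm_re hW.measY hW.evenY (dC i)), fun i => NConv.of_le (hconv i)
      (.of_forall fun t => ?_)⟩
  have e : cConn (t⁻¹ • (Ac t - Ac 0)) i - (fun x => ((dC i x).re : ℂ)) =
      fun x => (((D t i - dC i) x).re : ℂ) := by
    funext x
    rw [Pi.sub_apply, Pi.sub_apply, Complex.sub_re, Complex.ofReal_sub]
    rfl
  exact (le_of_eq (congrArg _ e)).trans (multiplierNorm_re hW.measY hW.evenY _)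

theorem hasDerivAt_of_quotient {f : ℝ → ℝ} {q : ℝ → ℝ} {c : ℝ}
    (hq : ∀ t, q t = t⁻¹ * (f t - f 0))
    (h : Tendsto (fun t => (q t : ℂ)) (𝓝[≠] 0) (𝓝 (c : ℂ))) : HasDerivAt f c 0 := by
  rw [hasDerivAt_iff_tendsto_slope_zero]
  have h1 := (Complex.continuous_re.tendsto _).comp h
  simpa [Function.comp_def, hq] using h1

/-- After one derivative the metric norm still has low exponent at most `σ_d` and high exponent `s`,
so it controls the supremum and convergence holds pointwise for values and gradients. -/
theorem isMetricVariation (I : IsDataCurve s δ hc lc Ac dh dlam) (P : Params d s δ) (x : Rd d) :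
    IsMetricVariation hc dh x := by
  have hfl : ∀ᶠ t in 𝓝 (0 : ℝ), ∀ p, FL1 (cMetric (hc t) p) := I.small.mono fun t ht => ht.fl1 P
  have hdfl : ∀ p, FL1 (cMetric dh p) := fun p =>
    P.fl1_of_ne_top (by linarith) le_rfl (ne_top_of_sumNorm I.dh_fin p)
  have h0 := hfl.self_of_nhds
  constructor
  · intro i j
    refine hasDerivAt_of_quotient (q := fun t => t⁻¹ * (hc t x i j - hc 0 x i j)) (fun t => rfl) ?_
    have := P.tendsto_apply le_rfl (by linarith) (I.h_conv (i, j)) x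
    exact this
  · intro γ i j
    refine hasDerivAt_of_quotient (fun t => rfl) ?_
    have h1 : NConv (wt (lowExp d δ - 1) s) (𝓝[≠] 0)
        (fun t : ℝ => pdC γ (cMetric (t⁻¹ • (hc t - hc 0)) (i, j))) (pdC γ (cMetric dh (i, j))) :=
      NConv.pd P.two_le (fun η hη => by
        rw [abs_of_nonneg (wt_nonneg _ _ _), abs_of_nonneg (wt_nonneg _ _ _), wt_mul_norm _ _ hη])
        (fun hw => P.fl1_of_ne_top (by linarith) le_rfl hw) (ne_top_of_sumNorm I.dh_fin _)
        (I.h_conv (i, j)) γ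
    have h2 := P.tendsto_apply (by linarith) le_rfl h1 x
    rw [pdC_cMetric hdfl] at h2
    refine h2.congr' ?_
    filter_upwards [hfl.filter_mono nhdsWithin_le_nhds] with t ht
    have e : cMetric (t⁻¹ • (hc t - hc 0)) (i, j) =
        fun y => (t : ℂ)⁻¹ * (cMetric (hc t) (i, j) - cMetric (hc 0) (i, j)) y := by
      funext y
      show ((t⁻¹ * (hc t y i j - hc 0 y i j) : ℝ) : ℂ) =
        (t : ℂ)⁻¹ * ((hc t y i j : ℂ) - (hc 0 y i j : ℂ))
      push_cast
      rfl
    rw [e, pdC_const_mul ((ht _).differentiable.sub (h0 _).differentiable),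
      pdC_sub (ht _).differentiable (h0 _).differentiable]
    simp only [Pi.sub_apply, pdC_cMetric ht, pdC_cMetric h0]
    push_cast
    rfl

theorem isConnVariation (I : IsDataCurve s δ hc lc Ac dh dlam) (P : Params d s δ)
    {dA : Connection d} (hfin : sumNorm (wt (deltaD d δ) (s + 1)) (cConn dA) ≠ ⊤)
    (hconv : ∀ i, NConv (wt (deltaD d δ) (s + 1)) (𝓝[≠] 0)
        (fun t : ℝ => cConn (t⁻¹ • (Ac t - Ac 0)) i) (cConn dA i)) (x : Rd d) :
    IsConnVariation Ac dA x := by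
  have hfl := (I.conn_ne_top P).mono fun t ht => P.conn_fl1 ht
  have h0 := hfl.self_of_nhds
  have h4 := P.one_sub_deltaD_le
  have h5 := P.deltaD_lt
  constructor
  · intro i
    refine hasDerivAt_of_quotient (q := fun t => t⁻¹ * (Ac t x i - Ac 0 x i)) (fun t => rfl) ?_
    have := P.tendsto_apply (by linarith) (by linarith) (hconv i) x
    exact this
  · intro γ i
    refine hasDerivAt_of_quotient (fun t => rfl) ?_
    have h2 := P.tendsto_apply (by linarith) le_rfl
      (P.grad_conv (ne_top_of_sumNorm hfin i) (hconv i) γ) x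
    rw [pdC_cConn (P.conn_fl1 hfin)] at h2
    refine h2.congr' ?_
    filter_upwards [hfl.filter_mono nhdsWithin_le_nhds] with t ht
    rw [conn_quot, pdC_const_mul ((ht _).differentiable.sub (h0 _).differentiable),
      pdC_sub (ht _).differentiable (h0 _).differentiable]
    simp only [Pi.sub_apply, pdC_cConn ht, pdC_cConn h0]
    push_cast
    rfl

/-- Along the curve the divergence is constantly zero and the curl equals the curvature. Both sides
are differentiable at zero by the chain rule, and uniqueness of derivatives yields the linearized
equations. -/
theorem solvesLinearized (I : IsDataCurve s δ hc lc Ac dh dlam) (P : Params d s δ)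
    {dA : Connection d} (hfin : sumNorm (wt (deltaD d δ) (s + 1)) (cConn dA) ≠ ⊤)
    (hconv : ∀ i, NConv (wt (deltaD d δ) (s + 1)) (𝓝[≠] 0)
        (fun t : ℝ => cConn (t⁻¹ • (Ac t - Ac 0)) i) (cConn dA i)) :
    SolvesLinearized (hc 0) (lc 0) (Ac 0) dh dlam dA := by
  have hh := I.small.self_of_nhds
  have hu := (hh.bound P).1
  have hv := I.isMetricVariation P
  have hvA := I.isConnVariation P hfin hconv
  have hsym : ∀ᶠ t in 𝓝 (0 : ℝ), ∀ x, (hc t x).IsSymm := I.data.mono fun t ht => ht.symm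
  -- Not assumed for the direction: it is inherited as the pointwise derivative of symmetric
  -- matrices.
  have hds : ∀ x, (dh x).IsSymm := fun x => by
    ext i j
    rw [Matrix.transpose_apply]
    refine ((hv x).val j i).unique (((hv x).val i j).congr_of_eventuallyEq ?_)
    filter_upwards [hsym] with t ht
    exact (ht x).apply i j
  have hlv : ∀ x i j, HasDerivAt (fun t => lc t x i j) (dlam x i j) 0 := fun x i j => by
    rw [hasDerivAt_iff_tendsto_slope_zero]
    have := P.tendsto_apply (a := 0) (b := s) (by have := P.two_le_real; have := P.lt_quarter
                                                  simp only [lowExp]; linarith)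
      le_rfl (I.lam_conv (i, j)) x
    simp only [zero_add]
    exact this
  refine (solvesLinearized_iff hu I.data.self_of_nhds.symm hds (hh.fl1 P) (fun p =>
    P.fl1_of_ne_top (by linarith) le_rfl (ne_top_of_sumNorm I.dh_fin p))
    (P.conn_fl1 (I.conn_ne_top P).self_of_nhds) (P.conn_fl1 hfin)).2 ⟨fun x => ?_, fun α β x => ?_⟩
  · refine ((hv x).hasDerivAt_covDiv (hu x) (hvA x)).unique
      ((hasDerivAt_const (0 : ℝ) (0 : ℝ)).congr_of_eventuallyEq ?_)
    filter_upwards [I.sol] with t ht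
    exact ht.1.coulomb x
  · refine ((hvA x).hasDerivAt_covCurl hsym α β).unique
      ((hasDerivAt_normalCurv (hv x).val (hu x) (hlv x) α β).congr_of_eventuallyEq ?_)
    filter_upwards [I.sol] with t ht
    exact ht.1.curl α β x

end IsDataCurve

end Curve

/-! ### The main theorem -/

theorem IsDataCurve.of_small {d : ℕ} {s δ ε : ℝ} (hε : ε ≤ 1)
    (hsm : ∀ h : MetricField d, metricNorm δ (s + 1) h ≤ ENNReal.ofReal ε → SmallMetric s δ h)
    {hc : ℝ → MetricField d} {lc : ℝ → SecondForm d} {Ac : ℝ → Connection d} {dh : MetricField d}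
    {dlam : SecondForm d}
    (hev : ∀ᶠ t in 𝓝 (0 : ℝ), IsSmallData s δ ε (hc t) (lc t) ∧
      IsSolution s δ (hc t) (lc t) (Ac t))
    (hdh : metricNorm δ (s + 1) dh < ⊤) (hdl : formNorm s dlam < ⊤)
    (hh : Tendsto (fun t : ℝ => metricNorm δ (s + 1) (t⁻¹ • (hc t - hc 0) - dh)) (𝓝[≠] 0) (𝓝 0))
    (hl : Tendsto (fun t : ℝ => formNorm s (t⁻¹ • (lc t - lc 0) - dlam)) (𝓝[≠] 0) (𝓝 0)) :
    IsDataCurve s δ hc lc Ac dh dlam where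
  small := hev.mono fun t ht => hsm _ ht.1.h_small
  data := hev.mono fun t ht => ht.1.mono hε
  sol := hev.mono fun t ht => ht.2
  dh_fin := sumNorm_cMetric_ne_top hdh.ne
  dlam_fin := sumNorm_cForm_ne_top hdl.ne
  h_conv p := NConv.of_le hh (.of_forall fun t => by
    have e : cMetric (t⁻¹ • (hc t - hc 0)) p - cMetric dh p =
        cMetric (t⁻¹ • (hc t - hc 0) - dh) p := by
      funext x
      exact (Complex.ofReal_sub _ _).symm
    rw [e]
    exact le_tensorNorm _ p)
  lam_conv p := NConv.of_le hl (.of_forall fun t => by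
    rw [formNorm_eq]
    exact le_tensorNorm (cForm (t⁻¹ • (lc t - lc 0) - dlam)) p)

theorem mainTheorem11 (d : ℕ) (hd : 2 ≤ d) (s : ℝ) (hs : (d : ℝ) / 2 < s) :
    ∃ δ₀ : ℝ, 0 < δ₀ ∧ ∀ δ : ℝ, 0 < δ → δ < δ₀ → ∀ φ : Rd d → ℝ, IsCutoff φ →
      ∃ ε₁ : ℝ, 0 < ε₁ ∧
        -- existence, uniqueness and the bound
        (∃ C : ℝ, 0 < C ∧ ∀ (h : MetricField d) (lam : SecondForm d), IsSmallData s δ ε₁ h lam →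
          ∃ A : Connection d, IsSolution s δ h lam A ∧
            connNorm δ (s + 1) A ≤ ENNReal.ofReal C * formNorm s lam ∧
            ∀ A' : Connection d, IsSolution s δ h lam A' → A' = A) ∧
        -- frequency envelope bounds
        (∀ K : ℝ, 1 ≤ K → ∃ C : ℝ, 0 < C ∧ ∀ ε₀ : ℝ, 0 < ε₀ → ε₀ ≤ ε₁ →
          ∀ (h : MetricField d) (lam : SecondForm d) (A : Connection d) (p : ℕ → ℝ),
            IsSmallData s δ ε₀ h lam → IsSolution s δ h lam A → IsEnvelope φ s δ K lam p →
            ∀ k : ℕ, connNormLP φ k δ (s + 1) A ≤ ENNReal.ofReal (C * ε₀ * p k)) ∧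
        -- bounds for the linearized system
        (∀ σ : ℝ, (d : ℝ) / 2 - 2 < σ → σ ≤ s → ∃ C : ℝ, 0 < C ∧ ∀ ε₀ : ℝ, 0 < ε₀ → ε₀ ≤ ε₁ →
          ∀ (h : MetricField d) (lam : SecondForm d) (A : Connection d)
            (dh : MetricField d) (dlam : SecondForm d) (dA : Connection d),
            IsSmallData s δ ε₀ h lam → IsSolution s δ h lam A →
            (∀ x, (dh x).IsSymm) → metricNorm δ (s + 1) dh < ⊤ → formNorm s dlam < ⊤ →
            connNorm δ (s + 1) dA < ⊤ → SolvesLinearized h lam A dh dlam dA →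
            connNorm δ (σ + 1) dA ≤
              ENNReal.ofReal (C * ε₀) * (metricNorm δ (σ + 1) dh + formNorm σ dlam)) ∧
        -- the derivative of the solution map along any differentiable curve of data exists
        -- and solves the linearized system
        (∀ (hc : ℝ → MetricField d) (lamc : ℝ → SecondForm d) (Ac : ℝ → Connection d)
          (dh : MetricField d) (dlam : SecondForm d),
          (∀ᶠ t in 𝓝 (0 : ℝ), IsSmallData s δ ε₁ (hc t) (lamc t) ∧
            IsSolution s δ (hc t) (lamc t) (Ac t)) →
          metricNorm δ (s + 1) dh < ⊤ → formNorm s dlam < ⊤ →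
          Tendsto (fun t : ℝ => metricNorm δ (s + 1) (t⁻¹ • (hc t - hc 0) - dh))
            (𝓝[≠] 0) (𝓝 0) →
          Tendsto (fun t : ℝ => formNorm s (t⁻¹ • (lamc t - lamc 0) - dlam)) (𝓝[≠] 0) (𝓝 0) →
          ∃ dA : Connection d, connNorm δ (s + 1) dA < ⊤ ∧
            SolvesLinearized (hc 0) (lamc 0) (Ac 0) dh dlam dA ∧
            Tendsto (fun t : ℝ => connNorm δ (s + 1) (t⁻¹ • (Ac t - Ac 0) - dA))
              (𝓝[≠] 0) (𝓝 0)) := by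
  -- The threshold `1/4` gives `16^δ ≤ 2` and bounds the envelope shift `2δ` by `1/2`; it needs no
  -- dependence on `d` or `s`.
  refine ⟨1 / 4, by norm_num, fun δ hδ hδ4 φ hφ => ?_⟩
  have P : Params d s δ := ⟨hd, hs, hδ, hδ4⟩
  obtain ⟨ε₁, hε, hε1, hsm⟩ := P.exists_small
  have hsm' : ∀ {ε₀ : ℝ} {h : MetricField d} {lam : SecondForm d}, ε₀ ≤ ε₁ →
      IsSmallData s δ ε₀ h lam → SmallMetric s δ h := fun hle hdat =>
    hsm _ (hdat.mono hle).h_small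
  refine ⟨ε₁, hε, ⟨(solConst d s δ).toReal + 1, by positivity, fun h lam hdat => ?_⟩,
    fun K _ => ?_, fun σ hσ1 hσ2 => ?_, fun hc lamc Ac dh dlam hev hdh hdl hh hl => ?_⟩
  · have hS := hsm' le_rfl hdat
    have hl := sumNorm_cForm_ne_top (ne_top_of_le_ne_top ENNReal.ofReal_ne_top hdat.lam_small)
    obtain ⟨A, hA, hfin⟩ := hS.exists_solution P hdat.symm hdat.harmonic hdat.ricci hl
    have hsol : IsSolution s δ h lam A := ⟨hA, (connNorm_ne_top hfin).lt_top⟩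
    refine ⟨A, hsol, ?_, fun A' hA' => hS.solution_unique P hA'.1 hA hdat.symm hdat.harmonic
      (sumNorm_cConn_ne_top hA'.2.ne) hfin⟩
    -- Since `ε₁ ≤ 1`, the quadratic bound is used with smallness parameter one, which leaves a
    -- single factor of `‖λ‖`.
    have h1 : connNorm δ (s + 1) A ≤ _ := (tensorNorm_le_sumNorm (cConn A)).trans
      (hS.solution_bound P (hdat.mono hε1) hsol)
    simpa using ENNReal.le_ofReal_of_le_mul P.solConst_ne_top (r := 1) (by simpa using h1)
  · set M : ℝ≥0∞ := 8 * solConst d s δ *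
      (16 * (∑' n : ℤ, ENNReal.ofReal (2 ^ (-(2 * δ * |(n : ℝ)|)))) + 1) with hM
    have hMt : M ≠ ⊤ := by
      have h1 := tsum_rpow_ne_top (r := 2 * δ) (by linarith)
      have h2 := P.solConst_ne_top
      finiteness
    refine ⟨M.toReal + 1, by positivity, fun ε₀ h0 hle h lam A p hdat hA hp k => ?_⟩
    have h1 := (hsm' hle hdat).solution_env_bound P hφ hdat hA hp k
    have h2 := ENNReal.le_ofReal_of_le_mul hMt h1
    rwa [← ENNReal.ofReal_mul (by positivity)] at h2
  · refine ⟨(linConst d s δ).toReal + 1, by positivity,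
      fun ε₀ h0 hle h lam A dh dlam dA hdat hA hds hdh hdl hdA hL => ?_⟩
    exact ENNReal.le_ofReal_of_le_mul P.linConst_ne_top
      ((hsm' hle hdat).linearized_bound P hσ1.le hσ2 (hle.trans hε1) hdat hA hds hdh.ne hdl.ne
        hdA.ne hL)
  · have I := IsDataCurve.of_small hε1 hsm hev hdh hdl hh hl
    obtain ⟨dA, hfin, hconv⟩ := I.exists_deriv P
    refine ⟨dA, (connNorm_ne_top hfin).lt_top, I.solvesLinearized P hfin hconv, ?_⟩
    have h1 : Tendsto (fun t : ℝ => ∑ i, multiplierNorm (wt (deltaD d δ) (s + 1))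
        (cConn (t⁻¹ • (Ac t - Ac 0)) i - cConn dA i)) (𝓝[≠] 0) (𝓝 0) := by
      simpa using tendsto_finsetSum Finset.univ fun i _ => hconv i
    refine tendsto_of_tendsto_of_tendsto_of_le_of_le tendsto_const_nhds h1 (fun _ => zero_le)
      fun t => (tensorNorm_le_sumNorm _).trans (Finset.sum_le_sum fun i _ => le_of_eq ?_)
    congr 1
    funext x
    exact Complex.ofReal_sub _ _
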